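/- Let $k\ge 1$ and let $\alpha_1,\dots,\alpha_k,\beta_1,\dots,\beta_k>0$ satisfy $\alpha_1\cdots\alpha_k=\beta_1\cdots\beta_k$. Put $$\Phi(z)=\frac{1}{(1-z^{-1})^k}\prod_{m=1}^k\begin{pmatrix}1&\alpha_m z^{-1}\\ \alpha_m^{-1}&1\end{pmatrix}\begin{pmatrix}1&\beta_m z^{-1}\\ \beta_m^{-1}&1\end{pmatrix},\qquad p(z)=\big((z-1)^k\operatorname{Tr}\Phi(z)\big)^2-4(z-1)^{2k}.$$ Then $p$ is a real polynomial of degree $2k-1$ whose zeros are real, non-positive and of order at most two. Write $p=q^2p_0$ with $q$ monic and $p_0$ having only simple zeros $0=x_0>x_1>\dots>x_{2(k'-1)}$, where $\deg p_0=2k'-1$. Let $\mathcal R$ be the compact Riemann surface consisting of the curve $\{(z,w)\in\mathbb C^2: w^2=p_0(z)\}$ and one point $(\infty,\infty)$. Let $C^+=\bigcup_{\ell=0}^{k'-1}C^+_\ell$, where $C_0^+=\{(z,w)\in\mathcal R: z\in[0,\infty)\}\cup\{(\infty,\infty)\}$ and $C^+_\ell=\{(z,w)\in\mathcal R: z\in[x_{2\ell},x_{2\ell-1}]\}$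 for $1\le\ell\le k'-1$. Let $p_0^{1/2}$ be the analytic continuation of $t\mapsto p_0(t)^{1/2}$, $t>0$, to $\mathbb C\setminus\big((-\infty,x_{2(k'-1)}]\cup\bigcup_{\ell=0}^{k'-2}[x_{2\ell+1},x_{2\ell}]\big)$, and let $\mathcal R_{12}\subset\mathcal R$ be the interior of the closure, in $\mathcal R$, of $$\{(z,p_0(z)^{1/2}):\operatorname{Im}z>0\}\cup\{(z,-p_0(z)^{1/2}):\operatorname{Im}z<0\}.$$ For $(\chi,\eta)\in(-1,1)^2$ consider on $\mathcal R$ the multi-valued function $$F(z,w;\chi,\eta)=\frac k4(\eta+1)\log z-\frac k2\log(z-1)-\frac\chi2\log\rho(z,w),\qquad \rho(z,w)=\frac12\operatorname{Tr}\Phi(z)+\frac{q(z)w}{2(z-1)^k}.$$ A critical point of $F$ is a point of $\mathcal R$ at which the derivative of $F$ (of any local analytic branch, in a local coordinate) vanishes; the points with $z\in\{0,1,\infty\}$, where $F$ has logarithmic singularities, are not critical. Let $\mathcal G_R$ (the rough region) be the set of $(\chi,\eta)\in(-1,1)^2$ for which $F(\cdot\,;\chi,\eta)$ has a critical point in $\mathcal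 R\setminus C^+$. **Proposition.** For each $(\chi,\eta)\in\mathcal G_R$ there is a unique critical point $(z,w)$ of $F(\cdot\,;\chi,\eta)$ in $\mathcal R_{12}$. Moreover $\mathcal G_R$ is open in $\mathbb R^2$, $\mathcal R_{12}$ is open in $\mathcal R$ and does not contain $(\infty,\infty)$, and the map $L:\mathcal G_R\to\mathcal R_{12}$, $L(\chi,\eta)=(z,w)$, is a ($C^\infty$) diffeomorphism: it is a bijection, and both $L$ and $L^{-1}$ are smooth. -/

import Mathlib

open scoped ContDiff Topology

noncomputable section

namespace Aztec

/-! ### The symbol and its discriminant -/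

/-- The matrix `(1, a z⁻¹; a⁻¹, 1)`. -/
def symbolFactor (a : ℝ) (z : ℂ) : Matrix (Fin 2) (Fin 2) ℂ :=
  !![1, (a : ℂ) * z⁻¹; (a : ℂ)⁻¹, 1]

/-- The matrix-valued weight
`Φ(z) = (1 - z⁻¹)^(-k) ∏ₘ (1, αₘ z⁻¹; αₘ⁻¹, 1) (1, βₘ z⁻¹; βₘ⁻¹, 1)` (ordered product),
to be used for `z ∉ {0, 1}`. -/
def Phi {k : ℕ} (α β : Fin k → ℝ) (z : ℂ) : Matrix (Fin 2) (Fin 2) ℂ :=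
  ((1 - z⁻¹) ^ k)⁻¹ •
    (List.ofFn fun m : Fin k => symbolFactor (α m) z * symbolFactor (β m) z).prod

/-- The polynomial matrix `(z - 1)^k Φ(z)`; see `Phi_eq`. -/
def PhiPoly {k : ℕ} (α β : Fin k → ℝ) : Matrix (Fin 2) (Fin 2) (Polynomial ℝ) :=
  (List.ofFn fun m : Fin k =>
    (!![Polynomial.X + Polynomial.C (α m * (β m)⁻¹), Polynomial.C (α m + β m);
        Polynomial.C ((α m)⁻¹ + (β m)⁻¹) * Polynomial.X,
        Polynomial.X + Polynomial.C ((α m)⁻¹ * β m)] :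
      Matrix (Fin 2) (Fin 2) (Polynomial ℝ))).prod

/-- The discriminant `p(z) = ((z - 1)^k Tr Φ(z))² - 4 (z - 1)^(2k)`, as a polynomial;
see `eval_discPoly`. -/
def discPoly {k : ℕ} (α β : Fin k → ℝ) : Polynomial ℝ :=
  (PhiPoly α β).trace ^ 2 - 4 * (Polynomial.X - 1) ^ (2 * k)

theorem Phi_eq {k : ℕ} (α β : Fin k → ℝ) {z : ℂ} (h0 : z ≠ 0) (h1 : z ≠ 1) :
    (PhiPoly α β).map (Polynomial.aeval z) = (z - 1) ^ k • Phi α β z := by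
  have hz : (1 - z⁻¹) ≠ 0 := by
    intro h
    apply h1
    field_simp at h
    linear_combination h
  have key : z - 1 = z * (1 - z⁻¹) := by field_simp
  rw [Phi, smul_smul, key, mul_pow, mul_assoc, mul_inv_cancel₀ (pow_ne_zero _ hz), mul_one]
  clear key hz h1
  unfold PhiPoly
  induction k with
  | zero =>
    simp only [List.ofFn_zero, List.prod_nil, pow_zero, one_smul]
    exact (RingHom.mapMatrix (Polynomial.aeval z : Polynomial ℝ →ₐ[ℝ] ℂ).toRingHom).map_one
  | succ n ih =>
    rw [List.ofFn_succ, List.ofFn_succ, List.prod_cons, List.prod_cons, pow_succ', mul_smul,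
      Matrix.map_mul, ih (fun i => α i.succ) (fun i => β i.succ)]
    rw [Matrix.mul_smul, smul_comm (z) (z ^ n), ← Matrix.smul_mul z]
    refine congrArg (fun A => z ^ n • (A * _)) ?_
    ext i j
    fin_cases i <;> fin_cases j <;>
      simp [symbolFactor] <;> field_simp <;> ring

theorem eval_discPoly {k : ℕ} (α β : Fin k → ℝ) {z : ℂ} (h0 : z ≠ 0) (h1 : z ≠ 1) :
    Polynomial.aeval z (discPoly α β)
      = ((z - 1) ^ k * (Phi α β z).trace) ^ 2 - 4 * (z - 1) ^ (2 * k) := by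
  have h : Polynomial.aeval z (PhiPoly α β).trace = (z - 1) ^ k * (Phi α β z).trace := by
    rw [← smul_eq_mul, ← Matrix.trace_smul, ← Phi_eq α β h0 h1]
    simp [Matrix.trace, Fin.sum_univ_two]
  have h4 : Polynomial.aeval z (4 : Polynomial ℝ) = 4 := map_ofNat _ 4
  rw [discPoly, map_sub, map_pow, h, map_mul, h4, map_pow, map_sub, Polynomial.aeval_X, map_one]

/-! ### The factorization `p = q² p₀` -/

/-- `(p₀, q)` is the factorization `p = q² p₀` with `p₀` having only simple zeros and `q` having
leading coefficient one. For `p ≠ 0` there is exactly one such pair. -/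
def IsSquarefreeFactorization (p : Polynomial ℝ) (P : Polynomial ℝ × Polynomial ℝ) : Prop :=
  p = P.2 ^ 2 * P.1 ∧ Squarefree P.1 ∧ P.2.Monic

theorem exists_squarefreeFactorization (p : Polynomial ℝ) (hp : p ≠ 0) :
    ∃ P, IsSquarefreeFactorization p P := by
  induction h : p.natDegree using Nat.strong_induction_on generalizing p with
  | _ n ih =>
    by_cases hs : Squarefree p
    · exact ⟨(p, 1), by simp, hs, Polynomial.monic_one⟩
    · unfold Squarefree at hs
      push Not at hs
      obtain ⟨x, ⟨r, hr⟩, hx⟩ := hs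
      have hx0 : x ≠ 0 := by rintro rfl; simp at hr; exact hp hr
      have hr0 : r ≠ 0 := by rintro rfl; simp at hr; exact hp hr
      have hxd : 0 < x.natDegree := by
        by_contra hd
        apply hx
        rw [Polynomial.eq_C_of_natDegree_eq_zero (by omega : x.natDegree = 0)] at hx0 ⊢
        exact Polynomial.isUnit_C.mpr (isUnit_iff_ne_zero.mpr (by simpa using hx0))
      have hd : r.natDegree < n := by
        rw [← h, hr, Polynomial.natDegree_mul (mul_ne_zero hx0 hx0) hr0,
          Polynomial.natDegree_mul hx0 hx0]
        omega
      obtain ⟨P, h1, h2, h3⟩ := ih _ hd r hr0 rfl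
      have hl : x.leadingCoeff ≠ 0 := Polynomial.leadingCoeff_ne_zero.mpr hx0
      have hu : IsUnit (Polynomial.C (x.leadingCoeff ^ 2)) :=
        Polynomial.isUnit_C.mpr (isUnit_iff_ne_zero.mpr (pow_ne_zero _ hl))
      refine ⟨(Polynomial.C (x.leadingCoeff ^ 2) * P.1,
        (x * Polynomial.C (x.leadingCoeff)⁻¹) * P.2), ?_, ?_, ?_⟩
      · have : (Polynomial.C (x.leadingCoeff)⁻¹) ^ 2 * Polynomial.C (x.leadingCoeff ^ 2)
            = (1 : Polynomial ℝ) := by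
          rw [← Polynomial.C_pow, ← Polynomial.C_mul, inv_pow,
            inv_mul_cancel₀ (pow_ne_zero _ hl), Polynomial.C_1]
        rw [hr, h1]
        linear_combination (-(x * x * (P.2 ^ 2 * P.1))) * this
      · exact h2.squarefree_of_dvd (hu.mul_left_dvd.mpr dvd_rfl)
      · exact (Polynomial.monic_mul_leadingCoeff_inv hx0).mul h3

theorem discPoly_ne_zero {k : ℕ} (hk : 0 < k) (α β : Fin k → ℝ)
    (hα : ∀ m, 0 < α m) (hβ : ∀ m, 0 < β m) : discPoly α β ≠ 0 := by
  have key : ∀ (n : ℕ) (a b : Fin n → ℝ), (∀ m, 0 < a m) → (∀ m, 0 < b m) →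
      0 < ((PhiPoly a b) 0 0).eval 1 ∧ 0 ≤ ((PhiPoly a b) 0 1).eval 1 ∧
      0 ≤ ((PhiPoly a b) 1 0).eval 1 ∧ 0 < ((PhiPoly a b) 1 1).eval 1 := by
    intro n
    induction n with
    | zero => intro a b _ _; simp [PhiPoly]
    | succ n ih =>
      intro a b ha hb
      obtain ⟨i1, i2, i3, i4⟩ := ih (fun i => a i.succ) (fun i => b i.succ)
        (fun i => ha i.succ) (fun i => hb i.succ)
      have ha0 := ha 0
      have hb0 := hb 0
      rw [show PhiPoly a b = _ * PhiPoly (fun i : Fin n => a i.succ) (fun i => b i.succ) by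
        rw [PhiPoly, List.ofFn_succ, List.prod_cons]; rfl]
      generalize PhiPoly (fun i : Fin n => a i.succ) (fun i => b i.succ) = M at i1 i2 i3 i4 ⊢
      simp only [Matrix.mul_apply, Fin.sum_univ_two, Polynomial.eval_add, Polynomial.eval_mul]
      refine ⟨?_, ?_, ?_, ?_⟩ <;> simp <;> positivity
  obtain ⟨h1, -, -, h4⟩ := key k α β hα hβ
  intro h
  have he : (discPoly α β).eval 1 = 0 := by rw [h, Polynomial.eval_zero]
  have h2k : 2 * k ≠ 0 := by omega
  simp [discPoly, Matrix.trace, Fin.sum_univ_two, hk.ne'] at he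
  linarith

/-- The pair `(p₀, q)`. -/
def factorPair {k : ℕ} (α β : Fin k → ℝ) : Polynomial ℝ × Polynomial ℝ :=
  Classical.epsilon (IsSquarefreeFactorization (discPoly α β))

/-- The polynomial `p₀`. -/
def p0 {k : ℕ} (α β : Fin k → ℝ) : Polynomial ℝ := (factorPair α β).1

/-- The polynomial `q`. -/
def q {k : ℕ} (α β : Fin k → ℝ) : Polynomial ℝ := (factorPair α β).2

theorem factorPair_spec {k : ℕ} (hk : 0 < k) (α β : Fin k → ℝ)
    (hα : ∀ m, 0 < α m) (hβ : ∀ m, 0 < β m) :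
    discPoly α β = q α β ^ 2 * p0 α β ∧ Squarefree (p0 α β) ∧ (q α β).Monic :=
  Classical.epsilon_spec (exists_squarefreeFactorization _ (discPoly_ne_zero hk α β hα hβ))

/-- The zeros `0 = x₀ > x₁ > ⋯ > x_{2(k'-1)}` of `p₀` in decreasing order. -/
def x {k : ℕ} (α β : Fin k → ℝ) (l : ℕ) : ℝ :=
  ((p0 α β).roots.sort (· ≥ ·)).getD l 0

/-- The number `k'`, given by `deg p₀ = 2 k' - 1`. -/
def kPrime {k : ℕ} (α β : Fin k → ℝ) : ℕ := ((p0 α β).natDegree + 1) / 2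

/-! ### The Riemann surface -/

/-- The affine curve `{(z, w) ∈ ℂ² : w² = p₀(z)}`. -/
abbrev Curve {k : ℕ} (α β : Fin k → ℝ) : Type :=
  {P : ℂ × ℂ // P.2 ^ 2 - Polynomial.aeval P.1 (p0 α β) = 0}

/-- The compact Riemann surface `ℛ`: the affine curve together with the point `(∞, ∞)`.
Since `deg p₀` is odd there is one point at infinity, so topologically `ℛ` is the one-point
compactification of the affine curve. -/
abbrev Surface {k : ℕ} (α β : Fin k → ℝ) : Type := OnePoint (Curve α β)

/-- The loops `C₀⁺ = {z ∈ [0, ∞)} ∪ {(∞, ∞)}` and `C_ℓ⁺ = {z ∈ [x_{2ℓ}, x_{2ℓ-1}]}` for `ℓ ≥ 1`. -/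
def loop {k : ℕ} (α β : Fin k → ℝ) : ℕ → Set (Surface α β)
  | 0 => insert OnePoint.infty
      {P | ∃ S : Curve α β, P = ↑S ∧ ∃ t : ℝ, 0 ≤ t ∧ S.1.1 = t}
  | l + 1 => {P | ∃ S : Curve α β, P = ↑S ∧
      ∃ t : ℝ, t ∈ Set.Icc (x α β (2 * (l + 1))) (x α β (2 * (l + 1) - 1)) ∧ S.1.1 = t}

/-- `C⁺ = C₀⁺ ∪ ⋯ ∪ C_{k'-1}⁺`. -/
def realLocus {k : ℕ} (α β : Fin k → ℝ) : Set (Surface α β) :=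
  ⋃ l ∈ Finset.range (kPrime α β), loop α β l

/-- The cuts `(-∞, x_{2(k'-1)}] ∪ ⋃_{ℓ=0}^{k'-2} [x_{2ℓ+1}, x_{2ℓ}]`. -/
def cuts {k : ℕ} (α β : Fin k → ℝ) : Set ℝ :=
  Set.Iic (x α β (2 * (kPrime α β - 1))) ∪
    ⋃ l ∈ Finset.range (kPrime α β - 1), Set.Icc (x α β (2 * l + 1)) (x α β (2 * l))

/-- `g` is an analytic continuation of `t ↦ p₀(t)^{1/2}`, `t > 0`, to the plane slit along
the cuts. -/
def IsSqrtContinuation {k : ℕ} (α β : Fin k → ℝ) (g : ℂ → ℂ) : Prop :=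
  DifferentiableOn ℂ g ((fun t : ℝ => (t : ℂ)) '' cuts α β)ᶜ ∧
    ∀ t : ℝ, 0 < t → g t = (Real.sqrt ((p0 α β).eval t) : ℂ)

/-- The branch `p₀^{1/2}` on the slit plane (its values on the cuts are irrelevant here). -/
def sqrtP0 {k : ℕ} (α β : Fin k → ℝ) : ℂ → ℂ := Classical.epsilon (IsSqrtContinuation α β)

/-- The region `ℛ₁₂`: the interior of the closure, in `ℛ`, of the union of the upper half plane
of the first sheet and the lower half plane of the second sheet. -/
def R12 {k : ℕ} (α β : Fin k → ℝ) : Set (Surface α β) :=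
  interior (closure {P | ∃ S : Curve α β, P = ↑S ∧
    ((0 < S.1.1.im ∧ S.1.2 = sqrtP0 α β S.1.1) ∨
      (S.1.1.im < 0 ∧ S.1.2 = -sqrtP0 α β S.1.1))})

/-! ### The action function, its critical points and the rough region -/

/-- The meromorphic function `ρ(z, w) = Tr Φ(z) / 2 + q(z) w / (2 (z - 1)^k)`. -/
def rho {k : ℕ} (α β : Fin k → ℝ) (P : ℂ × ℂ) : ℂ :=
  (Phi α β P.1).trace / 2 + Polynomial.aeval P.1 (q α β) * P.2 / (2 * (P.1 - 1) ^ k)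

/-- `γ` is (the inverse of) a holomorphic chart of the affine curve, centred at `S`. -/
def IsLocalParam {k : ℕ} (α β : Fin k → ℝ) (S : Curve α β) (γ : ℂ → ℂ × ℂ) : Prop :=
  AnalyticAt ℂ γ 0 ∧ γ 0 = S.1 ∧ deriv γ 0 ≠ 0 ∧
    ∀ᶠ t in 𝓝 (0 : ℂ), (γ t).2 ^ 2 - Polynomial.aeval (γ t).1 (p0 α β) = 0

/-- `f` is, near `0`, an analytic branch of `log (h)`. -/
def IsLogBranch (h f : ℂ → ℂ) : Prop :=
  AnalyticAt ℂ f 0 ∧ ∀ᶠ t in 𝓝 (0 : ℂ), Complex.exp (f t) = h t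

/-- `f` is, near `0`, a branch of the multi-valued function
`F(z, w; χ, η) = (k/4) (η + 1) log z - (k/2) log (z - 1) - (χ/2) log ρ(z, w)`
read in the local coordinate given by `γ`; here `v = (χ, η)`. -/
def IsBranchOfF {k : ℕ} (α β : Fin k → ℝ) (v : ℝ × ℝ) (γ : ℂ → ℂ × ℂ) (f : ℂ → ℂ) : Prop :=
  ∃ a b c : ℂ → ℂ,
    IsLogBranch (fun t => (γ t).1) a ∧
    IsLogBranch (fun t => (γ t).1 - 1) b ∧
    IsLogBranch (fun t => rho α β (γ t)) c ∧
    f = fun t => (k : ℂ) / 4 * ((v.2 : ℂ) + 1) * a t - (k : ℂ) / 2 * b t - (v.1 : ℂ) / 2 * c t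

/-- `P` is a critical point of `F(· ; χ, η)`, `v = (χ, η)`: the derivative of `F` in a local
coordinate centred at `P` vanishes. (This does not depend on the coordinate or on the branch.)
The points of `ℛ` with `z ∈ {0, 1, ∞}` are not critical points: `F` has no
local branch there, its differential having a pole with non-zero residue for
`(χ, η) ∈ (-1, 1)²`. -/
def IsCriticalPoint {k : ℕ} (α β : Fin k → ℝ) (v : ℝ × ℝ) (P : Surface α β) : Prop :=
  ∃ S : Curve α β, P = ↑S ∧ S.1.1 ≠ 0 ∧ S.1.1 ≠ 1 ∧
    ∃ γ f, IsLocalParam α β S γ ∧ IsBranchOfF α β v γ f ∧ deriv f 0 = 0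

/-- The rough region `𝒢_R`: those `(χ, η) ∈ (-1, 1)²` for which `F` has a critical point in
`ℛ \ C⁺`. -/
def roughRegion {k : ℕ} (α β : Fin k → ℝ) : Set (ℝ × ℝ) :=
  {v | v ∈ Set.Ioo (-1 : ℝ) 1 ×ˢ Set.Ioo (-1 : ℝ) 1 ∧
    ∃ P : Surface α β, P ∉ realLocus α β ∧ IsCriticalPoint α β v P}

/-! ### Diffeomorphisms onto regions of the surface -/

/-- The embedding of the affine part of `ℛ` into `ℂ²` (with a junk value at infinity). -/
def affineCoord {k : ℕ} (α β : Fin k → ℝ) (P : Surface α β) : ℂ × ℂ :=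
  OnePoint.elim P (0, 0) Subtype.val

/-- `L` is a diffeomorphism (of class `C^∞`) from the open set `G ⊆ ℝ²` onto the open subset `V`
of the affine part of `ℛ`. The affine part is a smooth submanifold of `ℂ²`, so `L` is smooth when
it is smooth as a map into `ℂ²`, and `L⁻¹` is smooth when it extends, near each point of `V`,
to a smooth map on an open subset of `ℂ²`. -/
def IsDiffeomorphism {k : ℕ} (α β : Fin k → ℝ) (L : ℝ × ℝ → Surface α β)
    (G : Set (ℝ × ℝ)) (V : Set (Surface α β)) : Prop :=
  IsOpen G ∧ IsOpen V ∧ OnePoint.infty ∉ V ∧ Set.BijOn L G V ∧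
    ContDiffOn ℝ ∞ (fun v => affineCoord α β (L v)) G ∧
    ∀ P ∈ V, ∃ U : Set (ℂ × ℂ), IsOpen U ∧ affineCoord α β P ∈ U ∧
      ∃ g : ℂ × ℂ → ℝ × ℝ, ContDiffOn ℝ ∞ g U ∧
        ∀ v ∈ G, affineCoord α β (L v) ∈ U → g (affineCoord α β (L v)) = v

end Aztec

end

namespace Aztec

open Polynomial

/-! ### The polynomial transfer matrix -/

/-! Write T for the trace polynomial `trPoly` and m = k' - 1. There is a polynomial n with q n = (z
- 1) T' - k T and d log ρ = n dz / ((z - 1) w), so criticality becomes k ((η - 1) z - (η + 1)) w = 2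
χ z n(z) (`CritEq`). This equation is real-affine in (χ, η): it says η = (z + 1)/(z - 1) + (2χ/k) Y,
with Y = z n / ((z - 1) w) (`logDer`). If Im Y ≠ 0, its imaginary part determines χ and its real
part then determines η. This is the inverse map `critParam`, visibly smooth.

For the other direction, squaring the equation, using w² = p₀(z) and cancelling z gives a real
polynomial `critPoly` of degree at most 2m + 2. The polynomial n has a zero in each of the m gaps
(x_{2l+2}, x_{2l+1}). For χ ≠ 0 the squared polynomial is positive at both ends of a gap and
nonpositive at the zero of n, hence has two zeros in each gap. At most one conjugate pair of
non-real zeros remains, and such zeros are simple (`critPoly_nonreal`). For χ = 0 the equation is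
solved directly. Positivity of the same polynomial at well-chosen nonnegative points forces (χ, η) ∈
(-1, 1)² and Im Y ≠ 0 off the real locus. Complex conjugation of the curve reverses the sign of Im
Y, and `R12` is exactly one of the two sets ± Im Y > 0 (`exists_R12_eq`). It therefore contains one
critical point of each conjugate pair. Simplicity makes the Jacobian of the system nonzero
(`jacobian_ne_zero`), and the implicit function theorem gives smoothness of L and openness of the
rough region.

The zeros of n come from the spectral structure of the transfer matrix. Off (-∞, 0] each factor
strictly increases an indefinite hermitian form relative to the modulus of its determinant, which
excludes zeros of the discriminant there (`discPoly_zero_real`). On the negative axis the transfer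
matrix rotates vectors in a fixed direction, so multiple zeros of the discriminant are strict local
maxima (`discPoly_double_zero`), and q has no zeros in the gaps. Rolle's theorem for p / (z -
1)^(2k) then produces the zeros of n. -/

/-- One factor of the ordered product `PhiPoly`. -/
noncomputable def stepPoly (a b : ℝ) : Matrix (Fin 2) (Fin 2) ℝ[X] :=
  !![X + C (a * b⁻¹), C (a + b); C (a⁻¹ + b⁻¹) * X, X + C (a⁻¹ * b)]

theorem PhiPoly_zero (α β : Fin 0 → ℝ) : PhiPoly α β = 1 := by simp [PhiPoly]

theorem PhiPoly_succ {n : ℕ} (α β : Fin (n + 1) → ℝ) :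
    PhiPoly α β = stepPoly (α 0) (β 0) *
      PhiPoly (fun i : Fin n => α i.succ) (fun i => β i.succ) := by
  rw [PhiPoly, List.ofFn_succ, List.prod_cons]; rfl

theorem det_stepPoly {a b : ℝ} (ha : 0 < a) (hb : 0 < b) :
    (stepPoly a b).det = (X - 1) ^ 2 := by
  apply Polynomial.funext
  intro t
  simp [stepPoly, Matrix.det_fin_two]
  field_simp
  ring

theorem det_PhiPoly {k : ℕ} (α β : Fin k → ℝ) (hα : ∀ m, 0 < α m) (hβ : ∀ m, 0 < β m) :
    (PhiPoly α β).det = (X - 1) ^ (2 * k) := by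
  induction k with
  | zero => simp [PhiPoly_zero]
  | succ n ih =>
    rw [PhiPoly_succ, Matrix.det_mul, det_stepPoly (hα 0) (hβ 0),
      ih _ _ (fun i => hα i.succ) (fun i => hβ i.succ)]
    ring

theorem discPoly_eq {k : ℕ} (α β : Fin k → ℝ) (hα : ∀ m, 0 < α m) (hβ : ∀ m, 0 < β m) :
    discPoly α β = (PhiPoly α β 0 0 - PhiPoly α β 1 1) ^ 2 +
      4 * (PhiPoly α β 0 1 * PhiPoly α β 1 0) := by
  rw [discPoly, ← det_PhiPoly α β hα hβ, Matrix.det_fin_two, Matrix.trace, Fin.sum_univ_two]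
  simp only [Matrix.diag_apply]
  ring

theorem PhiPoly_coeff {k : ℕ} (α β : Fin k → ℝ) (hα : ∀ m, 0 < α m) (hβ : ∀ m, 0 < β m) :
    (∀ i j n, 0 ≤ (PhiPoly α β i j).coeff n) ∧
    (∀ i j n, k < n → (PhiPoly α β i j).coeff n = 0) ∧
    (PhiPoly α β 0 0).coeff k = 1 ∧ (PhiPoly α β 0 1).coeff k = 0 ∧
    (PhiPoly α β 1 1).coeff k = 1 := by
  induction k with
  | zero =>
    rw [PhiPoly_zero]
    refine ⟨fun i j n => ?_, fun i j n hn => ?_, by simp, by simp, by simp⟩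
    · fin_cases i <;> fin_cases j <;> simp [Polynomial.coeff_one] <;> split_ifs <;> simp
    · fin_cases i <;> fin_cases j <;> simp [Polynomial.coeff_one] <;> omega
  | succ k ih =>
    obtain ⟨h1, h2, h3, h4, h5⟩ := ih _ _ (fun i => hα i.succ) (fun i => hβ i.succ)
    have ha := hα 0
    have hb := hβ 0
    rw [PhiPoly_succ]
    generalize PhiPoly (fun i : Fin k => α i.succ) (fun i => β i.succ) = M at *
    have e : ∀ (s t : ℝ) (P Q : ℝ[X]) (n : ℕ),
        ((X + C s) * P + C t * Q).coeff (n + 1) = P.coeff n + s * P.coeff (n + 1) +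
          t * Q.coeff (n + 1) := by
      intro s t P Q n; simp [add_mul, Polynomial.coeff_X_mul]
    have e' : ∀ (s t : ℝ) (P Q : ℝ[X]) (n : ℕ),
        (C t * X * P + (X + C s) * Q).coeff (n + 1) = t * P.coeff n + Q.coeff n +
          s * Q.coeff (n + 1) := by
      intro s t P Q n; simp [add_mul, Polynomial.coeff_X_mul, mul_assoc, add_assoc]
    have r0 : ∀ j, (stepPoly (α 0) (β 0) * M) 0 j =
        (X + C (α 0 * (β 0)⁻¹)) * M 0 j + C (α 0 + β 0) * M 1 j := by
      intro j; simp only [Matrix.mul_apply, Fin.sum_univ_two]; rfl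
    have r1 : ∀ j, (stepPoly (α 0) (β 0) * M) 1 j =
        C ((α 0)⁻¹ + (β 0)⁻¹) * X * M 0 j + (X + C ((α 0)⁻¹ * β 0)) * M 1 j := by
      intro j; simp only [Matrix.mul_apply, Fin.sum_univ_two]; rfl
    have z := fun i j => h2 i j (k + 1) (by omega)
    refine ⟨fun i j n => ?_, fun i j n hn => ?_, ?_, ?_, ?_⟩
    · rcases n with _ | n
      · have := h1 0 j 0
        have := h1 1 j 0
        fin_cases i
        · simp [r0, Polynomial.mul_coeff_zero]; positivity
        · simp [r1, Polynomial.mul_coeff_zero]; positivity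
      · have := h1 0 j n
        have := h1 1 j n
        have := h1 0 j (n + 1)
        have := h1 1 j (n + 1)
        fin_cases i
        · simp only [Fin.zero_eta, r0, e]; positivity
        · simp only [Fin.mk_one, r1, e']; positivity
    · obtain ⟨n, rfl⟩ : ∃ l, n = l + 1 := ⟨n - 1, by omega⟩
      have w := fun i j => h2 i j n (by omega)
      have w' := fun i j => h2 i j (n + 1) (by omega)
      fin_cases i
      · simp only [Fin.zero_eta, r0, e, w, w', mul_zero, add_zero]
      · simp only [Fin.mk_one, r1, e', w, w', mul_zero, add_zero]
    · rw [r0, e]; simp [z, h3]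
    · rw [r0, e]; simp [z, h4]
    · rw [r1, e']; simp [z, h4, h5]

theorem PhiPoly_eval_zero {k : ℕ} (α β : Fin k → ℝ) :
    (PhiPoly α β 1 0).eval 0 = 0 ∧ (PhiPoly α β 0 0).eval 0 = ∏ m, (α m * (β m)⁻¹) ∧
      (PhiPoly α β 1 1).eval 0 = ∏ m, ((α m)⁻¹ * β m) := by
  induction k with
  | zero => simp [PhiPoly_zero]
  | succ k ih =>
    obtain ⟨h1, h2, h3⟩ := ih (fun i => α i.succ) (fun i => β i.succ)
    rw [PhiPoly_succ, Fin.prod_univ_succ, Fin.prod_univ_succ]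
    simp [Matrix.mul_apply, Fin.sum_univ_two, stepPoly, h1, h2, h3]

/-- The polynomial `(z - 1)^k Tr Φ(z)`. -/
noncomputable def trPoly {k : ℕ} (α β : Fin k → ℝ) : ℝ[X] := (PhiPoly α β).trace

theorem trPoly_eq {k : ℕ} (α β : Fin k → ℝ) :
    trPoly α β = PhiPoly α β 0 0 + PhiPoly α β 1 1 := by
  simp [trPoly, Matrix.trace, Fin.sum_univ_two]

theorem discPoly_eq_trPoly {k : ℕ} (α β : Fin k → ℝ) :
    discPoly α β = trPoly α β ^ 2 - 4 * (X - 1) ^ (2 * k) := rfl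

/-! ### Degree, signs and special values of the trace and the discriminant -/

section trPoly

variable {k : ℕ} (α β : Fin k → ℝ) (hα : ∀ m, 0 < α m) (hβ : ∀ m, 0 < β m)
include hα hβ

theorem trPoly_coeff_nonneg (n : ℕ) : 0 ≤ (trPoly α β).coeff n := by
  rw [trPoly_eq, coeff_add]
  exact add_nonneg ((PhiPoly_coeff α β hα hβ).1 _ _ _) ((PhiPoly_coeff α β hα hβ).1 _ _ _)

theorem trPoly_coeff_eq_zero {n : ℕ} (hn : k < n) : (trPoly α β).coeff n = 0 := by
  rw [trPoly_eq, coeff_add, (PhiPoly_coeff α β hα hβ).2.1 _ _ _ hn,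
    (PhiPoly_coeff α β hα hβ).2.1 _ _ _ hn, add_zero]

theorem trPoly_coeff_self : (trPoly α β).coeff k = 2 := by
  rw [trPoly_eq, coeff_add, (PhiPoly_coeff α β hα hβ).2.2.1,
    (PhiPoly_coeff α β hα hβ).2.2.2.2]
  norm_num

theorem natDegree_trPoly : (trPoly α β).natDegree = k := by
  refine natDegree_eq_of_le_of_coeff_ne_zero ?_ (by rw [trPoly_coeff_self α β hα hβ]; norm_num)
  exact natDegree_le_iff_coeff_eq_zero.2 fun n hn => trPoly_coeff_eq_zero α β hα hβ hn

theorem trPoly_eval_one_pos : 0 < (trPoly α β).eval 1 := by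
  rw [eval_eq_sum_range, natDegree_trPoly α β hα hβ]
  simp only [one_pow, mul_one]
  refine Finset.sum_pos' (fun i _ => trPoly_coeff_nonneg α β hα hβ i)
    ⟨k, by simp, by rw [trPoly_coeff_self α β hα hβ]; norm_num⟩

theorem discPoly_eval_one_pos (hk : 0 < k) : 0 < (discPoly α β).eval 1 := by
  have := trPoly_eval_one_pos α β hα hβ
  have h2k : 2 * k ≠ 0 := by omega
  simp [discPoly_eq_trPoly, hk.ne']
  positivity

/-- The discriminant has degree `2 k - 1` and positive leading coefficient. -/
theorem natDegree_discPoly (hk : 0 < k) :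
    (discPoly α β).natDegree = 2 * k - 1 ∧ 0 < (discPoly α β).leadingCoeff := by
  set T := trPoly α β
  have hT : T.natDegree = k := natDegree_trPoly α β hα hβ
  have hX : ((X - 1 : ℝ[X]) ^ k).natDegree = k := by
    rw [natDegree_pow, show (1 : ℝ[X]) = C 1 from rfl, natDegree_X_sub_C, mul_one]
  have hXm : ((X - 1 : ℝ[X]) ^ k).Monic := by
    rw [show (1 : ℝ[X]) = C 1 from rfl]; exact (monic_X_sub_C 1).pow k
  have hXk : ((X - 1 : ℝ[X]) ^ k).coeff k = 1 := by
    have := hXm.coeff_natDegree; rwa [hX] at this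
  have hX1 : ((X - 1 : ℝ[X]) ^ k).coeff (k - 1) = -k := by
    obtain ⟨j, rfl⟩ : ∃ j, k = j + 1 := ⟨k - 1, by omega⟩
    have : (X - 1 : ℝ[X]) = X + C (-1) := by simp [sub_eq_add_neg]
    rw [this, coeff_X_add_C_pow]
    simp
  -- The leading coefficients 2 and 2 add up in one factor and cancel in the other. In the latter
  -- the coefficient of degree k - 1 is at least 2k, because T has nonnegative coefficients.
  have hfac : discPoly α β = (T - C 2 * (X - 1) ^ k) * (T + C 2 * (X - 1) ^ k) := by
    rw [discPoly_eq_trPoly, show (4 : ℝ[X]) = C 2 * C 2 by rw [← C_mul]; norm_num; rfl]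
    ring
  have hTk := trPoly_coeff_self α β hα hβ
  have A : (T + C 2 * (X - 1) ^ k).coeff k = 4 := by
    rw [coeff_add, coeff_C_mul, hTk, hXk]; norm_num
  have Ad : (T + C 2 * (X - 1) ^ k).natDegree = k := by
    refine natDegree_eq_of_le_of_coeff_ne_zero ?_ (by rw [A]; norm_num)
    exact natDegree_add_le_of_degree_le hT.le ((natDegree_C_mul_le _ _).trans hX.le)
  have B : 0 < (T - C 2 * (X - 1) ^ k).coeff (k - 1) := by
    have := trPoly_coeff_nonneg α β hα hβ (k - 1)
    rw [coeff_sub, coeff_C_mul, hX1]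
    have : (0 : ℝ) < k := by exact_mod_cast hk
    linarith
  have Bd : (T - C 2 * (X - 1) ^ k).natDegree = k - 1 := by
    refine natDegree_eq_of_le_of_coeff_ne_zero ?_ B.ne'
    refine natDegree_le_iff_coeff_eq_zero.2 fun n hn => ?_
    rcases (show k ≤ n by omega).eq_or_lt with h | h
    · subst h; rw [coeff_sub, coeff_C_mul, hTk, hXk]; norm_num
    · rw [coeff_sub, coeff_C_mul, trPoly_coeff_eq_zero α β hα hβ h,
        coeff_eq_zero_of_natDegree_lt (by rw [hX]; exact h)]
      norm_num
  have A0 : (T + C 2 * (X - 1) ^ k) ≠ 0 := by intro h; rw [h] at A; simp at A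
  have B0 : (T - C 2 * (X - 1) ^ k) ≠ 0 := by intro h; rw [h] at B; simp at B
  constructor
  · rw [hfac, natDegree_mul B0 A0, Ad, Bd]; omega
  · rw [hfac, leadingCoeff_mul, leadingCoeff, leadingCoeff, Ad, Bd, A]
    positivity

omit hα in
theorem trPoly_eval_zero (hαβ : ∏ m, α m = ∏ m, β m) : (trPoly α β).eval 0 = 2 := by
  obtain ⟨-, h2, h3⟩ := PhiPoly_eval_zero α β
  have hA : ∏ m, β m ≠ 0 := (Finset.prod_pos fun m _ => hβ m).ne'
  rw [trPoly_eq, eval_add, h2, h3, Finset.prod_mul_distrib, Finset.prod_mul_distrib,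
    Finset.prod_inv_distrib, Finset.prod_inv_distrib, hαβ]
  field_simp
  norm_num

theorem discPoly_eval_zero (hαβ : ∏ m, α m = ∏ m, β m) :
    (discPoly α β).eval 0 = 0 ∧ (0 < k → 0 < (derivative (discPoly α β)).eval 0) := by
  have h0 := trPoly_eval_zero α β hβ hαβ
  refine ⟨by simp [discPoly_eq_trPoly, h0, pow_mul]; norm_num, fun hk => ?_⟩
  have h1 : 0 ≤ (derivative (trPoly α β)).eval 0 := by
    rw [← coeff_zero_eq_eval_zero, coeff_derivative]
    have := trPoly_coeff_nonneg α β hα hβ 1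
    simpa using this
  have hodd : ((-1 : ℝ)) ^ (2 * k - 1) = -1 := Odd.neg_one_pow ⟨k - 1, by omega⟩
  have hk' : (0 : ℝ) < k := by exact_mod_cast hk
  have : (4 : ℝ[X]) = C 4 := rfl
  rw [discPoly_eq_trPoly, this]
  simp [h0, hodd, derivative_pow]
  nlinarith

end trPoly

/-! ### Zeros of the discriminant on the negative axis -/

/-- The quadratic form measuring the rotation of the transfer matrix on the negative axis. -/
def rotForm (M M' : Matrix (Fin 2) (Fin 2) ℝ) (z : ℝ) (v : Fin 2 → ℝ) : ℝ :=
  2 * z * ((M.mulVec v) 0 * (M'.mulVec v) 1 - (M.mulVec v) 1 * (M'.mulVec v) 0)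
    - (M.mulVec v) 0 * (M.mulVec v) 1 + M.det * (v 0 * v 1)

/-- A Leibniz rule for a wedge product. With r = √(-z), D = diag(r, 1), N = D M D⁻¹ and V = D v,
where M' is the z-derivative of M, the form is -2r times the wedge of N V with its z-derivative, V
being held fixed. The term with the determinant comes from this rescaling of v. -/
theorem rotForm_mul (F F' M M' : Matrix (Fin 2) (Fin 2) ℝ) (z : ℝ) (v : Fin 2 → ℝ) :
    rotForm (F * M) (F' * M + F * M') z v =
      F.det * rotForm M M' z v + rotForm F F' z (M.mulVec v) := by
  simp only [rotForm, Matrix.det_fin_two, Matrix.mulVec, dotProduct, Fin.sum_univ_two,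
    Matrix.mul_apply, Matrix.add_apply]
  ring

theorem rotForm_step {a b z : ℝ} (ha : 0 < a) (hb : 0 < b) (v : Fin 2 → ℝ) :
    rotForm ((stepPoly a b).map (eval z)) ((stepPoly a b).map fun P => (derivative P).eval z) z v
      = z * a * (v 0 / b + v 1) ^ 2 - (z * v 0 + b * v 1) ^ 2 / a
        - (1 - z) * (b * v 1 ^ 2 - z * v 0 ^ 2 / b) := by
  simp [rotForm, Matrix.det_fin_two, Matrix.mulVec, dotProduct, Fin.sum_univ_two, stepPoly]
  field_simp
  ring

/-- For z < 0 all three summands of `rotForm_step` are nonpositive, and the last contains the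
positive definite form b v₁² - z v₀² / b. -/
theorem rotForm_step_neg {a b z : ℝ} (ha : 0 < a) (hb : 0 < b) (hz : z < 0) {v : Fin 2 → ℝ}
    (hv : v ≠ 0) :
    rotForm ((stepPoly a b).map (eval z)) ((stepPoly a b).map fun P => (derivative P).eval z) z v
      < 0 := by
  rw [rotForm_step ha hb]
  have h1 : z * a * (v 0 / b + v 1) ^ 2 ≤ 0 := by
    have : 0 ≤ a * (v 0 / b + v 1) ^ 2 := by positivity
    nlinarith
  have h2 : 0 ≤ (z * v 0 + b * v 1) ^ 2 / a := by positivity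
  have h3 : 0 < b * v 1 ^ 2 - z * v 0 ^ 2 / b := by
    by_cases h : v 1 = 0
    · have h0 : v 0 ≠ 0 := by
        intro h0; apply hv; ext i; fin_cases i <;> simp [h, h0]
      have : 0 < -z * v 0 ^ 2 / b := by have := neg_pos.2 hz; positivity
      have e : -z * v 0 ^ 2 / b = -(z * v 0 ^ 2 / b) := by ring
      rw [h]; linarith
    · have : 0 ≤ -z * v 0 ^ 2 / b := by have := neg_pos.2 hz; positivity
      have : 0 < b * v 1 ^ 2 := by positivity
      have e : -z * v 0 ^ 2 / b = -(z * v 0 ^ 2 / b) := by ring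
      linarith
  have h4 : 0 < (1 - z) * (b * v 1 ^ 2 - z * v 0 ^ 2 / b) := mul_pos (by linarith) h3
  linarith

theorem rotForm_PhiPoly_neg {k : ℕ} (hk : 0 < k) (α β : Fin k → ℝ) (hα : ∀ m, 0 < α m)
    (hβ : ∀ m, 0 < β m) {z : ℝ} (hz : z < 0) {v : Fin 2 → ℝ} (hv : v ≠ 0) :
    rotForm ((PhiPoly α β).map (eval z)) ((PhiPoly α β).map fun P => (derivative P).eval z) z v
      < 0 := by
  -- The empty product gives the value 0, so only the weak inequality can be carried through the
  -- induction. Each new factor makes it strict, because the remaining product is invertible at z ≠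
  -- 1.
  have key : ∀ (n : ℕ) (a b : Fin n → ℝ), (∀ m, 0 < a m) → (∀ m, 0 < b m) →
      rotForm ((PhiPoly a b).map (eval z)) ((PhiPoly a b).map fun P => (derivative P).eval z) z v
        ≤ 0 ∧ (0 < n →
      rotForm ((PhiPoly a b).map (eval z)) ((PhiPoly a b).map fun P => (derivative P).eval z) z v
        < 0) := by
    intro n
    induction n with
    | zero =>
      intro a b _ _
      refine ⟨?_, by simp⟩
      rw [PhiPoly_zero]
      simp [rotForm, Matrix.mulVec, dotProduct, Fin.sum_univ_two]
    | succ n ih =>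
      intro a b ha hb
      suffices h : rotForm ((PhiPoly a b).map (eval z))
          ((PhiPoly a b).map fun P => (derivative P).eval z) z v < 0 from ⟨h.le, fun _ => h⟩
      have i1 := (ih _ _ (fun i => ha i.succ) (fun i => hb i.succ)).1
      have hd := det_PhiPoly _ _ (fun i => ha (Fin.succ i)) (fun i => hb (Fin.succ i))
      rw [PhiPoly_succ]
      generalize PhiPoly (fun i : Fin n => a i.succ) (fun i => b i.succ) = M at *
      have e1 : (stepPoly (a 0) (b 0) * M).map (eval z) =
          (stepPoly (a 0) (b 0)).map (eval z) * M.map (eval z) := by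
        ext i j; simp [Matrix.mul_apply, Fin.sum_univ_two]
      have e2 : ((stepPoly (a 0) (b 0) * M).map fun P => (derivative P).eval z) =
          ((stepPoly (a 0) (b 0)).map fun P => (derivative P).eval z) * M.map (eval z) +
          (stepPoly (a 0) (b 0)).map (eval z) * (M.map fun P => (derivative P).eval z) := by
        ext i j; simp [Matrix.mul_apply, Fin.sum_univ_two]; ring
      have d1 : ((stepPoly (a 0) (b 0)).map (eval z)).det = (z - 1) ^ 2 := by
        have := congrArg (eval z) (det_stepPoly (ha 0) (hb 0))
        simpa [Matrix.det_fin_two] using this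
      have d2 : (M.map (eval z)).det = (z - 1) ^ (2 * n) := by
        have := congrArg (eval z) hd
        simpa [Matrix.det_fin_two] using this
      rw [e1, e2, rotForm_mul, d1]
      have hne : (M.map (eval z)).mulVec v ≠ 0 := by
        intro h0
        apply hv
        refine Matrix.eq_zero_of_mulVec_eq_zero ?_ h0
        rw [d2]
        exact pow_ne_zero _ (by linarith)
      have := rotForm_step_neg (ha 0) (hb 0) hz hne
      nlinarith [sq_nonneg (z - 1)]
  exact (key k α β hα hβ).2 hk

/-- A multiple zero of the discriminant on the negative axis is a strict local maximum. -/
theorem discPoly_double_zero {k : ℕ} (hk : 0 < k) (α β : Fin k → ℝ) (hα : ∀ m, 0 < α m)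
    (hβ : ∀ m, 0 < β m) {z : ℝ} (hz : z < 0) (h0 : (discPoly α β).eval z = 0)
    (h1 : (derivative (discPoly α β)).eval z = 0) :
    (derivative (derivative (discPoly α β))).eval z < 0 := by
  have hB := fun v (hv : v ≠ 0) => rotForm_PhiPoly_neg hk α β hα hβ hz hv
  rw [discPoly_eq α β hα hβ] at h0 h1 ⊢
  generalize PhiPoly α β = M at *
  have h4 : (4 : ℝ[X]) = C 4 := rfl
  rw [h4] at *
  simp [derivative_pow] at h0 h1 ⊢
  set a := (M 0 0).eval z
  set b := (M 0 1).eval z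
  set c := (M 1 0).eval z
  set d := (M 1 1).eval z
  set a' := (derivative (M 0 0)).eval z
  set b' := (derivative (M 0 1)).eval z
  set c' := (derivative (M 1 0)).eval z
  set d' := (derivative (M 1 1)).eval z
  have form : ∀ s t : ℝ, (s ≠ 0 ∨ t ≠ 0) →
      2 * z * ((a * s + b * t) * (c' * s + d' * t) - (c * s + d * t) * (a' * s + b' * t))
        - (a * s + b * t) * (c * s + d * t) + (a * d - b * c) * (s * t) < 0 := by
    intro s t hst
    have := hB ![s, t] (by
      intro h
      have e0 := congrFun h 0
      have e1 := congrFun h 1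
      simp at e0 e1
      tauto)
    simpa [rotForm, Matrix.det_fin_two, Matrix.mulVec, dotProduct, Fin.sum_univ_two] using this
  -- When the discriminant vanishes, (b, (d - a)/2) and ((a - d)/2, c) lie in the eigenspace of (a +
  -- d)/2. Vanishing of its derivative makes the definite form vanish on both, so both are zero and
  -- the matrix is scalar.
  have hb : b = 0 ∧ (d - a) / 2 = 0 := by
    by_contra h
    have := form b ((d - a) / 2) (by tauto)
    refine absurd this (not_lt.2 (ge_of_eq ?_))
    linear_combination (z * b * (a + d) / 4) * h1 + ((-(z * (a + d) * b') -
      2 * z * (a' * b + b' * ((d - a) / 2)) - (a + d) / 2 * b - b * ((d - a) / 2)) / 4) * h0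
  have hc : (a - d) / 2 = 0 ∧ c = 0 := by
    by_contra h
    have := form ((a - d) / 2) c (by tauto)
    refine absurd this (not_lt.2 (ge_of_eq ?_))
    linear_combination (-(z * c * (a + d) / 4)) * h1 + ((z * (a + d) * c' +
      2 * z * (c' * ((a - d) / 2) + d' * c) - (a + d) / 2 * c - (a - d) / 2 * c) / 4) * h0
  obtain ⟨hb, hda⟩ := hb
  obtain ⟨-, hc⟩ := hc
  have hd : d = a := by linarith
  have f1 := form 1 0 (by norm_num)
  rw [hb, hc, hd] at f1
  have hc' : c' ≠ 0 := by rintro h; rw [h] at f1; simp at f1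
  -- At a scalar matrix the form is 2za (c' s² + (d' - a') s t - b' t²). This vector is its
  -- stationary direction in s for fixed t, where the value is -2zac' times (a' - d')² + 4b'c'.
  -- Since 2zac' < 0 by `f1`, definiteness gives the sign of the second derivative.
  have f2 := form (a' - d') (2 * c') (Or.inr (by simpa using hc'))
  rw [hb, hc, hd] at f2
  have f3 : -(2 * z * a * c') * ((a' - d') ^ 2 + 4 * (b' * c')) < 0 := by linarith
  have f4 : (a' - d') ^ 2 + 4 * (b' * c') < 0 := by
    by_contra h
    nlinarith
  rw [hb, hc, hd]
  linarith

/-! ### The zeros of the discriminant are real -/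

/-- The indefinite hermitian form `Im (u₀ ū₁)`. -/
noncomputable def imForm (u : Fin 2 → ℂ) : ℝ := (u 0 * (starRingEnd ℂ) (u 1)).im

/-- The matrix `(r, -a; a⁻¹, r)`. -/
noncomputable def rotMat (a : ℝ) (r : ℂ) : Matrix (Fin 2) (Fin 2) ℂ := !![r, -a; (a : ℂ)⁻¹, r]

theorem imForm_rotMat {a : ℝ} (ha : 0 < a) (r : ℂ) (u : Fin 2 → ℂ) :
    imForm ((rotMat a r).mulVec u) = (Complex.normSq r + 1) * imForm u +
      r.im * (Complex.normSq (u 0) / a + a * Complex.normSq (u 1)) := by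
  simp [imForm, rotMat, Matrix.mulVec, dotProduct, Fin.sum_univ_two, Complex.normSq_apply,
    -Complex.ofReal_inv]
  field_simp
  ring

theorem two_mul_abs_imForm_le {a : ℝ} (ha : 0 < a) (u : Fin 2 → ℂ) :
    2 * |imForm u| ≤ Complex.normSq (u 0) / a + a * Complex.normSq (u 1) := by
  have h1 : |imForm u| ≤ ‖u 0‖ * ‖u 1‖ := by
    refine (Complex.abs_im_le_norm _).trans (le_of_eq ?_)
    simp
  rw [Complex.normSq_eq_norm_sq, Complex.normSq_eq_norm_sq]
  have h2 : ‖u 0‖ ^ 2 / a + a * ‖u 1‖ ^ 2 - 2 * (‖u 0‖ * ‖u 1‖) =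
      (‖u 0‖ - a * ‖u 1‖) ^ 2 / a := by field_simp; ring
  have h3 : 0 ≤ (‖u 0‖ - a * ‖u 1‖) ^ 2 / a := by positivity
  linarith

theorem norm_sq_add_one_le (r : ℂ) : ‖r ^ 2 + 1‖ ≤ Complex.normSq r + 1 := by
  refine (norm_add_le _ _).trans (le_of_eq ?_)
  rw [norm_pow, norm_one, Complex.normSq_eq_norm_sq]

/-- Factor r² + 1 = (r - i)(r + i). For Im r > 0 the point r is closer to i than to -i, and |r - i|²
is the left-hand side. -/
theorem norm_sq_add_one_gt {r : ℂ} (hr : 0 < r.im) (h1 : r ^ 2 + 1 ≠ 0) :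
    Complex.normSq r + 1 - 2 * r.im < ‖r ^ 2 + 1‖ := by
  have e : r ^ 2 + 1 = (r - Complex.I) * (r + Complex.I) := by
    linear_combination Complex.I_sq
  have hm : 0 < ‖r - Complex.I‖ := by
    rw [norm_pos_iff]; intro h; apply h1; rw [e, h, zero_mul]
  have e2 : Complex.normSq r + 1 - 2 * r.im = ‖r - Complex.I‖ ^ 2 := by
    rw [← Complex.normSq_eq_norm_sq]; simp [Complex.normSq_apply]; ring
  have e3 : ‖r + Complex.I‖ ^ 2 = ‖r - Complex.I‖ ^ 2 + 4 * r.im := by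
    rw [← Complex.normSq_eq_norm_sq, ← Complex.normSq_eq_norm_sq]
    simp [Complex.normSq_apply]; ring
  have h3 : ‖r - Complex.I‖ < ‖r + Complex.I‖ := by
    by_contra h
    nlinarith [norm_nonneg (r + Complex.I)]
  rw [e, norm_mul, e2, sq]
  exact mul_lt_mul_of_pos_left h3 hm

/-- The increment Im r (|u₀|²/a + a|u₁|²) is positive and at least 2 Im r |Im(u₀ū₁)|. For a
nonnegative form the bound |r² + 1| ≤ |r|² + 1 suffices; for a negative one the growth factor may
drop to |r|² + 1 - 2 Im r, which is still below |r² + 1|, the modulus of the determinant. -/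
theorem imForm_rotMat_gt {a : ℝ} (ha : 0 < a) {r : ℂ} (hr : 0 < r.im) (h1 : r ^ 2 + 1 ≠ 0)
    {u : Fin 2 → ℂ} (hu : u ≠ 0) :
    ‖r ^ 2 + 1‖ * imForm u < imForm ((rotMat a r).mulVec u) := by
  rw [imForm_rotMat ha]
  have h2 := two_mul_abs_imForm_le ha u
  have h3 := norm_sq_add_one_le r
  have h4 := norm_sq_add_one_gt hr h1
  have hpos : 0 < Complex.normSq (u 0) / a + a * Complex.normSq (u 1) := by
    by_cases h : u 0 = 0
    · have : u 1 ≠ 0 := by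
        intro h'; apply hu; ext i; fin_cases i <;> simp [h, h']
      have := Complex.normSq_pos.2 this
      have := Complex.normSq_nonneg (u 0)
      positivity
    · have := Complex.normSq_pos.2 h
      have := Complex.normSq_nonneg (u 1)
      positivity
  rcases le_or_gt 0 (imForm u) with h | h
  · nlinarith
  · rw [abs_of_neg h] at h2
    nlinarith

theorem imForm_rotMat_ge {a : ℝ} (ha : 0 < a) {r : ℂ} (hr : 0 < r.im) (h1 : r ^ 2 + 1 ≠ 0)
    (u : Fin 2 → ℂ) :
    ‖r ^ 2 + 1‖ * imForm u ≤ imForm ((rotMat a r).mulVec u) := by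
  by_cases hu : u = 0
  · subst hu; simp [imForm]
  · exact (imForm_rotMat_gt ha hr h1 hu).le

/-- The form `Im (r v₀ v̄₁)`. -/
noncomputable def imFormAt (r : ℂ) (v : Fin 2 → ℂ) : ℝ := imForm ![r * v 0, v 1]

/-- Conjugated by diag(r, 1) with r² = -z, a factor of the transfer matrix becomes minus a product
of two matrices `rotMat`; the form does not see the sign. -/
theorem imFormAt_step {a b : ℝ} (ha : 0 < a) (hb : 0 < b) {r z : ℂ} (hz : r ^ 2 = -z)
    (v : Fin 2 → ℂ) :
    imFormAt r (((stepPoly a b).map (aeval z)).mulVec v) =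
      imForm ((rotMat a r).mulVec ((rotMat b r).mulVec ![r * v 0, v 1])) := by
  have ha' : (a : ℂ) ≠ 0 := by exact_mod_cast ha.ne'
  have hb' : (b : ℂ) ≠ 0 := by exact_mod_cast hb.ne'
  have hz' : z = -r ^ 2 := by rw [hz, neg_neg]
  have : ∀ u : Fin 2 → ℂ, imForm u = imForm (-u) := by
    intro u; simp [imForm]
  rw [this, imFormAt]
  congr 1
  subst hz'
  ext i
  fin_cases i
  · simp [stepPoly, rotMat, Matrix.mulVec, dotProduct, Fin.sum_univ_two]
    field_simp
    ring
  · simp [stepPoly, rotMat, Matrix.mulVec, dotProduct, Fin.sum_univ_two]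
    field_simp
    ring

theorem imFormAt_step_ge {a b : ℝ} (ha : 0 < a) (hb : 0 < b) {r z : ℂ} (hz : r ^ 2 = -z)
    (hr : 0 < r.im) (h1 : z ≠ 1) (v : Fin 2 → ℂ) :
    ‖z - 1‖ ^ 2 * imFormAt r v ≤ imFormAt r (((stepPoly a b).map (aeval z)).mulVec v) ∧
    (v ≠ 0 →
      ‖z - 1‖ ^ 2 * imFormAt r v < imFormAt r (((stepPoly a b).map (aeval z)).mulVec v)) := by
  have h1' : r ^ 2 + 1 ≠ 0 := by
    rw [hz]; intro h; apply h1; linear_combination -h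
  have hn : ‖r ^ 2 + 1‖ = ‖z - 1‖ := by rw [hz, ← norm_neg]; congr 1; ring
  have hp : 0 < ‖r ^ 2 + 1‖ := norm_pos_iff.2 h1'
  rw [imFormAt_step ha hb hz, ← hn, sq, mul_assoc]
  have g2 := imForm_rotMat_ge ha hr h1' ((rotMat b r).mulVec ![r * v 0, v 1])
  have g1 := mul_le_mul_of_nonneg_left (imForm_rotMat_ge hb hr h1' ![r * v 0, v 1]) hp.le
  refine ⟨g1.trans g2, fun hv => lt_of_lt_of_le ?_ g2⟩
  refine mul_lt_mul_of_pos_left (imForm_rotMat_gt hb hr h1' ?_) hp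
  intro h
  apply hv
  have e0 := congrFun h 0
  have e1 := congrFun h 1
  have hr0 : r ≠ 0 := by rintro rfl; simp at hr
  simp [hr0] at e0 e1
  ext i; fin_cases i <;> simp [e0, e1]

theorem imFormAt_PhiPoly {k : ℕ} (α β : Fin k → ℝ) (hα : ∀ m, 0 < α m)
    (hβ : ∀ m, 0 < β m) {r z : ℂ} (hz : r ^ 2 = -z) (hr : 0 < r.im) (h1 : z ≠ 1)
    (v : Fin 2 → ℂ) :
    ‖z - 1‖ ^ (2 * k) * imFormAt r v ≤
        imFormAt r (((PhiPoly α β).map (aeval z)).mulVec v) ∧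
    (0 < k → ((PhiPoly α β).map (aeval z)).mulVec v ≠ 0 →
      ‖z - 1‖ ^ (2 * k) * imFormAt r v <
        imFormAt r (((PhiPoly α β).map (aeval z)).mulVec v)) := by
  induction k with
  | zero =>
    rw [PhiPoly_zero]
    have : ((1 : Matrix (Fin 2) (Fin 2) ℝ[X]).map (aeval z)) = 1 := by
      ext i j; fin_cases i <;> fin_cases j <;> simp
    simp [this]
  | succ n ih =>
    obtain ⟨i1, -⟩ := ih _ _ (fun i => hα i.succ) (fun i => hβ i.succ)
    rw [PhiPoly_succ, Matrix.map_mul, ← Matrix.mulVec_mulVec,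
      show 2 * (n + 1) = 2 + 2 * n by ring, pow_add, mul_assoc]
    obtain ⟨j1, j2⟩ := imFormAt_step_ge (hα 0) (hβ 0) hz hr h1
      (((PhiPoly (fun i : Fin n => α i.succ) (fun i => β i.succ)).map (aeval z)).mulVec v)
    have := mul_le_mul_of_nonneg_left i1 (sq_nonneg ‖z - 1‖)
    refine ⟨this.trans j1, fun _ hne => lt_of_le_of_lt this (j2 ?_)⟩
    intro h0
    rw [h0] at hne
    simp at hne

theorem exists_sqrt_neg_im_pos {z : ℂ} (hz : ¬ ∃ t : ℝ, t ≤ 0 ∧ z = t) :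
    ∃ r : ℂ, r ^ 2 = -z ∧ 0 < r.im := by
  obtain ⟨r, hr⟩ := IsAlgClosed.exists_pow_nat_eq (-z) (n := 2) (by norm_num)
  rcases lt_trichotomy r.im 0 with h | h | h
  · exact ⟨-r, by rw [neg_sq, hr], by simpa using h⟩
  · exfalso
    apply hz
    refine ⟨-(r.re ^ 2), by nlinarith [sq_nonneg r.re], ?_⟩
    have : r = (r.re : ℂ) := by apply Complex.ext <;> simp [h]
    rw [this] at hr
    push_cast
    linear_combination hr
  · exact ⟨r, hr, h⟩

/-- The zeros of the discriminant are real and non-positive. -/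
theorem discPoly_zero_real {k : ℕ} (hk : 0 < k) (α β : Fin k → ℝ) (hα : ∀ m, 0 < α m)
    (hβ : ∀ m, 0 < β m) {z : ℂ} (h0 : aeval z (discPoly α β) = 0) :
    ∃ t : ℝ, t ≤ 0 ∧ z = t := by
  by_contra hz
  obtain ⟨r, hr, hri⟩ := exists_sqrt_neg_im_pos hz
  have h1 : z ≠ 1 := by
    rintro rfl
    have := discPoly_eval_one_pos α β hα hβ hk
    rw [show (1 : ℂ) = ((1 : ℝ) : ℂ) by simp, ← Complex.coe_algebraMap, aeval_algebraMap_apply] at h0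
    simp at h0
    linarith
  have hd : ((PhiPoly α β).map (aeval z)).det = (z - 1) ^ (2 * k) := by
    have := congrArg (aeval z) (det_PhiPoly α β hα hβ)
    simpa [Matrix.det_fin_two] using this
  have ht : aeval z (trPoly α β) = (PhiPoly α β).map (aeval z) 0 0 +
      (PhiPoly α β).map (aeval z) 1 1 := by
    rw [trPoly_eq]; simp
  have h4 : aeval z (4 : ℝ[X]) = 4 := map_ofNat _ 4
  have hT : aeval z (trPoly α β) ^ 2 = 4 * (z - 1) ^ (2 * k) := by
    rw [discPoly_eq_trPoly] at h0
    simp [h4] at h0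
    linear_combination h0
  have hmain := imFormAt_PhiPoly α β hα hβ hr hri h1
  generalize (PhiPoly α β).map (aeval z) = M at *
  -- At a zero of the discriminant, half the trace is a double eigenvalue, with μ² equal to the
  -- determinant (z - 1)^(2k).
  set μ : ℂ := aeval z (trPoly α β) / 2 with hμ
  have hμ2 : μ ^ 2 = (z - 1) ^ (2 * k) := by rw [hμ]; linear_combination hT / 4
  have hz1 : z - 1 ≠ 0 := sub_ne_zero.2 h1
  have hμ0 : μ ≠ 0 := by
    rintro h; rw [h] at hμ2
    exact pow_ne_zero (2 * k) hz1 (by rw [← hμ2]; simp)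
  have hdet : (M - μ • (1 : Matrix (Fin 2) (Fin 2) ℂ)).det = 0 := by
    have e : aeval z (trPoly α β) = 2 * μ := by rw [hμ]; ring
    rw [Matrix.det_fin_two] at hd ⊢
    simp
    rw [e] at ht
    linear_combination hd - hμ2 + μ * ht
  obtain ⟨v, hv, hMv⟩ := Matrix.exists_mulVec_eq_zero_iff.2 hdet
  have hMv' : M.mulVec v = μ • v := by
    rw [Matrix.sub_mulVec, Matrix.smul_mulVec, Matrix.one_mulVec, sub_eq_zero] at hMv
    exact hMv
  have := (hmain v).2 hk (by rw [hMv']; exact smul_ne_zero hμ0 hv)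
  rw [hMv'] at this
  -- On the eigenvector the form grows exactly by |μ|² = |z - 1|^(2k), against the strict growth in
  -- `hmain`.
  have e : imFormAt r (μ • v) = ‖μ ^ 2‖ * imFormAt r v := by
    rw [norm_pow, ← Complex.normSq_eq_norm_sq]
    simp [imFormAt, imForm, Complex.normSq_apply]
    ring
  rw [e, hμ2, norm_pow] at this
  exact lt_irrefl _ this

/-! ### Harnack pairs -/

/-- The zeros `0 = x₀ > x₁ > ⋯ > x₂ₘ` of the real polynomial `P` are real and simple and its
leading coefficient is positive. -/
structure IsSpectralPoly (m : ℕ) (P : ℝ[X]) (x : ℕ → ℝ) : Prop where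
  exists_eq : ∃ c : ℝ, 0 < c ∧ P = C c * ∏ j ∈ Finset.range (2 * m + 1), (X - C (x j))
  x_zero : x 0 = 0
  x_lt : ∀ i j, i < j → j < 2 * m + 1 → x j < x i

/-- The pair `(P, n)` of real polynomials describing the spectral curve `w² = P(z)` together with
the differential `n(z) dz / ((z - 1) w)`: the polynomial `n`, of degree at most `m`, has a zero in
each of the gaps `(x₂ₗ₊₂, x₂ₗ₊₁)` of `P`. -/
structure IsHarnackPair (m : ℕ) (κ : ℝ) (P n : ℝ[X]) (x : ℕ → ℝ) : Prop
    extends IsSpectralPoly m P x where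
  kappa_pos : 0 < κ
  natDegree_le : n.natDegree ≤ m
  eval_one : n.eval 1 ^ 2 = κ ^ 2 * P.eval 1
  exists_zero : ∀ l < m, ∃ c, x (2 * l + 2) < c ∧ c < x (2 * l + 1) ∧ n.eval c = 0

/-- This pairs the zeros as endpoints of the gaps, which gives signs on the real line. The primed
version pairs them as endpoints of the cuts, which gives the branch of the square root. -/
theorem prod_range_two_mul_add_one {M : Type*} [CommMonoid M] (f : ℕ → M) (m : ℕ) :
    ∏ j ∈ Finset.range (2 * m + 1), f j =
      f 0 * ∏ l ∈ Finset.range m, f (2 * l + 1) * f (2 * l + 2) := by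
  induction m with
  | zero => simp
  | succ m ih =>
    rw [show 2 * (m + 1) + 1 = 2 * m + 1 + 1 + 1 by ring, Finset.prod_range_succ,
      Finset.prod_range_succ, ih, Finset.prod_range_succ _ m]
    simp only [mul_assoc]

theorem prod_range_two_mul_add_one' {M : Type*} [CommMonoid M] (f : ℕ → M) (m : ℕ) :
    ∏ j ∈ Finset.range (2 * m + 1), f j =
      (∏ l ∈ Finset.range m, f (2 * l) * f (2 * l + 1)) * f (2 * m) := by
  induction m with
  | zero => simp
  | succ m ih =>
    rw [show 2 * (m + 1) + 1 = 2 * m + 1 + 1 + 1 by ring, Finset.prod_range_succ,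
      Finset.prod_range_succ, ih, Finset.prod_range_succ _ m, show 2 * m + 1 + 1 = 2 * (m + 1) by ring]
    simp only [mul_assoc]

/-- Membership in one of the closed gaps `[x₂ₗ₊₂, x₂ₗ₊₁]`. -/
def InGap (m : ℕ) (x : ℕ → ℝ) (t : ℝ) : Prop :=
  ∃ l < m, x (2 * l + 2) ≤ t ∧ t ≤ x (2 * l + 1)

namespace IsSpectralPoly

variable {m : ℕ} {P : ℝ[X]} {x : ℕ → ℝ} (h : IsSpectralPoly m P x)
include h

theorem x_neg {j : ℕ} (h0 : 0 < j) (hj : j < 2 * m + 1) : x j < 0 := by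
  have := h.x_lt 0 j h0 hj
  rwa [h.x_zero] at this

theorem x_nonpos {j : ℕ} (hj : j < 2 * m + 1) : x j ≤ 0 := by
  rcases Nat.eq_zero_or_pos j with rfl | h0
  · exact h.x_zero.le
  · exact (h.x_neg h0 hj).le

theorem eval_nonneg {t : ℝ} (ht : 0 ≤ t) : 0 ≤ P.eval t := by
  obtain ⟨c, hc, hP⟩ := h.exists_eq
  rw [hP, eval_mul, eval_C, eval_prod]
  refine mul_nonneg hc.le (Finset.prod_nonneg fun j hj => ?_)
  have := h.x_nonpos (Finset.mem_range.1 hj)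
  simp; linarith

theorem eval_pos {t : ℝ} (ht : 0 < t) : 0 < P.eval t := by
  obtain ⟨c, hc, hP⟩ := h.exists_eq
  rw [hP, eval_mul, eval_C, eval_prod]
  refine mul_pos hc (Finset.prod_pos fun j hj => ?_)
  have := h.x_nonpos (Finset.mem_range.1 hj)
  simp; linarith

theorem eval_eq (t : ℝ) : ∃ c : ℝ, 0 < c ∧ P.eval t = c * (t *
    ∏ l ∈ Finset.range m, ((t - x (2 * l + 1)) * (t - x (2 * l + 2)))) := by
  obtain ⟨c, hc, hP⟩ := h.exists_eq
  refine ⟨c, hc, ?_⟩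
  rw [hP, prod_range_two_mul_add_one, h.x_zero, eval_mul, eval_mul, eval_prod]
  simp

theorem eval_neg {t : ℝ} (ht : t < 0) (hg : ¬ InGap m x t) : P.eval t < 0 := by
  obtain ⟨c, hc, e⟩ := h.eval_eq t
  rw [e]
  refine mul_neg_of_pos_of_neg hc (mul_neg_of_neg_of_pos ht (Finset.prod_pos fun l hl => ?_))
  have hl' := Finset.mem_range.1 hl
  have hx := h.x_lt (2 * l + 1) (2 * l + 2) (by omega) (by omega)
  rcases lt_or_ge t (x (2 * l + 2)) with h1 | h1
  · exact mul_pos_of_neg_of_neg (by linarith) (by linarith)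
  · rcases lt_or_ge (x (2 * l + 1)) t with h2 | h2
    · exact mul_pos (by linarith) (by linarith)
    · exact absurd ⟨l, hl', h1, h2⟩ hg

theorem eval_gap {l : ℕ} (hl : l < m) {t : ℝ} :
    (x (2 * l + 2) ≤ t → t ≤ x (2 * l + 1) → 0 ≤ P.eval t) ∧
    (x (2 * l + 2) < t → t < x (2 * l + 1) → 0 < P.eval t) := by
  obtain ⟨c, hc, e⟩ := h.eval_eq t
  have hneg := h.x_neg (j := 2 * l + 1) (by omega) (by omega)
  rw [e, ← Finset.mul_prod_erase _ _ (Finset.mem_range.2 hl)]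
  have hp : x (2 * l + 2) ≤ t → t ≤ x (2 * l + 1) →
      0 < ∏ l ∈ (Finset.range m).erase l, ((t - x (2 * l + 1)) * (t - x (2 * l + 2))) := by
    intro h1 h2
    refine Finset.prod_pos fun i hi => ?_
    obtain ⟨hne, hi⟩ := Finset.mem_erase.1 hi
    have hi := Finset.mem_range.1 hi
    have hx := h.x_lt (2 * i + 1) (2 * i + 2) (by omega) (by omega)
    rcases lt_or_gt_of_ne hne with hlt | hlt
    · have := h.x_lt (2 * i + 2) (2 * l + 1) (by omega) (by omega)
      exact mul_pos_of_neg_of_neg (by linarith) (by linarith)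
    · have := h.x_lt (2 * l + 2) (2 * i + 1) (by omega) (by omega)
      exact mul_pos (by linarith) (by linarith)
  constructor
  · intro h1 h2
    have h3 := hp h1 h2
    have : (t - x (2 * l + 1)) * (t - x (2 * l + 2)) ≤ 0 :=
      mul_nonpos_of_nonpos_of_nonneg (by linarith) (by linarith)
    refine mul_nonneg hc.le (mul_nonneg_of_nonpos_of_nonpos (by linarith) ?_)
    exact mul_nonpos_of_nonpos_of_nonneg this h3.le
  · intro h1 h2
    have h3 := hp h1.le h2.le
    have : (t - x (2 * l + 1)) * (t - x (2 * l + 2)) < 0 :=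
      mul_neg_of_neg_of_pos (by linarith) (by linarith)
    refine mul_pos hc (mul_pos_of_neg_of_neg (by linarith) ?_)
    exact mul_neg_of_neg_of_pos this h3

theorem eval_nonneg_iff {t : ℝ} : 0 ≤ P.eval t ↔ 0 ≤ t ∨ InGap m x t := by
  constructor
  · intro h0
    by_contra hcon
    push Not at hcon
    exact absurd h0 (not_le.2 (h.eval_neg hcon.1 hcon.2))
  · rintro (h0 | ⟨l, hl, h1, h2⟩)
    · exact h.eval_nonneg h0
    · exact (h.eval_gap hl).1 h1 h2

theorem eval_x {j : ℕ} (hj : j < 2 * m + 1) : P.eval (x j) = 0 := by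
  obtain ⟨c, hc, hP⟩ := h.exists_eq
  rw [hP, eval_mul, eval_prod, Finset.prod_eq_zero (Finset.mem_range.2 hj) (by simp), mul_zero]

theorem natDegree_P : P.natDegree = 2 * m + 1 := by
  obtain ⟨c, hc, hP⟩ := h.exists_eq
  rw [hP, natDegree_C_mul hc.ne', natDegree_prod_of_monic _ _ fun j _ => monic_X_sub_C _]
  simp

theorem aeval_eq (z : ℂ) : ∃ c : ℝ, 0 < c ∧
    aeval z P = c * ∏ j ∈ Finset.range (2 * m + 1), (z - x j) := by
  obtain ⟨c, hc, hP⟩ := h.exists_eq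
  refine ⟨c, hc, ?_⟩
  rw [hP, map_mul, map_prod]
  simp

theorem aeval_ne_zero {z : ℂ} (hz : z.im ≠ 0) : aeval z P ≠ 0 := by
  obtain ⟨c, hc, e⟩ := h.aeval_eq z
  rw [e]
  refine mul_ne_zero (by exact_mod_cast hc.ne') (Finset.prod_ne_zero_iff.2 fun j _ hj => hz ?_)
  rw [sub_eq_zero.1 hj, Complex.ofReal_im]

end IsSpectralPoly

namespace IsHarnackPair

variable {m : ℕ} {κ : ℝ} {P n : ℝ[X]} {x : ℕ → ℝ} (h : IsHarnackPair m κ P n x)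
include h

theorem n_ne_zero : n ≠ 0 := by
  rintro rfl
  have h1 := h.eval_one
  have := h.eval_pos one_pos
  have := h.kappa_pos
  simp at h1
  rcases h1 with h1 | h1 <;> linarith

/-- All zeros of `n` lie in the gaps. -/
theorem eval_pos_of_n_eq_zero {t : ℝ} (ht : n.eval t = 0) :
    ∃ l < m, x (2 * l + 2) < t ∧ t < x (2 * l + 1) := by
  by_contra hcon
  push Not at hcon
  choose! c h1 h2 h3 using h.exists_zero
  have hinj : Set.InjOn c (Finset.range m) := by
    intro i hi j hj hij
    have hi := Finset.mem_range.1 (Finset.mem_coe.1 hi)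
    have hj := Finset.mem_range.1 (Finset.mem_coe.1 hj)
    have := h1 i hi
    have := h2 i hi
    have := h1 j hj
    have := h2 j hj
    by_contra hne
    rcases lt_or_gt_of_ne hne with hlt | hlt
    · have := h.x_lt (2 * i + 2) (2 * j + 1) (by omega) (by omega)
      linarith
    · have := h.x_lt (2 * j + 2) (2 * i + 1) (by omega) (by omega)
      linarith
  have hnot : t ∉ (Finset.range m).image c := by
    intro hmem
    obtain ⟨l, hl, rfl⟩ := Finset.mem_image.1 hmem
    have hl := Finset.mem_range.1 hl
    exact absurd (hcon l hl (h1 l hl)) (not_le.2 (h2 l hl))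
  have hsub : (insert t ((Finset.range m).image c)) ⊆ n.roots.toFinset := by
    intro y hy
    rw [Multiset.mem_toFinset, mem_roots h.n_ne_zero]
    rcases Finset.mem_insert.1 hy with rfl | hy
    · exact ht
    · obtain ⟨l, hl, rfl⟩ := Finset.mem_image.1 hy
      exact h3 l (Finset.mem_range.1 hl)
  have := Finset.card_le_card hsub
  rw [Finset.card_insert_of_notMem hnot, Finset.card_image_of_injOn hinj, Finset.card_range] at this
  have := (Multiset.toFinset_card_le n.roots).trans (card_roots' n)
  have := h.natDegree_le
  omega

theorem n_eval_ne_zero {t : ℝ} (ht : P.eval t ≤ 0) : n.eval t ≠ 0 := by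
  intro h0
  obtain ⟨l, hl, h1, h2⟩ := h.eval_pos_of_n_eq_zero h0
  exact absurd ((h.eval_gap hl).2 h1 h2) (not_lt.2 ht)

end IsHarnackPair

/-! ### Counting zeros -/

/-- Zeros must be counted with multiplicity, since r = s can occur. After division by X - r the
cofactor has opposite signs at u and v and so has a zero of its own. -/
theorem exists_two_roots {Q : ℝ[X]} {u v c : ℝ} (huc : u < c) (hcv : c < v)
    (hu : 0 < Q.eval u) (hv : 0 < Q.eval v) (hc : Q.eval c ≤ 0) :
    ∃ r s, (u < r ∧ r < v) ∧ (u < s ∧ s < v) ∧ (X - C r) * (X - C s) ∣ Q := by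
  obtain ⟨r, ⟨hr1, hr2⟩, hr⟩ := intermediate_value_Icc' huc.le Q.continuousOn ⟨hc, hu.le⟩
  have hur : u < r := lt_of_le_of_ne hr1 (by rintro rfl; exact hu.ne' hr)
  have hrv : r < v := lt_of_le_of_lt hr2 hcv
  obtain ⟨S, hS⟩ := dvd_iff_isRoot.2 hr
  rw [hS, eval_mul] at hu hv
  simp only [eval_sub, eval_X, eval_C] at hu hv
  have hu' : S.eval u < 0 := by
    by_contra hcon
    nlinarith
  have hv' : 0 < S.eval v := pos_of_mul_pos_right hv (by linarith)
  obtain ⟨s, ⟨hs1, hs2⟩, hs⟩ :=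
    intermediate_value_Icc (huc.trans hcv).le S.continuousOn ⟨hu'.le, hv'.le⟩
  refine ⟨r, s, ⟨hur, hrv⟩, ⟨lt_of_le_of_ne hs1 ?_, lt_of_le_of_ne hs2 ?_⟩, ?_⟩
  · rintro rfl; exact hu'.ne hs
  · rintro rfl; exact hv'.ne' hs
  · rw [hS]; exact mul_dvd_mul_left _ (dvd_iff_isRoot.2 hs)

theorem eq_of_natDegree_le_two {S : ℝ[X]} (hS : S.natDegree ≤ 2) {z : ℂ} (hz : z.im ≠ 0)
    (h0 : aeval z S = 0) :
    S = C (S.coeff 2) * (X ^ 2 - C (2 * z.re) * X + C (Complex.normSq z)) := by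
  have e : S = C (S.coeff 2) * X ^ 2 + C (S.coeff 1) * X + C (S.coeff 0) :=
    eq_quadratic_of_degree_le_two (natDegree_le_iff_degree_le.1 hS)
  rw [e] at h0
  simp at h0
  have him := congrArg Complex.im h0
  have hre := congrArg Complex.re h0
  simp [sq] at him hre
  have h1 : S.coeff 1 = -(S.coeff 2 * (2 * z.re)) := by
    have : z.im * (S.coeff 1 + S.coeff 2 * (2 * z.re)) = 0 := by linarith
    rcases mul_eq_zero.1 this with h | h
    · exact absurd h hz
    · linarith
  have h2 : S.coeff 0 = S.coeff 2 * Complex.normSq z := by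
    rw [h1] at hre
    rw [Complex.normSq_apply]
    linarith
  conv_lhs => rw [e, h1, h2]
  simp only [C_neg, C_mul]
  ring

/-- The polynomial whose zeros are the `z`-coordinates of the critical points. -/
noncomputable def critPoly (κ : ℝ) (P₁ n : ℝ[X]) (a b c : ℝ) : ℝ[X] :=
  C (κ ^ 2) * (C a * X - C b) ^ 2 * P₁ - C (4 * c ^ 2) * X * n ^ 2

theorem eval_critPoly (κ : ℝ) (P₁ n : ℝ[X]) (a b c t : ℝ) :
    (critPoly κ P₁ n a b c).eval t =
      κ ^ 2 * (a * t - b) ^ 2 * P₁.eval t - 4 * c ^ 2 * t * n.eval t ^ 2 := by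
  simp [critPoly]

namespace IsHarnackPair

variable {m : ℕ} {κ : ℝ} {P n : ℝ[X]} {x : ℕ → ℝ} (h : IsHarnackPair m κ P n x)
include h

theorem X_dvd : X ∣ P := by
  obtain ⟨c, hc, hP⟩ := h.exists_eq
  rw [hP, prod_range_two_mul_add_one, h.x_zero]
  simp only [C_0, sub_zero]
  exact dvd_mul_of_dvd_right (dvd_mul_right _ _) _

variable {P₁ : ℝ[X]} (hP₁ : P = X * P₁)
include hP₁

omit h in
theorem eval_P1 (t : ℝ) : P.eval t = t * P₁.eval t := by rw [hP₁]; simp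

theorem eval_P1_nonneg {t : ℝ} (ht : 0 ≤ t) : 0 ≤ P₁.eval t := by
  obtain ⟨c, hc, hP⟩ := h.exists_eq
  rw [hP, prod_range_two_mul_add_one, h.x_zero, C_0, sub_zero, mul_left_comm] at hP₁
  rw [← mul_left_cancel₀ X_ne_zero hP₁, eval_mul, eval_C, eval_prod]
  refine mul_nonneg hc.le (Finset.prod_nonneg fun l hl => ?_)
  have hl := Finset.mem_range.1 hl
  have := h.x_neg (j := 2 * l + 1) (by omega) (by omega)
  have := h.x_neg (j := 2 * l + 2) (by omega) (by omega)
  simp only [eval_mul, eval_sub, eval_X, eval_C]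
  exact mul_nonneg (by linarith) (by linarith)

theorem natDegree_P1 : P₁.natDegree = 2 * m := by
  have := h.natDegree_P
  have h0 : P₁ ≠ 0 := by rintro rfl; rw [hP₁] at this; simp at this
  rw [hP₁, natDegree_X_mul h0] at this
  omega

/-- To the left of all zeros of P one has t < 0 and P < 0, so P₁ ≥ 0 and n ≠ 0, and the term -4c² t
n² is strictly positive. -/
theorem critPoly_ne_zero {a b c : ℝ} (hc : c ≠ 0) : critPoly κ P₁ n a b c ≠ 0 := by
  have h2m := h.x_nonpos (j := 2 * m) (by omega)
  set t := x (2 * m) - 1 with ht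
  have hP : P.eval t < 0 := by
    refine h.eval_neg (by linarith) ?_
    rintro ⟨l, hl, h1, -⟩
    have : x (2 * m) ≤ x (2 * l + 2) := by
      rcases (show 2 * l + 2 ≤ 2 * m by omega).eq_or_lt with e | e
      · rw [e]
      · exact (h.x_lt _ _ e (by omega)).le
    linarith
  have hn := h.n_eval_ne_zero hP.le
  have hP1 : 0 ≤ P₁.eval t := by
    rw [eval_P1 hP₁] at hP
    by_contra hcon
    nlinarith
  intro h0
  have := eval_critPoly κ P₁ n a b c t
  rw [h0, eval_zero] at this
  have h3 : 0 ≤ κ ^ 2 * (a * t - b) ^ 2 * P₁.eval t := by positivity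
  have h4 : 0 < c ^ 2 * n.eval t ^ 2 := by positivity
  nlinarith

theorem natDegree_critPoly_le (a b c : ℝ) :
    (critPoly κ P₁ n a b c).natDegree ≤ 2 * m + 2 ∧
    (a = 0 → (critPoly κ P₁ n a b c).natDegree ≤ 2 * m + 1) := by
  have hP := h.natDegree_P1 hP₁
  have hn := h.natDegree_le
  have hlin : (C a * X - C b : ℝ[X]).natDegree ≤ 1 := by
    rw [sub_eq_add_neg, ← C_neg]; exact natDegree_linear_le
  have hlin0 : a = 0 → (C a * X - C b : ℝ[X]).natDegree = 0 := by
    rintro rfl; simp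
  have e1 : (C (κ ^ 2) * (C a * X - C b) ^ 2 * P₁).natDegree ≤
      2 * (C a * X - C b : ℝ[X]).natDegree + 2 * m := by
    refine natDegree_mul_le.trans ?_
    have := natDegree_C_mul_le (κ ^ 2) ((C a * X - C b) ^ 2 : ℝ[X])
    have := natDegree_pow_le (p := (C a * X - C b : ℝ[X])) (n := 2)
    omega
  have e2 : (C (4 * c ^ 2) * X * n ^ 2).natDegree ≤ 2 * m + 1 := by
    refine natDegree_mul_le.trans ?_
    have := natDegree_C_mul_le (4 * c ^ 2) (X : ℝ[X])
    have := natDegree_pow_le (p := n) (n := 2)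
    rw [natDegree_X] at *
    omega
  constructor
  · exact (natDegree_sub_le _ _).trans (max_le (by omega) (by omega))
  · intro ha
    have := hlin0 ha
    exact (natDegree_sub_le _ _).trans (max_le (by omega) (by omega))

/-- At the ends of the gap P₁ vanishes and -4c² t n² > 0 because t < 0. At the zero of n in between
only κ² (a t - b)² P₁ is left, and P₁ < 0 there because P > 0 > t. -/
theorem critPoly_gap {a b c : ℝ} (hc : c ≠ 0) {l : ℕ} (hl : l < m) :
    ∃ r s, (x (2 * l + 2) < r ∧ r < x (2 * l + 1)) ∧ (x (2 * l + 2) < s ∧ s < x (2 * l + 1)) ∧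
      (X - C r) * (X - C s) ∣ critPoly κ P₁ n a b c := by
  obtain ⟨t, h1, h2, h3⟩ := h.exists_zero l hl
  have hend : ∀ j, 0 < j → j < 2 * m + 1 → 0 < (critPoly κ P₁ n a b c).eval (x j) := by
    intro j hj0 hj
    have hxj := h.x_neg hj0 hj
    have hx := h.eval_x hj
    have hn := h.n_eval_ne_zero hx.le
    rw [eval_P1 hP₁] at hx
    have hx' : P₁.eval (x j) = 0 := (mul_eq_zero.1 hx).resolve_left hxj.ne
    rw [eval_critPoly, hx']
    have h4 : 0 < c ^ 2 * n.eval (x j) ^ 2 := by positivity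
    nlinarith
  refine exists_two_roots h1 h2 (hend _ (by omega) (by omega)) (hend _ (by omega) (by omega)) ?_
  have hPt := (h.eval_gap hl).2 h1 h2
  have := h.x_neg (j := 2 * l + 1) (by omega) (by omega)
  have hP1 : P₁.eval t ≤ 0 := by
    rw [eval_P1 hP₁] at hPt
    by_contra hcon
    nlinarith
  rw [eval_critPoly, h3]
  have : 0 ≤ κ ^ 2 * (a * t - b) ^ 2 := by positivity
  nlinarith

/-- W collects the two zeros in each gap. These use up 2m of at most 2m + 2 degrees, or of 2m + 1
when a = 0, so every non-real or nonnegative zero belongs to the small factor S. -/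
theorem critPoly_factor {a b c : ℝ} (hc : c ≠ 0) :
    ∃ W S : ℝ[X], critPoly κ P₁ n a b c = W * S ∧ S.natDegree ≤ 2 ∧ (a = 0 → S.natDegree ≤ 1) ∧
      (∀ z : ℂ, z.im ≠ 0 → aeval z W ≠ 0) ∧ ∀ t : ℝ, 0 ≤ t → W.eval t ≠ 0 := by
  choose! r s hr hs hd using fun l (hl : l < m) => h.critPoly_gap hP₁ (a := a) (b := b) hc hl
  set W : ℝ[X] := ∏ l ∈ Finset.range m, (X - C (r l)) * (X - C (s l)) with hW
  have hsep : ∀ i j, i < m → j < m → i ≠ j → ∀ u v, (x (2 * i + 2) < u ∧ u < x (2 * i + 1)) →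
      (x (2 * j + 2) < v ∧ v < x (2 * j + 1)) → IsCoprime (X - C u) (X - C v : ℝ[X]) := by
    intro i j hi hj hij u v hu hv
    refine isCoprime_X_sub_C_of_isUnit_sub (isUnit_iff_ne_zero.2 (sub_ne_zero.2 ?_))
    rcases lt_or_gt_of_ne hij with hlt | hlt
    · have := h.x_lt (2 * i + 2) (2 * j + 1) (by omega) (by omega)
      linarith [hu.1, hv.2]
    · have := h.x_lt (2 * j + 2) (2 * i + 1) (by omega) (by omega)
      linarith [hu.2, hv.1]
  have hdvd : W ∣ critPoly κ P₁ n a b c := by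
    refine Finset.prod_dvd_of_coprime ?_ fun l hl => hd l (Finset.mem_range.1 hl)
    intro i hi j hj hij
    have hi := Finset.mem_range.1 (Finset.mem_coe.1 hi)
    have hj := Finset.mem_range.1 (Finset.mem_coe.1 hj)
    refine IsCoprime.mul_left (IsCoprime.mul_right ?_ ?_) (IsCoprime.mul_right ?_ ?_)
    · exact hsep i j hi hj hij _ _ (hr i hi) (hr j hj)
    · exact hsep i j hi hj hij _ _ (hr i hi) (hs j hj)
    · exact hsep i j hi hj hij _ _ (hs i hi) (hr j hj)
    · exact hsep i j hi hj hij _ _ (hs i hi) (hs j hj)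
  obtain ⟨S, hS⟩ := hdvd
  have hne := h.critPoly_ne_zero hP₁ (a := a) (b := b) hc
  have hWd : W.natDegree = 2 * m := by
    rw [hW, natDegree_prod_of_monic _ _ fun j _ => (monic_X_sub_C _).mul (monic_X_sub_C _)]
    simp [natDegree_mul (X_sub_C_ne_zero _) (X_sub_C_ne_zero _), mul_comm]
  have hW0 : W ≠ 0 := by rintro h0; rw [hS, h0, zero_mul] at hne; exact hne rfl
  have hS0 : S ≠ 0 := by rintro h0; rw [hS, h0, mul_zero] at hne; exact hne rfl
  have hdeg := h.natDegree_critPoly_le hP₁ a b c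
  rw [hS, natDegree_mul hW0 hS0, hWd] at hdeg
  refine ⟨W, S, hS, by omega, fun ha => by have := hdeg.2 ha; omega, ?_, ?_⟩
  · intro z hz
    rw [hW, map_prod]
    refine Finset.prod_ne_zero_iff.2 fun l hl => ?_
    simp only [map_mul, map_sub, aeval_X, aeval_C, Complex.coe_algebraMap]
    refine mul_ne_zero (fun h0 => hz ?_) (fun h0 => hz ?_) <;>
      rw [sub_eq_zero.1 h0, Complex.ofReal_im]
  · intro t ht
    rw [hW, eval_prod]
    refine Finset.prod_ne_zero_iff.2 fun l hl => ?_
    have hl := Finset.mem_range.1 hl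
    have := h.x_neg (j := 2 * l + 1) (by omega) (by omega)
    simp only [eval_mul, eval_sub, eval_X, eval_C]
    have := (hr l hl).2
    have := (hs l hl).2
    exact mul_ne_zero (by intro; linarith) (by intro; linarith)

/-- If the polynomial `critPoly` has a non-real zero then that zero is simple, it is the only one
up to conjugation, and the parameters are in the liquid range. -/
theorem critPoly_nonreal {a b c : ℝ} (hc : c ≠ 0) {z : ℂ} (hz : z.im ≠ 0)
    (h0 : aeval z (critPoly κ P₁ n a b c) = 0) :
    a * b < 0 ∧ 4 * c ^ 2 < (a - b) ^ 2 ∧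
      aeval z (derivative (critPoly κ P₁ n a b c)) ≠ 0 ∧
      ∀ z' : ℂ, z'.im ≠ 0 → aeval z' (critPoly κ P₁ n a b c) = 0 →
        z' = z ∨ z' = (starRingEnd ℂ) z := by
  obtain ⟨W, S, hQ, hS2, hS1, hWz, hWt⟩ := h.critPoly_factor hP₁ (a := a) (b := b) hc
  have hne := h.critPoly_ne_zero hP₁ (a := a) (b := b) hc
  have hSz : aeval z S = 0 := by
    rw [hQ, map_mul] at h0
    exact (mul_eq_zero.1 h0).resolve_left (hWz z hz)
  have hS := eq_of_natDegree_le_two hS2 hz hSz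
  set s := S.coeff 2 with hs
  have hs0 : s ≠ 0 := by
    intro h0; rw [h0, C_0, zero_mul] at hS; rw [hQ, hS, mul_zero] at hne; exact hne rfl
  have hSt : ∀ t : ℝ, S.eval t ≠ 0 := by
    intro t
    rw [hS]
    simp only [eval_mul, eval_add, eval_sub, eval_pow, eval_C, eval_X, Complex.normSq_apply]
    refine mul_ne_zero hs0 (ne_of_gt ?_)
    have : 0 < z.im ^ 2 := by positivity
    nlinarith [sq_nonneg (t - z.re)]
  have hroot : ∀ t : ℝ, 0 ≤ t → (critPoly κ P₁ n a b c).eval t ≠ 0 := by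
    intro t ht
    rw [hQ, eval_mul]
    exact mul_ne_zero (hWt t ht) (hSt t)
  have ha : a ≠ 0 := by
    intro ha
    apply hs0
    exact coeff_eq_zero_of_natDegree_lt (lt_of_le_of_lt (hS1 ha) (by norm_num))
  have hQ0 : 0 < (critPoly κ P₁ n a b c).eval 0 := by
    refine lt_of_le_of_ne ?_ (hroot 0 le_rfl).symm
    rw [eval_critPoly]
    have := h.eval_P1_nonneg hP₁ le_rfl
    simp
    positivity
  have hpos : ∀ t : ℝ, 0 ≤ t → 0 < (critPoly κ P₁ n a b c).eval t := by
    intro t ht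
    by_contra hcon
    obtain ⟨u, hu, hu0⟩ := intermediate_value_Icc' ht (critPoly κ P₁ n a b c).continuousOn
      ⟨not_lt.1 hcon, hQ0.le⟩
    exact hroot u hu.1 hu0
  refine ⟨?_, ?_, ?_, ?_⟩
  -- If a b ≥ 0, the point t = b/a ≥ 0 annihilates the square, and only -4c² t n(t)² ≤ 0 remains,
  -- against positivity on [0, ∞).
  · by_contra hab
    push Not at hab
    have hba : 0 ≤ b / a := by
      rw [div_eq_mul_inv]
      have : b * a⁻¹ = (a * b) * (a⁻¹) ^ 2 := by field_simp
      rw [this]; positivity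
    have := hpos _ hba
    rw [eval_critPoly, mul_div_cancel₀ _ ha] at this
    have h3 : 0 ≤ c ^ 2 * (b / a) * n.eval (b / a) ^ 2 := by positivity
    simp only [sub_self] at this
    nlinarith
  -- Since n(1)² = κ² P(1), the value at t = 1 is κ² P(1) ((a - b)² - 4c²).
  · have := hpos 1 zero_le_one
    have h1 := h.eval_one
    have hP1 := eval_P1 hP₁ 1
    have hp := h.eval_pos one_pos
    rw [one_mul] at hP1
    rw [eval_critPoly, h1, ← hP1] at this
    have hk := h.kappa_pos
    have h5 : 0 < κ ^ 2 * P.eval 1 := by positivity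
    have h6 : 0 < (κ ^ 2 * P.eval 1) * ((a - b) ^ 2 - 4 * c ^ 2) := by nlinarith
    have := pos_of_mul_pos_right h6 h5.le
    linarith
  · rw [hQ, derivative_mul, map_add, map_mul, map_mul, hSz, mul_zero, zero_add]
    refine mul_ne_zero (hWz z hz) ?_
    rw [hS]
    simp
    refine ⟨hs0, fun h1 => hz ?_⟩
    have := congrArg Complex.im h1
    simp at this
    linarith
  · intro z' hz' h0'
    have hSz' : aeval z' S = 0 := by
      rw [hQ, map_mul] at h0'
      exact (mul_eq_zero.1 h0').resolve_left (hWz z' hz')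
    rw [hS] at hSz'
    simp only [map_mul, map_add, map_sub, map_pow, aeval_X, aeval_C, Complex.coe_algebraMap] at hSz'
    have hs0' : (s : ℂ) ≠ 0 := by exact_mod_cast hs0
    have h1 := (mul_eq_zero.1 hSz').resolve_left hs0'
    have h2 : (z' - z) * (z' - (starRingEnd ℂ) z) = 0 := by
      have e1 := Complex.mul_conj z
      have e2 := Complex.add_conj z
      rw [← e1] at h1
      push_cast at e2 h1
      linear_combination h1 - z' * e2
    rcases mul_eq_zero.1 h2 with h3 | h3
    · exact Or.inl (sub_eq_zero.1 h3)
    · exact Or.inr (sub_eq_zero.1 h3)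

end IsHarnackPair

/-! ### The critical point equation on the curve -/

/-- The critical point equation, for `v = (χ, η)`. -/
def CritEq (κ : ℝ) (n : ℝ[X]) (v : ℝ × ℝ) (S : ℂ × ℂ) : Prop :=
  (κ : ℂ) * ((v.2 - 1) * S.1 - (v.2 + 1)) * S.2 = 2 * v.1 * S.1 * aeval S.1 n

/-- The points of the curve with `OffReal` first coordinate are those off the real locus. -/
def OffReal (P : ℝ[X]) (z : ℂ) : Prop := z.im ≠ 0 ∨ P.eval z.re < 0

/-- The logarithmic derivative of `ρ` with respect to `log z`. -/
noncomputable def logDer (n : ℝ[X]) (S : ℂ × ℂ) : ℂ := S.1 * aeval S.1 n / ((S.1 - 1) * S.2)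

/-- The solution `(χ, η)` of the critical point equation at a given point of the curve. -/
noncomputable def critParam (κ : ℝ) (n : ℝ[X]) (S : ℂ × ℂ) : ℝ × ℝ :=
  (-κ * ((S.1 + 1) / (S.1 - 1)).im / (2 * (logDer n S).im),
    ((S.1 + 1) / (S.1 - 1)).re -
      ((S.1 + 1) / (S.1 - 1)).im / (logDer n S).im * (logDer n S).re)

theorem aeval_conj_real (p : ℝ[X]) (z : ℂ) :
    aeval ((starRingEnd ℂ) z) p = (starRingEnd ℂ) (aeval z p) := by
  have := Polynomial.aeval_algHom_apply Complex.conjAe.toAlgHom z p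
  simpa using this

theorem aeval_ofReal' (p : ℝ[X]) (t : ℝ) : aeval (t : ℂ) p = ((p.eval t : ℝ) : ℂ) := by
  rw [← Complex.coe_algebraMap, aeval_algebraMap_apply]
  simp

theorem logDer_conj (n : ℝ[X]) (z w : ℂ) :
    logDer n ((starRingEnd ℂ) z, (starRingEnd ℂ) w) = (starRingEnd ℂ) (logDer n (z, w)) := by
  simp [logDer, aeval_conj_real]

theorem logDer_neg (n : ℝ[X]) (z w : ℂ) : logDer n (z, -w) = -logDer n (z, w) := by
  simp [logDer, div_neg]

/-- Divided by (z - 1) w, the equation reads κ η = κ (z + 1)/(z - 1) + 2χ Y with Y the value of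
`logDer`. The imaginary part determines χ, then the real part determines η. -/
theorem critEq_iff {κ : ℝ} (hκ : κ ≠ 0) {n : ℝ[X]} {S : ℂ × ℂ} (h1 : S.1 ≠ 1) (hw : S.2 ≠ 0)
    (hY : (logDer n S).im ≠ 0) (v : ℝ × ℝ) : CritEq κ n v S ↔ v = critParam κ n S := by
  have hz : S.1 - 1 ≠ 0 := sub_ne_zero.2 h1
  have hκ' : (κ : ℂ) ≠ 0 := by exact_mod_cast hκ
  have e : CritEq κ n v S ↔
      (κ : ℂ) * v.2 = κ * ((S.1 + 1) / (S.1 - 1)) + 2 * v.1 * logDer n S := by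
    rw [CritEq, logDer]
    field_simp
    constructor
    · intro h; linear_combination h
    · intro h; linear_combination h
  rw [e, critParam]
  set y := (S.1 + 1) / (S.1 - 1)
  set Y := logDer n S
  constructor
  · intro h
    have hi := congrArg Complex.im h
    have hr := congrArg Complex.re h
    simp at hi hr
    have h2 : v.1 = -κ * y.im / (2 * Y.im) := by
      field_simp
      linarith
    have h3 : v.2 = y.re - y.im / Y.im * Y.re := by
      have : κ * v.2 = κ * (y.re - y.im / Y.im * Y.re) := by
        rw [hr, h2]; field_simp; ring
      exact mul_left_cancel₀ hκ this
    exact Prod.ext h2 h3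
  · intro h
    have h2 : v.1 = -κ * y.im / (2 * Y.im) := congrArg Prod.fst h
    have h3 : v.2 = y.re - y.im / Y.im * Y.re := congrArg Prod.snd h
    apply Complex.ext
    · simp
      rw [h2, h3]; field_simp; ring
    · simp
      rw [h2]; field_simp; ring

/-! ### Uniqueness and nondegeneracy of solutions off the real locus -/

namespace IsHarnackPair

variable {m : ℕ} {κ : ℝ} {P n : ℝ[X]} {x : ℕ → ℝ} (h : IsHarnackPair m κ P n x)
include h

theorem offReal_ne {z : ℂ} (hz : OffReal P z) : z ≠ 0 ∧ z ≠ 1 ∧ aeval z P ≠ 0 := by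
  rcases hz with hz | hz
  · exact ⟨by rintro rfl; simp at hz, by rintro rfl; simp at hz, h.aeval_ne_zero hz⟩
  · by_cases hi : z.im = 0
    · have e : z = (z.re : ℂ) := by apply Complex.ext <;> simp [hi]
      have hlt : z.re < 0 := by
        by_contra hcon
        exact absurd (h.eval_nonneg (not_lt.1 hcon)) (not_le.2 hz)
      refine ⟨by rintro rfl; simp at hlt, ?_, ?_⟩
      · rintro rfl; norm_num at hlt
      · rw [e, aeval_ofReal']; exact_mod_cast hz.ne
    · exact ⟨by rintro rfl; simp at hi, by rintro rfl; simp at hi, h.aeval_ne_zero hi⟩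

theorem offReal_snd_ne {S : ℂ × ℂ} (hS : S.2 ^ 2 = aeval S.1 P) (hz : OffReal P S.1) :
    S.2 ≠ 0 := by
  intro h0
  rw [h0] at hS
  exact (h.offReal_ne hz).2.2 (by rw [← hS]; simp)

omit h in
-- Square the equation, replace w² by z P₁(z) and cancel one factor z.
theorem critPoly_of_eq {P₁ : ℝ[X]} (hP₁ : P = X * P₁) {a b c : ℝ} {z w : ℂ}
    (hS : w ^ 2 = aeval z P) (hz : z ≠ 0)
    (he : (κ : ℂ) * (a * z - b) * w = 2 * c * z * aeval z n) :
    aeval z (critPoly κ P₁ n a b c) = 0 := by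
  have e : aeval z P = z * aeval z P₁ := by rw [hP₁]; simp
  have : z * aeval z (critPoly κ P₁ n a b c) = 0 := by
    simp only [critPoly, map_sub, map_mul, map_pow, aeval_X, aeval_C, Complex.coe_algebraMap]
    push_cast
    rw [e] at hS
    linear_combination (κ * (a * z - b) * w + 2 * c * z * aeval z n) * he -
      κ ^ 2 * (a * z - b) ^ 2 * hS
  exact (mul_eq_zero.1 this).resolve_left hz

theorem real_band {S : ℂ × ℂ} (hS : S.2 ^ 2 = aeval S.1 P) (hi : S.1.im = 0)
    (hz : OffReal P S.1) : ∃ t s : ℝ, t < 0 ∧ P.eval t < 0 ∧ s ≠ 0 ∧ S.1 = t ∧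
      S.2 = s * Complex.I := by
  have e : S.1 = (S.1.re : ℂ) := by apply Complex.ext <;> simp [hi]
  have hP : P.eval S.1.re < 0 := hz.resolve_left (by simpa using hi)
  have hlt : S.1.re < 0 := by
    by_contra hcon
    exact absurd (h.eval_nonneg (not_lt.1 hcon)) (not_le.2 hP)
  rw [e, aeval_ofReal'] at hS
  have hr := congrArg Complex.re hS
  have hm := congrArg Complex.im hS
  simp [sq] at hr hm
  have hw : S.2.re = 0 := by
    by_contra h0
    have : S.2.im = 0 := by
      rcases mul_eq_zero.1 (show S.2.re * S.2.im = 0 by linarith) with h1 | h1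
      · exact absurd h1 h0
      · exact h1
    rw [this] at hr
    nlinarith [sq_nonneg S.2.re]
  refine ⟨S.1.re, S.2.im, hlt, hP, ?_, e, ?_⟩
  · intro h0
    rw [hw, h0] at hr
    simp at hr
    linarith
  · apply Complex.ext <;> simp [hw]

/-- A real value y at a non-real z would solve the critical equation with a = b = y/κ and c = 1/2,
contradicting a b < 0 in `critPoly_nonreal`. At real z the value is purely imaginary, and it is
nonzero because n has no zeros where P < 0. -/
theorem logDer_im_ne_zero {S : ℂ × ℂ} (hS : S.2 ^ 2 = aeval S.1 P) (hz : OffReal P S.1) :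
    (logDer n S).im ≠ 0 := by
  intro h0
  obtain ⟨z0, z1, -⟩ := h.offReal_ne hz
  have hw := h.offReal_snd_ne hS hz
  have hz1 : S.1 - 1 ≠ 0 := sub_ne_zero.2 z1
  obtain ⟨y, hy⟩ : ∃ y : ℝ, logDer n S = y := ⟨_, Complex.ext rfl h0⟩
  rw [logDer, div_eq_iff (mul_ne_zero hz1 hw)] at hy
  by_cases hi : S.1.im = 0
  · obtain ⟨t, s, ht, hPt, hs, e1, e2⟩ := h.real_band hS hi hz
    rw [e1, e2, aeval_ofReal'] at hy
    have := congrArg Complex.re hy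
    simp at this
    rcases this with h1 | h1
    · exact ht.ne h1
    · exact h.n_eval_ne_zero hPt.le h1
  · obtain ⟨P₁, hP₁⟩ := h.X_dvd
    have hκ := h.kappa_pos.ne'
    have hκ' : (κ : ℂ) ≠ 0 := by exact_mod_cast hκ
    have h1 : aeval S.1 (critPoly κ P₁ n (y / κ) (y / κ) (1 / 2)) = 0 := by
      refine critPoly_of_eq hP₁ hS z0 ?_
      push_cast
      field_simp
      linear_combination -hy
    have := (h.critPoly_nonreal hP₁ (by norm_num) hi h1).1
    nlinarith [sq_nonneg (y / κ)]

/-- Where z is real and P < 0, w is purely imaginary, so the two sides of the equation are imaginary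
and real respectively and both vanish. Conversely, χ = 0 kills the right side, and the linear factor
on the left has no non-real zero. -/
theorem critEq_cases {S : ℂ × ℂ} (hS : S.2 ^ 2 = aeval S.1 P) (hz : OffReal P S.1)
    {v : ℝ × ℝ} (hv : CritEq κ n v S) :
    (S.1.im = 0 ∧ v.1 = 0 ∧ ((v.2 : ℂ) - 1) * S.1 - (v.2 + 1) = 0) ∨
      (S.1.im ≠ 0 ∧ v.1 ≠ 0 ∧ ((v.2 : ℂ) - 1) * S.1 - (v.2 + 1) ≠ 0) := by
  have hκ' : (κ : ℂ) ≠ 0 := by exact_mod_cast h.kappa_pos.ne'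
  have hw := h.offReal_snd_ne hS hz
  by_cases hi : S.1.im = 0
  · left
    obtain ⟨t, s, ht, hPt, hs, e1, e2⟩ := h.real_band hS hi hz
    rw [CritEq, e1, e2, aeval_ofReal'] at hv
    have hm := congrArg Complex.im hv
    have hr := congrArg Complex.re hv
    simp at hm hr
    have h1 : v.1 = 0 := by
      rcases hr with (h1 | h1) | h1
      · exact h1
      · exact absurd h1 ht.ne
      · exact absurd h1 (h.n_eval_ne_zero hPt.le)
    refine ⟨hi, h1, ?_⟩
    have h2 : (v.2 - 1) * t - (v.2 + 1) = 0 := by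
      rcases hm with (h2 | h2) | h2
      · exact absurd h2 h.kappa_pos.ne'
      · exact h2
      · exact absurd h2 hs
    rw [e1]
    exact_mod_cast h2
  · right
    have hne : ((v.2 : ℂ) - 1) * S.1 - (v.2 + 1) ≠ 0 := by
      intro h0
      have hm := congrArg Complex.im h0
      have hr := congrArg Complex.re h0
      simp [hi] at hm hr
      have : v.2 = 1 := by linarith
      rw [this] at hr
      norm_num at hr
    refine ⟨hi, ?_, hne⟩
    intro h0
    rw [CritEq, h0] at hv
    simp [h.kappa_pos.ne', hw] at hv
    exact hne hv

/-- In the non-real case, a = η - 1, b = η + 1 and c = χ turn a b < 0 into η² < 1 and 4c² < (a - b)²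
into χ² < 1. In the real case χ = 0 and z = (η + 1)/(η - 1) is negative. -/
theorem critEq_mem {S : ℂ × ℂ} (hS : S.2 ^ 2 = aeval S.1 P) (hz : OffReal P S.1)
    {v : ℝ × ℝ} (hv : CritEq κ n v S) : v ∈ Set.Ioo (-1 : ℝ) 1 ×ˢ Set.Ioo (-1 : ℝ) 1 := by
  rcases h.critEq_cases hS hz hv with ⟨hi, h1, h2⟩ | ⟨hi, h1, h2⟩
  · obtain ⟨t, s, ht, hPt, hs, e1, e2⟩ := h.real_band hS hi hz
    rw [e1] at h2
    have h3 : (v.2 - 1) * t - (v.2 + 1) = 0 := by exact_mod_cast h2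
    refine ⟨⟨by rw [h1]; norm_num, by rw [h1]; norm_num⟩, ?_, ?_⟩
    · nlinarith
    · nlinarith
  · obtain ⟨P₁, hP₁⟩ := h.X_dvd
    have h3 : aeval S.1 (critPoly κ P₁ n (v.2 - 1) (v.2 + 1) v.1) = 0 := by
      refine critPoly_of_eq hP₁ hS (h.offReal_ne hz).1 ?_
      push_cast
      exact hv
    obtain ⟨h4, h5, -⟩ := h.critPoly_nonreal hP₁ h1 hi h3
    have h6 : v.1 ^ 2 < 1 := by linarith
    have h7 : v.2 ^ 2 < 1 := by linarith
    exact ⟨abs_lt.1 ((sq_lt_one_iff_abs_lt_one _).1 h6),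
      abs_lt.1 ((sq_lt_one_iff_abs_lt_one _).1 h7)⟩

/-- The z-coordinate is determined up to conjugation, and then w by the equation itself or, for real
z, up to sign. The remaining candidate is the conjugate point, at which Im `logDer` has the opposite
sign. -/
theorem critEq_unique {S S' : ℂ × ℂ} (hS : S.2 ^ 2 = aeval S.1 P) (hz : OffReal P S.1)
    (hS' : S'.2 ^ 2 = aeval S'.1 P) (hz' : OffReal P S'.1) {v : ℝ × ℝ}
    (hv : CritEq κ n v S) (hv' : CritEq κ n v S')
    (hsign : 0 < (logDer n S).im * (logDer n S').im) : S = S' := by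
  obtain ⟨z, w⟩ := S
  obtain ⟨z', w'⟩ := S'
  have hκ' : (κ : ℂ) ≠ 0 := by exact_mod_cast h.kappa_pos.ne'
  rcases h.critEq_cases hS hz hv with ⟨hi, h1, h2⟩ | ⟨hi, h1, h2⟩
  · rcases h.critEq_cases hS' hz' hv' with ⟨hi', -, h2'⟩ | ⟨-, h1', -⟩
    · have hne : (v.2 : ℂ) - 1 ≠ 0 := by
        intro h0
        rw [h0] at h2
        have : (v.2 : ℂ) = 1 := by linear_combination h0
        rw [this] at h2
        norm_num at h2
      have hzz : z = z' := by
        apply mul_left_cancel₀ hne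
        simp only at h2 h2'
        linear_combination h2 - h2'
      subst hzz
      simp only at hS hS'
      have : (w - w') * (w + w') = 0 := by linear_combination hS - hS'
      rcases mul_eq_zero.1 this with h3 | h3
      · rw [sub_eq_zero.1 h3]
      · exfalso
        rw [show w' = -w by linear_combination h3, logDer_neg] at hsign
        simp at hsign
        nlinarith [sq_nonneg (logDer n (z, w)).im]
    · exact absurd h1 h1'
  · rcases h.critEq_cases hS' hz' hv' with ⟨-, h1', -⟩ | ⟨hi', -, h2'⟩
    · exact absurd h1' h1
    · obtain ⟨P₁, hP₁⟩ := h.X_dvd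
      have e1 : aeval z (critPoly κ P₁ n (v.2 - 1) (v.2 + 1) v.1) = 0 := by
        refine critPoly_of_eq hP₁ hS (h.offReal_ne hz).1 ?_
        push_cast
        exact hv
      have e2 : aeval z' (critPoly κ P₁ n (v.2 - 1) (v.2 + 1) v.1) = 0 := by
        refine critPoly_of_eq hP₁ hS' (h.offReal_ne hz').1 ?_
        push_cast
        exact hv'
      rcases (h.critPoly_nonreal hP₁ h1 hi e1).2.2.2 z' hi' e2 with h3 | h3
      · subst h3
        have : w = w' := by
          apply mul_left_cancel₀ (mul_ne_zero hκ' h2)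
          exact hv.trans hv'.symm
        rw [this]
      · exfalso
        subst h3
        have : w' = (starRingEnd ℂ) w := by
          apply mul_left_cancel₀ (mul_ne_zero hκ' h2')
          rw [CritEq] at hv hv'
          have := congrArg (starRingEnd ℂ) hv
          simp only at hv'
          simp [← aeval_conj_real, map_ofNat] at this
          exact hv'.trans this.symm
        rw [this, logDer_conj] at hsign
        simp at hsign
        nlinarith [sq_nonneg (logDer n (z, w)).im]

/-- The Jacobian of the system `w² = P(z)`, `CritEq`, in the variables `(z, w)`. -/
theorem jacobian_ne_zero {S : ℂ × ℂ} (hS : S.2 ^ 2 = aeval S.1 P) (hz : OffReal P S.1)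
    {v : ℝ × ℝ} (hv : CritEq κ n v S) :
    aeval S.1 (derivative P) * (κ * ((v.2 - 1) * S.1 - (v.2 + 1))) +
      2 * S.2 * (κ * (v.2 - 1) * S.2 - 2 * v.1 * (aeval S.1 n + S.1 * aeval S.1 (derivative n)))
      ≠ 0 := by
  obtain ⟨z, w⟩ := S
  have hκ' : (κ : ℂ) ≠ 0 := by exact_mod_cast h.kappa_pos.ne'
  have hw := h.offReal_snd_ne hS hz
  rcases h.critEq_cases hS hz hv with ⟨hi, h1, h2⟩ | ⟨hi, h1, h2⟩
  · rw [h2, h1]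
    have hne : (v.2 : ℂ) - 1 ≠ 0 := by
      intro h0
      rw [h0] at h2
      have : (v.2 : ℂ) = 1 := by linear_combination h0
      rw [this] at h2
      norm_num at h2
    simp only [mul_zero, zero_add, Complex.ofReal_zero, zero_mul, sub_zero]
    exact mul_ne_zero (mul_ne_zero two_ne_zero hw) (mul_ne_zero (mul_ne_zero hκ' hne) hw)
  · obtain ⟨P₁, hP₁⟩ := h.X_dvd
    have e1 : aeval z (critPoly κ P₁ n (v.2 - 1) (v.2 + 1) v.1) = 0 := by
      refine critPoly_of_eq hP₁ hS (h.offReal_ne hz).1 ?_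
      push_cast
      exact hv
    have hd := (h.critPoly_nonreal hP₁ h1 hi e1).2.2.1
    have hz0 := (h.offReal_ne hz).1
    intro h0
    apply hd
    -- Multiplying by X restores P, so that w² = P(z) can be used. At a solution the derivative of
    -- this identity expresses the Jacobian through the derivative of `critPoly`, which is nonzero
    -- because the zero is simple.
    have hX : X * critPoly κ P₁ n (v.2 - 1) (v.2 + 1) v.1 =
        C (κ ^ 2) * (C (v.2 - 1) * X - C (v.2 + 1)) ^ 2 * P - C (4 * v.1 ^ 2) * (X * n) ^ 2 := by
      rw [hP₁, critPoly]; ring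
    have hX' := congrArg (fun p => aeval z (derivative p)) hX
    rw [CritEq] at hv
    simp [derivative_pow] at hX' hv hS h0 e1
    rw [e1] at hX'
    apply (mul_eq_zero.1 (show z * _ = 0 from ?_)).resolve_left hz0
    set p' := aeval z (derivative P)
    set n' := aeval z (derivative n)
    set n₀ := aeval z n
    set D : ℂ := (v.2 - 1) * z - (v.2 + 1)
    rw [zero_add] at hX'
    rw [hX', ← hS]
    linear_combination κ * D * h0 + 4 * v.1 * (n₀ + z * n') * hv

end IsHarnackPair

/-! ### The spectral curve of the transfer matrix -/

theorem isSpectralPoly_of_roots {P : ℝ[X]} {m : ℕ} (hd : P.natDegree = 2 * m + 1)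
    (hl : 0 < P.leadingCoeff) (hs : Squarefree P)
    (hr : ∀ z : ℂ, aeval z P = 0 → ∃ t : ℝ, t ≤ 0 ∧ z = t) (h0 : P.eval 0 = 0) :
    IsSpectralPoly m P fun l => (P.roots.sort (· ≥ ·)).getD l 0 := by
  have hP0 : P ≠ 0 := by rintro rfl; simp at hl
  have hsplit : P.Splits := by
    refine Splits.of_splits_map (algebraMap ℝ ℂ) (IsAlgClosed.splits _) fun z hz => ?_
    rw [mem_roots_map hP0, ← aeval_def] at hz
    obtain ⟨t, -, rfl⟩ := hr z hz
    exact ⟨t, rfl⟩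
  have hcard : P.roots.card = 2 * m + 1 := by rw [← hsplit.natDegree_eq_card_roots, hd]
  have hnodup : P.roots.Nodup := nodup_roots (PerfectField.separable_iff_squarefree.2 hs)
  set l := P.roots.sort (· ≥ ·) with hldef
  have hlen : l.length = 2 * m + 1 := by rw [hldef, Multiset.length_sort, hcard]
  have hlco : (l : Multiset ℝ) = P.roots := Multiset.sort_eq _ _
  have hmono : l.Pairwise (· ≥ ·) := Multiset.pairwise_sort _ _
  have hlnd : l.Nodup := by rw [← Multiset.coe_nodup, hlco]; exact hnodup
  have hlt : ∀ i j, i < j → j < 2 * m + 1 → l.getD j 0 < l.getD i 0 := by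
    intro i j hij hj
    rw [List.getD_eq_getElem _ _ (by omega), List.getD_eq_getElem _ _ (by omega)]
    refine lt_of_le_of_ne (List.pairwise_iff_getElem.1 hmono i j (by omega) (by omega) hij) ?_
    intro he
    have := (List.Nodup.getElem_inj_iff hlnd).1 he
    omega
  have hnonpos : ∀ y ∈ l, y ≤ 0 := by
    intro y hy
    rw [← Multiset.mem_coe, hlco, mem_roots hP0] at hy
    obtain ⟨t, ht, e⟩ := hr (y : ℝ) (by rw [aeval_ofReal', hy.eq_zero]; simp)
    have : y = t := by exact_mod_cast e
    rw [this]; exact ht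
  have hmem : ∀ j, j < 2 * m + 1 → l.getD j 0 ≤ 0 := by
    intro j hj
    rw [List.getD_eq_getElem _ _ (by omega)]
    exact hnonpos _ (List.getElem_mem _)
  refine ⟨⟨P.leadingCoeff, hl, ?_⟩, ?_, hlt⟩
  · conv_lhs => rw [hsplit.eq_prod_roots, ← hlco]
    congr 1
    rw [Multiset.map_coe, Multiset.prod_coe, ← hlen, Finset.prod_range, ← List.prod_ofFn]
    congr 1
    apply List.ext_getElem
    · simp
    · intro i h1 h2
      simp at h1
      simp
  · have : (0 : ℝ) ∈ l := by
      rw [← Multiset.mem_coe, hlco, mem_roots hP0]; exact h0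
    obtain ⟨i, hi, e⟩ := List.getElem_of_mem this
    have e' : l.getD i 0 = 0 := by rw [List.getD_eq_getElem _ _ hi, e]
    rcases Nat.eq_zero_or_pos i with rfl | hpos
    · exact e'
    · have := hlt 0 i hpos (by omega)
      have := hmem 0 (by omega)
      linarith

/-! ### The factor q and the zeros of n in the gaps -/

section

variable {k : ℕ} (hk : 0 < k) (α β : Fin k → ℝ) (hα : ∀ m, 0 < α m) (hβ : ∀ m, 0 < β m)
  (hαβ : ∏ m, α m = ∏ m, β m)
include hk hα hβ

theorem q_eval_one_ne_zero : (q α β).eval 1 ≠ 0 := by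
  intro h0
  have h1 := discPoly_eval_one_pos α β hα hβ hk
  rw [(factorPair_spec hk α β hα hβ).1] at h1
  simp [h0] at h1

-- At a zero of q one has p = p' = 0 and p'' = 2 q'² p₀, while p'' < 0 by `discPoly_double_zero`.
-- The point is not 0 because p'(0) > 0.
include hαβ in
theorem q_zero {t : ℝ} (ht : (q α β).eval t = 0) : (p0 α β).eval t < 0 := by
  obtain ⟨hp, -, hq⟩ := factorPair_spec hk α β hα hβ
  have h0 : (discPoly α β).eval t = 0 := by rw [hp]; simp [ht]
  have h1 : (derivative (discPoly α β)).eval t = 0 := by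
    rw [hp]; simp [ht, derivative_pow]
  have h2 : (derivative (derivative (discPoly α β))).eval t =
      2 * (derivative (q α β)).eval t ^ 2 * (p0 α β).eval t := by
    rw [hp, sq]
    simp only [derivative_mul, derivative_add, eval_add, eval_mul, ht]
    ring
  obtain ⟨s, hs, e⟩ := discPoly_zero_real hk α β hα hβ (z := (t : ℂ))
    (by rw [aeval_ofReal', h0]; simp)
  have e : t = s := by exact_mod_cast e
  subst e
  have hlt : t < 0 := by
    refine lt_of_le_of_ne hs ?_
    rintro rfl
    exact ((discPoly_eval_zero α β hα hβ hαβ).2 hk).ne' h1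
  have h3 := discPoly_double_zero hk α β hα hβ hlt h0 h1
  rw [h2] at h3
  by_contra hcon
  have : 0 ≤ 2 * (derivative (q α β)).eval t ^ 2 * (p0 α β).eval t := by
    have := not_lt.1 hcon
    positivity
  linarith

theorem natDegree_p0 : 2 * (q α β).natDegree + (p0 α β).natDegree = 2 * k - 1 ∧
    (p0 α β).natDegree = 2 * (kPrime α β - 1) + 1 ∧ 0 < (p0 α β).leadingCoeff := by
  obtain ⟨hp, -, hq⟩ := factorPair_spec hk α β hα hβ
  obtain ⟨hd, hl⟩ := natDegree_discPoly α β hα hβ hk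
  have h0 : p0 α β ≠ 0 := by rintro h0; rw [hp, h0] at hl; simp at hl
  rw [hp, natDegree_mul (pow_ne_zero _ hq.ne_zero) h0, natDegree_pow] at hd
  rw [hp, leadingCoeff_mul, leadingCoeff_pow, hq.leadingCoeff, one_pow, one_mul] at hl
  refine ⟨hd, ?_, hl⟩
  unfold kPrime
  omega

include hαβ in
theorem isSpectralPoly_p0 : IsSpectralPoly (kPrime α β - 1) (p0 α β) (x α β) := by
  obtain ⟨hp, hs, hq⟩ := factorPair_spec hk α β hα hβ
  obtain ⟨-, hd, hl⟩ := natDegree_p0 hk α β hα hβ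
  refine isSpectralPoly_of_roots hd hl hs (fun z hz => ?_) ?_
  · refine discPoly_zero_real hk α β hα hβ ?_
    rw [hp, map_mul, hz, mul_zero]
  · have h0 := (discPoly_eval_zero α β hα hβ hαβ).1
    rw [hp] at h0
    simp at h0
    rcases h0 with h0 | h0
    · exfalso
      have h1 := (discPoly_eval_zero α β hα hβ hαβ).2 hk
      rw [hp] at h1
      simp [h0, derivative_pow] at h1
    · exact h0

omit hα hβ in
/-- The numerator of the derivative of `Tr Φ`. -/
theorem derivative_discPoly :
    2 * trPoly α β * ((X - 1) * derivative (trPoly α β) - (k : ℝ[X]) * trPoly α β) =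
    (X - 1) * derivative (discPoly α β) - 2 * (k : ℝ[X]) * discPoly α β := by
  have h4 : (4 : ℝ[X]) = C 4 := rfl
  obtain ⟨j, hj⟩ : ∃ j, 2 * k = j + 1 := ⟨2 * k - 1, by omega⟩
  have hj' : 2 * (k : ℝ[X]) = (j : ℝ[X]) + 1 := by exact_mod_cast congrArg (Nat.cast (R := ℝ[X])) hj
  rw [discPoly_eq_trPoly, h4]
  simp [derivative_pow, hj]
  rw [← h4, show (C 2 : ℝ[X]) = 2 from rfl]
  linear_combination (-4 * (X - 1) ^ (j + 1)) * hj'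

/-- Because q² divides p, q divides (X - 1) p' - 2k p, which is 2T times the polynomial in question.
And q is coprime to T: a common factor would divide 4 (X - 1)^(2k), but q(1) ≠ 0. -/
theorem q_dvd : q α β ∣ (X - 1) * derivative (trPoly α β) - (k : ℝ[X]) * trPoly α β := by
  obtain ⟨hp, hs, hq⟩ := factorPair_spec hk α β hα hβ
  have hX : IsCoprime (q α β) (X - 1) := by
    have : Irreducible (X - 1 : ℝ[X]) := by
      rw [show (1 : ℝ[X]) = C 1 from rfl]; exact irreducible_X_sub_C 1
    refine ((Irreducible.coprime_iff_not_dvd this).2 ?_).symm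
    intro hdvd
    rw [show (1 : ℝ[X]) = C 1 from rfl] at hdvd
    exact q_eval_one_ne_zero hk α β hα hβ (dvd_iff_isRoot.1 hdvd)
  have h2 : IsCoprime (q α β) (C 4 * (X - 1) ^ (2 * k)) :=
    IsCoprime.mul_right (isCoprime_one_right.of_isCoprime_of_dvd_right
      (isUnit_C.2 (isUnit_iff_ne_zero.2 (by norm_num))).dvd) hX.pow_right
  have h3 : IsCoprime (q α β) (trPoly α β) := by
    have e : C 4 * (X - 1) ^ (2 * k) = trPoly α β * trPoly α β +
        q α β * (-(q α β * p0 α β)) := by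
      have := hp
      rw [discPoly_eq_trPoly] at this
      rw [show (C 4 : ℝ[X]) = 4 from rfl]
      linear_combination -this
    rw [e] at h2
    exact IsCoprime.of_mul_right_left (IsCoprime.of_add_mul_left_right h2)
  have h4 : IsCoprime (q α β) (C 2 * trPoly α β) :=
    IsCoprime.mul_right (isCoprime_one_right.of_isCoprime_of_dvd_right
      (isUnit_C.2 (isUnit_iff_ne_zero.2 (by norm_num))).dvd) h3
  refine h4.dvd_of_dvd_mul_left ?_
  rw [show (C 2 : ℝ[X]) = 2 from rfl, derivative_discPoly hk α β, hp]
  refine dvd_sub (dvd_mul_of_dvd_right ?_ _) (dvd_mul_of_dvd_right ?_ _)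
  · simp only [derivative_mul, sq]
    refine dvd_add (dvd_mul_of_dvd_left (dvd_add ?_ ?_) _) ?_
    · exact dvd_mul_left _ _
    · exact dvd_mul_right _ _
    · rw [mul_assoc]; exact dvd_mul_right _ _
  · rw [sq, mul_assoc]; exact dvd_mul_right _ _

-- The function p / (t - 1)^(2k) vanishes at both ends of a gap, so Rolle gives a zero of its
-- derivative, whose numerator is a multiple of T q n. In the gap T ≠ 0 because T² = p + 4 (t -
-- 1)^(2k) > 0, and q ≠ 0 because p₀ > 0.
include hαβ in
theorem exists_isHarnackPair : ∃ n : ℝ[X],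
    (X - 1) * derivative (trPoly α β) - (k : ℝ[X]) * trPoly α β = q α β * n ∧
    IsHarnackPair (kPrime α β - 1) k (p0 α β) n (x α β) := by
  obtain ⟨n, hn⟩ := q_dvd hk α β hα hβ
  obtain ⟨hp, hs, hq⟩ := factorPair_spec hk α β hα hβ
  obtain ⟨hd1, hd2, -⟩ := natDegree_p0 hk α β hα hβ
  have hsp := isSpectralPoly_p0 hk α β hα hβ hαβ
  have hk' : (0 : ℝ) < k := by exact_mod_cast hk
  have hone : (q α β).eval 1 * n.eval 1 = -k * (trPoly α β).eval 1 := by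
    have := congrArg (eval 1) hn
    simp at this
    linarith
  have hT1 := trPoly_eval_one_pos α β hα hβ
  have hn0 : n ≠ 0 := by
    rintro rfl
    simp at hone
    rcases hone with h1 | h1
    · omega
    · exact hT1.ne' h1
  refine ⟨n, hn, hsp, hk', ?_, ?_, ?_⟩
  -- The coefficients of degree k cancel. With 2 deg q + 2m + 1 = 2k - 1 this leaves deg n ≤ m.
  · have hdeg : ((X - 1) * derivative (trPoly α β) - (k : ℝ[X]) * trPoly α β).natDegree ≤ k - 1 := by
      refine natDegree_le_iff_coeff_eq_zero.2 fun j hj => ?_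
      obtain ⟨j, rfl⟩ : ∃ i, j = i + 1 := ⟨j - 1, by omega⟩
      rw [sub_mul, one_mul, coeff_sub, coeff_sub, coeff_X_mul, coeff_natCast_mul, coeff_derivative,
        coeff_derivative, trPoly_coeff_eq_zero α β hα hβ (show k < j + 1 + 1 by omega)]
      rcases (show k ≤ j + 1 by omega).eq_or_lt with e | e
      · rw [show (k : ℝ) = j + 1 by exact_mod_cast e]; ring
      · rw [trPoly_coeff_eq_zero α β hα hβ e]; ring
    rw [hn, natDegree_mul hq.ne_zero hn0] at hdeg
    omega
  · have h1 : (q α β).eval 1 ^ 2 * (p0 α β).eval 1 = (trPoly α β).eval 1 ^ 2 := by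
      have := congrArg (eval 1) hp
      rw [discPoly_eq_trPoly] at this
      simp [hk.ne'] at this
      exact this.symm
    have hq1 := q_eval_one_ne_zero hk α β hα hβ
    apply mul_left_cancel₀ (pow_ne_zero 2 hq1)
    rw [mul_left_comm, h1]
    linear_combination ((q α β).eval 1 * n.eval 1 - k * (trPoly α β).eval 1) * hone
  · intro l hl
    have hlt := hsp.x_lt (2 * l + 1) (2 * l + 2) (by omega) (by omega)
    have hb := hsp.x_neg (j := 2 * l + 1) (by omega) (by omega)
    have hz : ∀ j, j < 2 * (kPrime α β - 1) + 1 → (discPoly α β).eval (x α β j) = 0 := by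
      intro j hj
      rw [hp, eval_mul, hsp.eval_x hj, mul_zero]
    have hfun : ∀ t < (0 : ℝ), HasDerivAt
        (fun t : ℝ => (discPoly α β).eval t / (t - 1) ^ (2 * k))
        (((derivative (discPoly α β)).eval t * (t - 1) ^ (2 * k) -
          (discPoly α β).eval t * ((2 * k : ℕ) * (t - 1) ^ (2 * k - 1) * 1)) /
            ((t - 1) ^ (2 * k)) ^ 2) t := by
      intro t ht
      exact ((discPoly α β).hasDerivAt t).div (((hasDerivAt_id t).sub_const 1).pow (2 * k))
        (pow_ne_zero _ (by simp; linarith))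
    obtain ⟨c, ⟨hc1, hc2⟩, hc⟩ := exists_hasDerivAt_eq_zero hlt
      (fun t ht => (hfun t (by linarith [ht.2])).continuousAt.continuousWithinAt)
      (by rw [hz _ (by omega), hz _ (by omega)]; simp)
      (fun t ht => hfun t (by linarith [ht.2]))
    refine ⟨c, hc1, hc2, ?_⟩
    have hcm : c - 1 ≠ 0 := by linarith
    have hP := (hsp.eval_gap hl).2 hc1 hc2
    have hpc : 0 ≤ (discPoly α β).eval c := by rw [hp]; simp; positivity
    have hT : (trPoly α β).eval c ≠ 0 := by
      intro h0
      rw [discPoly_eq_trPoly] at hpc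
      simp [h0] at hpc
      have : 0 < 4 * (c - 1) ^ (2 * k) := by
        have := (even_two_mul k).pow_pos hcm
        positivity
      linarith
    have hqc : (q α β).eval c ≠ 0 := by
      intro h0
      exact absurd (q_zero hk α β hα hβ hαβ h0) (not_lt.2 hP.le)
    have e := congrArg (eval c) (derivative_discPoly hk α β)
    rw [hn] at e
    have hj : 2 * k = (2 * k - 1) + 1 := by omega
    rw [div_eq_zero_iff] at hc
    have hc := hc.resolve_right (pow_ne_zero _ (pow_ne_zero _ hcm))
    have hc' : (c - 1) ^ (2 * k - 1) * ((c - 1) * (derivative (discPoly α β)).eval c -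
        2 * k * (discPoly α β).eval c) = 0 := by
      rw [← hc]
      nth_rw 2 [hj]
      push_cast
      ring
    have hc'' := (mul_eq_zero.1 hc').resolve_left (pow_ne_zero _ hcm)
    simp [hc'', hT, hqc] at e
    exact e

end

/-! ### Local branches -/

theorem exists_isLogBranch {h : ℂ → ℂ} (hh : AnalyticAt ℂ h 0) (h0 : h 0 ≠ 0) :
    ∃ f, IsLogBranch h f := by
  refine ⟨fun t => Complex.log (h 0) + Complex.log (h t / h 0), ?_, ?_⟩
  · refine analyticAt_const.add ((hh.div_const).clog ?_)
    simp [div_self h0]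
  · filter_upwards [hh.continuousAt.eventually_ne h0] with t ht
    rw [Complex.exp_add, Complex.exp_log h0, Complex.exp_log (div_ne_zero ht h0)]
    field_simp

theorem IsLogBranch.ne_zero {h f : ℂ → ℂ} (hf : IsLogBranch h f) : h 0 ≠ 0 := by
  rw [← hf.2.self_of_nhds]
  exact Complex.exp_ne_zero _

theorem IsLogBranch.hasDerivAt {h f : ℂ → ℂ} {h' : ℂ} (hf : IsLogBranch h f)
    (hh : HasDerivAt h h' 0) : HasDerivAt f (h' / h 0) 0 := by
  have h1 := hf.1.differentiableAt.hasDerivAt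
  have h2 := (h1.cexp.congr_of_eventuallyEq (hf.2.mono fun t ht => ht.symm)).unique hh
  rw [hf.2.self_of_nhds] at h2
  rw [← h2, mul_div_cancel_left₀ _ hf.ne_zero]
  exact h1

/-- Near a point with `w ≠ 0`, the curve `w² = P(z)` is parametrized by `z`. -/
theorem exists_local_graph {P : ℝ[X]} {z w : ℂ} (hS : w ^ 2 = aeval z P) (hw : w ≠ 0) :
    ∃ g : ℂ → ℂ, AnalyticAt ℂ g 0 ∧ g 0 = w ∧ ∀ᶠ t in 𝓝 (0 : ℂ), g t ^ 2 = aeval (z + t) P := by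
  have ha : AnalyticAt ℂ (fun t => aeval (z + t) P) 0 :=
    (analyticAt_const.add analyticAt_id).aeval_polynomial P
  have h0 : aeval (z + 0) P ≠ 0 := by rw [add_zero, ← hS]; exact pow_ne_zero _ hw
  obtain ⟨c, hc, he⟩ := exists_isLogBranch ha h0
  refine ⟨fun t => w * Complex.exp ((c t - c 0) / 2), ?_, by simp, ?_⟩
  · exact analyticAt_const.mul ((hc.sub analyticAt_const).div_const).cexp'
  · filter_upwards [he] with t ht
    rw [mul_pow, hS, ← Complex.exp_nat_mul, ← ht]
    have e : ((2 : ℕ) : ℂ) * ((c t - c 0) / 2) = c t - c 0 := by push_cast; ring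
    have := he.self_of_nhds
    simp only [add_zero] at this
    rw [e, Complex.exp_sub, ← this]
    field_simp [Complex.exp_ne_zero]

/-! ### The critical points -/

section

variable {k : ℕ} (hk : 0 < k) (α β : Fin k → ℝ) (hα : ∀ m, 0 < α m) (hβ : ∀ m, 0 < β m)

theorem rho_eq {z w : ℂ} (h0 : z ≠ 0) (h1 : z ≠ 1) :
    rho α β (z, w) = (aeval z (trPoly α β) + aeval z (q α β) * w) / (2 * (z - 1) ^ k) := by
  have h : aeval z (trPoly α β) = (z - 1) ^ k * (Phi α β z).trace := by
    rw [← smul_eq_mul, ← Matrix.trace_smul, ← Phi_eq α β h0 h1]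
    simp [trPoly, Matrix.trace, Fin.sum_univ_two]
  have hz : (z - 1) ^ k ≠ 0 := pow_ne_zero _ (sub_ne_zero.2 h1)
  rw [rho, h]
  simp only
  field_simp

include hk hα hβ

/-- In other words ρ(z, w) ρ(z, -w) = 1. Hence ρ has no zeros away from z = 0, 1, and log ρ has
local branches there. -/
theorem norm_identity {z w : ℂ} (hS : w ^ 2 = aeval z (p0 α β)) :
    (aeval z (trPoly α β) + aeval z (q α β) * w) * (aeval z (trPoly α β) - aeval z (q α β) * w)
      = 4 * (z - 1) ^ (2 * k) := by
  have h := congrArg (aeval z) (factorPair_spec hk α β hα hβ).1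
  have h4 : aeval z (4 : ℝ[X]) = 4 := map_ofNat _ 4
  rw [discPoly_eq_trPoly] at h
  simp [h4] at h
  linear_combination h - aeval z (q α β) ^ 2 * hS

theorem numerator_identity {n : ℝ[X]}
    (hn : (X - 1) * derivative (trPoly α β) - (k : ℝ[X]) * trPoly α β = q α β * n) :
    2 * trPoly α β * n = (X - 1) * (2 * derivative (q α β) * p0 α β +
      q α β * derivative (p0 α β)) - 2 * (k : ℝ[X]) * q α β * p0 α β := by
  obtain ⟨hp, -, hq⟩ := factorPair_spec hk α β hα hβ
  have h := derivative_discPoly hk α β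
  rw [hn, hp, sq] at h
  simp only [derivative_mul] at h
  apply mul_left_cancel₀ hq.ne_zero
  linear_combination h

/-- This is d log ρ = n dz / ((z - 1) w). Differentiating T + q w produces w', which is eliminated
by 2 w w' = p₀' z'; `numerator_identity` then collects the terms into a multiple of T + q w. -/
theorem hasDerivAt_rho {n : ℝ[X]}
    (hn : (X - 1) * derivative (trPoly α β) - (k : ℝ[X]) * trPoly α β = q α β * n)
    {z w : ℂ → ℂ} {z' w' : ℂ} (hz : HasDerivAt z z' 0) (hw : HasDerivAt w w' 0)
    (h0 : z 0 ≠ 0) (h1 : z 0 ≠ 1) (hw0 : w 0 ≠ 0)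
    (hS : ∀ᶠ t in 𝓝 (0 : ℂ), w t ^ 2 = aeval (z t) (p0 α β)) :
    HasDerivAt (fun t => rho α β (z t, w t))
      (rho α β (z 0, w 0) * (aeval (z 0) n * z' / ((z 0 - 1) * w 0))) 0 := by
  have hz1 : z 0 - 1 ≠ 0 := sub_ne_zero.2 h1
  have hzk : (z 0 - 1) ^ k ≠ 0 := pow_ne_zero _ hz1
  have hev : (fun t => rho α β (z t, w t)) =ᶠ[𝓝 0] fun t =>
      (aeval (z t) (trPoly α β) + aeval (z t) (q α β) * w t) / (2 * (z t - 1) ^ k) := by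
    filter_upwards [hz.continuousAt.eventually_ne h0, hz.continuousAt.eventually_ne h1]
      with t ht0 ht1 using rho_eq α β ht0 ht1
  have hpol : ∀ p : ℝ[X], HasDerivAt (fun t => aeval (z t) p) (aeval (z 0) (derivative p) * z') 0 :=
    fun p => (p.hasDerivAt_aeval (z 0)).comp 0 hz
  have hcurve : 2 * w 0 * w' = aeval (z 0) (derivative (p0 α β)) * z' := by
    have := ((hw.pow 2).congr_of_eventuallyEq (hS.mono fun t ht => ht.symm)).unique (hpol (p0 α β))
    rw [← this]; simp
  have hd := (((hpol (trPoly α β)).add ((hpol (q α β)).mul hw)).div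
    (((hz.sub_const 1).pow k).const_mul 2) (mul_ne_zero two_ne_zero hzk))
  refine (hd.congr_of_eventuallyEq hev).congr_deriv ?_
  have e1 := congrArg (aeval (z 0)) (numerator_identity hk α β hα hβ hn)
  have e2 := congrArg (aeval (z 0)) hn
  have h2 : aeval (z 0) (2 : ℝ[X]) = 2 := map_ofNat _ 2
  simp only [map_sub, map_mul, map_add, aeval_X, map_one, map_natCast, h2] at e1 e2
  have hS0 := hS.self_of_nhds
  rw [rho_eq α β h0 h1]
  obtain ⟨j, hj⟩ : ∃ j, k = j + 1 := ⟨k - 1, by omega⟩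
  have hkj : (k : ℂ) = j + 1 := by exact_mod_cast hj
  have hpow : (z 0 - 1) ^ k = (z 0 - 1) ^ j * (z 0 - 1) := by rw [← pow_succ, ← hj]
  have hpow' : (z 0 - 1) ^ (k - 1) = (z 0 - 1) ^ j := by rw [hj]; rfl
  have hzj : (z 0 - 1) ^ j ≠ 0 := pow_ne_zero _ hz1
  simp only [Pi.add_apply, Pi.mul_apply, Pi.pow_apply]
  rw [hpow, hpow']
  generalize aeval (z 0) (trPoly α β) = T at *
  generalize aeval (z 0) (derivative (trPoly α β)) = T' at *
  generalize aeval (z 0) (q α β) = Q at *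
  generalize aeval (z 0) (derivative (q α β)) = Q' at *
  generalize aeval (z 0) (p0 α β) = R at *
  generalize aeval (z 0) (derivative (p0 α β)) = R' at *
  generalize aeval (z 0) n = N at *
  generalize (z 0 - 1) ^ j = D at *
  generalize (k : ℂ) = K at *
  field_simp
  linear_combination w 0 * z' * e2 - z' / 2 * e1 + (z 0 - 1) * z' * Q' * hS0 +
    (z 0 - 1) * Q / 2 * hcurve - K * Q * z' * hS0

theorem isBranchOfF_hasDerivAt {n : ℝ[X]}
    (hn : (X - 1) * derivative (trPoly α β) - (k : ℝ[X]) * trPoly α β = q α β * n)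
    {S : Curve α β} (h0 : S.1.1 ≠ 0) (h1 : S.1.1 ≠ 1) (hw : S.1.2 ≠ 0) {v : ℝ × ℝ}
    {γ : ℂ → ℂ × ℂ} {f : ℂ → ℂ} (hγ : IsLocalParam α β S γ) (hf : IsBranchOfF α β v γ f) :
    deriv f 0 = 0 ↔ CritEq k n v S.1 := by
  obtain ⟨ha, hγ0, hγ', hc⟩ := hγ
  obtain ⟨a, b, c, hA, hB, hC, rfl⟩ := hf
  have hd := ha.differentiableAt.hasDerivAt
  set D := deriv γ 0 with hD
  have hz : HasDerivAt (fun t => (γ t).1) D.1 0 :=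
    (hasFDerivAt_fst (𝕜 := ℂ) (p := γ 0)).comp_hasDerivAt (0 : ℂ) hd
  have hw' : HasDerivAt (fun t => (γ t).2) D.2 0 :=
    (hasFDerivAt_snd (𝕜 := ℂ) (p := γ 0)).comp_hasDerivAt (0 : ℂ) hd
  have hc' : ∀ᶠ t in 𝓝 (0 : ℂ), (γ t).2 ^ 2 = aeval (γ t).1 (p0 α β) :=
    hc.mono fun t ht => sub_eq_zero.1 ht
  have hcurve : 2 * S.1.2 * D.2 = aeval S.1.1 (derivative (p0 α β)) * D.1 := by
    have h2 := ((p0 α β).hasDerivAt_aeval (γ 0).1).comp 0 hz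
    have := ((hw'.pow 2).congr_of_eventuallyEq (hc'.mono fun t ht => ht.symm)).unique h2
    rw [hγ0] at this
    rw [← this]; simp
  -- As w ≠ 0, the curve is a graph over z, so the z-component of a chart has nonzero derivative.
  have hD1 : D.1 ≠ 0 := by
    intro h
    apply hγ'
    rw [h, mul_zero] at hcurve
    exact Prod.ext h (by simpa [hw] using hcurve)
  have hr := hasDerivAt_rho hk α β hα hβ hn hz hw' (by rw [hγ0]; exact h0) (by rw [hγ0]; exact h1)
    (by rw [hγ0]; exact hw) hc'
  have dA := hA.hasDerivAt hz
  have dB := hB.hasDerivAt (hz.sub_const 1)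
  have dC := hC.hasDerivAt hr
  have hne := hC.ne_zero
  simp only [Prod.mk.eta] at dA dB dC
  rw [mul_div_cancel_left₀ _ hne] at dC
  have hdf := ((dA.const_mul ((k : ℂ) / 4 * ((v.2 : ℂ) + 1))).sub
    (dB.const_mul ((k : ℂ) / 2))).sub (dC.const_mul ((v.1 : ℂ) / 2))
  have hdf' : deriv (fun t => (k : ℂ) / 4 * ((v.2 : ℂ) + 1) * a t - (k : ℂ) / 2 * b t -
      (v.1 : ℂ) / 2 * c t) 0 = _ := hdf.deriv
  rw [hdf', hγ0, CritEq]
  have hz1 : S.1.1 - 1 ≠ 0 := sub_ne_zero.2 h1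
  have e : (k : ℂ) / 4 * ((v.2 : ℂ) + 1) * (D.1 / S.1.1) - (k : ℂ) / 2 * (D.1 / (S.1.1 - 1)) -
      (v.1 : ℂ) / 2 * (aeval S.1.1 n * D.1 / ((S.1.1 - 1) * S.1.2)) =
      D.1 / (4 * S.1.1 * (S.1.1 - 1) * S.1.2) *
        ((k : ℂ) * ((v.2 - 1) * S.1.1 - (v.2 + 1)) * S.1.2 - 2 * v.1 * S.1.1 * aeval S.1.1 n) := by
    field_simp
    ring
  have hfac : D.1 / (4 * S.1.1 * (S.1.1 - 1) * S.1.2) ≠ 0 := by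
    refine div_ne_zero hD1 ?_
    simp [h0, hz1, hw]
  rw [e, mul_eq_zero, or_iff_right hfac, sub_eq_zero]
  norm_cast

theorem isCriticalPoint_iff {n : ℝ[X]}
    (hn : (X - 1) * derivative (trPoly α β) - (k : ℝ[X]) * trPoly α β = q α β * n)
    {S : Curve α β} (h0 : S.1.1 ≠ 0) (h1 : S.1.1 ≠ 1) (hw : S.1.2 ≠ 0) (v : ℝ × ℝ) :
    IsCriticalPoint α β v (S : Surface α β) ↔ CritEq k n v S.1 := by
  constructor
  · rintro ⟨S', hSS', h0', h1', γ, f, hγ, hf, hd⟩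
    have := OnePoint.coe_injective hSS'
    subst this
    exact (isBranchOfF_hasDerivAt hk α β hα hβ hn h0 h1 hw hγ hf).1 hd
  · intro hv
    have hS : S.1.2 ^ 2 = aeval S.1.1 (p0 α β) := sub_eq_zero.1 S.2
    obtain ⟨g, hg, hg0, hgS⟩ := exists_local_graph hS hw
    set γ : ℂ → ℂ × ℂ := fun t => (S.1.1 + t, g t) with hγdef
    have haz : AnalyticAt ℂ (fun t : ℂ => S.1.1 + t) 0 := analyticAt_const.add analyticAt_id
    have hγ0 : γ 0 = S.1 := by simp [hγdef, hg0]
    have hγ : IsLocalParam α β S γ := by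
      refine ⟨haz.prod hg, hγ0, ?_, hgS.mono fun t ht => sub_eq_zero.2 ht⟩
      have : HasDerivAt γ (1, deriv g 0) 0 :=
        ((hasDerivAt_id (0 : ℂ)).const_add S.1.1).prodMk hg.differentiableAt.hasDerivAt
      rw [this.deriv]
      intro h
      exact one_ne_zero (congrArg Prod.fst h)
    obtain ⟨a, hA⟩ := exists_isLogBranch (h := fun t => (γ t).1) haz (by rw [hγ0]; exact h0)
    obtain ⟨b, hB⟩ := exists_isLogBranch (h := fun t => (γ t).1 - 1) (haz.sub analyticAt_const)
      (by rw [hγ0]; exact sub_ne_zero.2 h1)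
    have hzk : (S.1.1 + 0 - 1) ^ k ≠ 0 := by rw [add_zero]; exact pow_ne_zero _ (sub_ne_zero.2 h1)
    have hrho : AnalyticAt ℂ (fun t => rho α β (γ t)) 0 := by
      have : AnalyticAt ℂ (fun t => (aeval (S.1.1 + t) (trPoly α β) +
          aeval (S.1.1 + t) (q α β) * g t) / (2 * (S.1.1 + t - 1) ^ k)) 0 :=
        ((haz.aeval_polynomial _).add ((haz.aeval_polynomial _).mul hg)).div
          (analyticAt_const.mul ((haz.sub analyticAt_const).pow k)) (mul_ne_zero two_ne_zero hzk)
      refine this.congr ?_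
      filter_upwards [haz.continuousAt.eventually_ne (y := 0) (by simpa using h0),
        haz.continuousAt.eventually_ne (y := 1) (by simpa using h1)] with t ht0 ht1
      exact (rho_eq α β ht0 ht1).symm
    have hrho0 : rho α β (γ 0) ≠ 0 := by
      rw [hγ0, show S.1 = (S.1.1, S.1.2) from rfl, rho_eq α β h0 h1]
      refine div_ne_zero (fun h => ?_)
        (mul_ne_zero two_ne_zero (pow_ne_zero _ (sub_ne_zero.2 h1)))
      have hid := norm_identity hk α β hα hβ hS
      rw [h, zero_mul] at hid
      exact mul_ne_zero (by norm_num : (4 : ℂ) ≠ 0) (pow_ne_zero (2 * k) (sub_ne_zero.2 h1)) hid.symm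
    obtain ⟨c, hC⟩ := exists_isLogBranch hrho hrho0
    have hf : IsBranchOfF α β v γ _ := ⟨a, b, c, hA, hB, hC, rfl⟩
    exact ⟨S, rfl, h0, h1, γ, _, hγ, hf,
      (isBranchOfF_hasDerivAt hk α β hα hβ hn h0 h1 hw hγ hf).2 hv⟩

end

/-! ### The branch of the square root -/

/-- The principal square root. -/
noncomputable def csqrt (u : ℂ) : ℂ := Complex.exp (Complex.log u / 2)

theorem csqrt_ofReal {u : ℝ} (hu : 0 < u) : csqrt u = (Real.sqrt u : ℝ) := by
  rw [csqrt, ← Complex.ofReal_log hu.le, Real.sqrt_eq_rpow, Real.rpow_def_of_pos hu]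
  push_cast
  congr 1
  ring

theorem differentiableAt_csqrt {f : ℂ → ℂ} {z : ℂ} (hf : DifferentiableAt ℂ f z)
    (hz : f z ∈ Complex.slitPlane) : DifferentiableAt ℂ (fun z => csqrt (f z)) z :=
  ((hf.clog hz).div_const 2).cexp

theorem div_mem_slitPlane {a b : ℝ} (hab : b < a) {z : ℂ}
    (hz : z ∉ (fun t : ℝ => (t : ℂ)) '' Set.Icc b a) :
    z - b ≠ 0 ∧ (z - a) / (z - b) ∈ Complex.slitPlane := by
  have hb : z - b ≠ 0 := by
    intro h
    exact hz ⟨b, ⟨le_rfl, hab.le⟩, (sub_eq_zero.1 h).symm⟩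
  refine ⟨hb, ?_⟩
  by_contra hcon
  rw [Complex.mem_slitPlane_iff] at hcon
  push Not at hcon
  set u := (z - a) / (z - b) with hu
  set s := u.re with hs
  have e : u = (s : ℂ) := by apply Complex.ext <;> simp [hcon.2, hs]
  have h1 : z - a = s * (z - b) := by rw [← e, hu]; field_simp
  have hs1 : 0 < 1 - s := by linarith [hcon.1]
  have hs1' : (1 : ℂ) - s ≠ 0 := by exact_mod_cast hs1.ne'
  refine hz ⟨(a - s * b) / (1 - s), ⟨?_, ?_⟩, ?_⟩
  · rw [le_div_iff₀ hs1]; linarith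
  · rw [div_le_iff₀ hs1]; nlinarith [hcon.1]
  · push_cast
    rw [div_eq_iff hs1']
    linear_combination -h1

theorem sub_mem_slitPlane {a : ℝ} {z : ℂ} (hz : z ∉ (fun t : ℝ => (t : ℂ)) '' Set.Iic a) :
    z - a ∈ Complex.slitPlane := by
  by_contra hcon
  rw [Complex.mem_slitPlane_iff] at hcon
  push Not at hcon
  refine hz ⟨z.re, ?_, ?_⟩
  · have := hcon.1; simp at this; simpa using this
  · apply Complex.ext
    · simp
    · have := hcon.2; simp at this; simp [this]

section

variable {k : ℕ} {α β : Fin k → ℝ}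

/-- For each bounded cut [b, a] the root of (z - a)(z - b) is taken as (z - b) √((z - a)/(z - b))
with the principal root: off the cut the quotient avoids (-∞, 0]. The last zero contributes √(z -
x_{2m}), cut along the remaining half-line. -/
theorem exists_isSqrtContinuation (h : IsSpectralPoly (kPrime α β - 1) (p0 α β) (x α β)) :
    ∃ g, IsSqrtContinuation α β g := by
  set m := kPrime α β - 1 with hm
  obtain ⟨c, hc, hP⟩ := h.exists_eq
  refine ⟨fun z => (Real.sqrt c : ℂ) * ((∏ l ∈ Finset.range m, ((z - x α β (2 * l + 1)) *
    csqrt ((z - x α β (2 * l)) / (z - x α β (2 * l + 1))))) * csqrt (z - x α β (2 * m))),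
    fun z hz => DifferentiableAt.differentiableWithinAt ?_, fun t ht => ?_⟩
  · have hz1 : z ∉ (fun t : ℝ => (t : ℂ)) '' Set.Iic (x α β (2 * m)) :=
      fun h => hz (Set.image_mono Set.subset_union_left h)
    have hz2 : ∀ l ∈ Finset.range m,
        z ∉ (fun t : ℝ => (t : ℂ)) '' Set.Icc (x α β (2 * l + 1)) (x α β (2 * l)) :=
      fun l hl h => hz (Set.image_mono
        ((Set.subset_biUnion_of_mem (u := fun l => Set.Icc (x α β (2 * l + 1)) (x α β (2 * l)))
          hl).trans Set.subset_union_right) h)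
    refine (differentiableAt_const _).mul (DifferentiableAt.mul ?_ ?_)
    · refine DifferentiableAt.fun_finsetProd fun l hl => ?_
      have hlt := h.x_lt (2 * l) (2 * l + 1) (by omega)
        (by have := Finset.mem_range.1 hl; omega)
      obtain ⟨hb, hs⟩ := div_mem_slitPlane hlt (hz2 l hl)
      have hd : ∀ a : ℝ, DifferentiableAt ℂ (fun z : ℂ => z - a) z :=
        fun a => differentiableAt_id.sub_const _
      exact (hd _).mul (differentiableAt_csqrt ((hd _).div (hd _) hb) hs)
    · exact differentiableAt_csqrt (differentiableAt_id.sub_const _) (sub_mem_slitPlane hz1)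
  · have hpos : ∀ j, j < 2 * m + 1 → 0 < t - x α β j := by
      intro j hj
      have := h.x_nonpos hj
      linarith
    have e : ∏ l ∈ Finset.range m, (((t : ℂ) - x α β (2 * l + 1)) *
        csqrt ((t - x α β (2 * l)) / (t - x α β (2 * l + 1)))) =
        ((∏ l ∈ Finset.range m, Real.sqrt ((t - x α β (2 * l)) * (t - x α β (2 * l + 1))) : ℝ) :
          ℂ) := by
      rw [Complex.ofReal_prod]
      refine Finset.prod_congr rfl fun l hl => ?_
      have hl := Finset.mem_range.1 hl
      have h1 := hpos (2 * l) (by omega)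
      have h2 := hpos (2 * l + 1) (by omega)
      rw [← Complex.ofReal_sub, ← Complex.ofReal_sub, ← Complex.ofReal_div,
        csqrt_ofReal (div_pos h1 h2), ← Complex.ofReal_mul]
      congr 1
      rw [Real.sqrt_mul h1.le, Real.sqrt_div h1.le]
      have h3 := Real.sqrt_pos.2 h2
      field_simp
      rw [Real.sq_sqrt h2.le]
    have e2 : (p0 α β).eval t = c * ((∏ l ∈ Finset.range m,
        ((t - x α β (2 * l)) * (t - x α β (2 * l + 1)))) * (t - x α β (2 * m))) := by
      rw [hP, eval_mul, eval_prod, prod_range_two_mul_add_one']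
      simp
    have h3 : ∀ l ∈ Finset.range m, 0 ≤ (t - x α β (2 * l)) * (t - x α β (2 * l + 1)) := by
      intro l hl
      have hl := Finset.mem_range.1 hl
      exact (mul_pos (hpos (2 * l) (by omega)) (hpos (2 * l + 1) (by omega))).le
    have e3 : ∏ l ∈ Finset.range m, Real.sqrt ((t - x α β (2 * l)) * (t - x α β (2 * l + 1))) =
        Real.sqrt (∏ l ∈ Finset.range m, ((t - x α β (2 * l)) * (t - x α β (2 * l + 1)))) := by
      rw [← sq_eq_sq₀ (Finset.prod_nonneg fun _ _ => Real.sqrt_nonneg _) (Real.sqrt_nonneg _),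
        ← Finset.prod_pow, Real.sq_sqrt (Finset.prod_nonneg h3)]
      exact Finset.prod_congr rfl fun l hl => Real.sq_sqrt (h3 l hl)
    simp only
    rw [e, ← Complex.ofReal_sub, csqrt_ofReal (hpos (2 * m) (by omega)), e2, e3,
      Real.sqrt_mul hc.le, Real.sqrt_mul (Finset.prod_nonneg h3)]
    push_cast
    rfl

/-- Two holomorphic functions on the slit plane agreeing on the positive axis are equal. -/
theorem eqOn_slitPlane {f g : ℂ → ℂ} (hf : DifferentiableOn ℂ f Complex.slitPlane)
    (hg : DifferentiableOn ℂ g Complex.slitPlane) (hfg : ∀ t : ℝ, 0 < t → f t = g t) :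
    Set.EqOn f g Complex.slitPlane := by
  refine (hf.analyticOnNhd Complex.isOpen_slitPlane).eqOn_of_preconnected_of_frequently_eq
    (hg.analyticOnNhd Complex.isOpen_slitPlane) ?_ Complex.one_mem_slitPlane ?_
  · exact (Complex.starConvex_one_slitPlane.isPathConnected Complex.one_mem_slitPlane
      ).isConnected.isPreconnected
  · have ht : Filter.Tendsto (fun t : ℝ => (t : ℂ)) (𝓝[≠] 1) (𝓝[≠] 1) := by
      refine tendsto_nhdsWithin_iff.2 ⟨?_, ?_⟩
      · exact (Complex.continuous_ofReal.tendsto' 1 1 (by simp)).mono_left nhdsWithin_le_nhds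
      · filter_upwards [self_mem_nhdsWithin] with t ht
        simpa using ht
    refine ht.frequently (Filter.Eventually.frequently ?_)
    have : ∀ᶠ t : ℝ in 𝓝 1, 0 < t := lt_mem_nhds one_pos
    exact (this.filter_mono nhdsWithin_le_nhds).mono fun t ht => hfg t ht

/-- Only the part of the domain off (-∞, 0] matters, because the half sheets lie over non-real z.
Both identities hold on the positive axis and extend by the identity theorem, whichever continuation
the choice operator returns. -/
theorem sqrtP0_props (h : IsSpectralPoly (kPrime α β - 1) (p0 α β) (x α β)) :
    DifferentiableOn ℂ (sqrtP0 α β) Complex.slitPlane ∧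
    (∀ z ∈ Complex.slitPlane, sqrtP0 α β z ^ 2 = aeval z (p0 α β)) ∧
    (∀ z ∈ Complex.slitPlane,
      sqrtP0 α β ((starRingEnd ℂ) z) = (starRingEnd ℂ) (sqrtP0 α β z)) := by
  obtain ⟨hd, ht⟩ : IsSqrtContinuation α β (sqrtP0 α β) :=
    Classical.epsilon_spec (exists_isSqrtContinuation h)
  have hsub : Complex.slitPlane ⊆ ((fun t : ℝ => (t : ℂ)) '' cuts α β)ᶜ := by
    rintro _ hz ⟨t, htc, rfl⟩
    have hpos : 0 < t := by simpa using hz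
    rcases htc with htc | htc
    · have := h.x_nonpos (j := 2 * (kPrime α β - 1)) (by omega)
      have htc : t ≤ x α β (2 * (kPrime α β - 1)) := htc
      linarith
    · simp only [Set.mem_iUnion] at htc
      obtain ⟨l, hl, -, htc⟩ := htc
      have hl := Finset.mem_range.1 hl
      have := h.x_nonpos (j := 2 * l) (by omega)
      linarith
  have hd' := hd.mono hsub
  refine ⟨hd', ?_, ?_⟩
  · refine eqOn_slitPlane (hd'.pow 2) ((p0 α β).differentiable_aeval.differentiableOn) ?_
    intro t ht0
    rw [ht t ht0, aeval_ofReal', ← Complex.ofReal_pow, Real.sq_sqrt (h.eval_nonneg ht0.le)]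
  · have hc : Set.EqOn (fun z => (starRingEnd ℂ) (sqrtP0 α β ((starRingEnd ℂ) z)))
        (sqrtP0 α β) Complex.slitPlane := by
      refine eqOn_slitPlane (fun z hz => DifferentiableAt.differentiableWithinAt ?_) hd' ?_
      · have hz' : (starRingEnd ℂ) z ∈ Complex.slitPlane := by
          rw [Complex.mem_slitPlane_iff] at hz ⊢; simpa using hz
        have := (hd'.differentiableAt (Complex.isOpen_slitPlane.mem_nhds hz')).conj_conj
        rwa [Complex.conj_conj] at this
      · intro t ht0
        simp [ht t ht0]
    intro z hz
    have := congrArg (starRingEnd ℂ) (hc hz)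
    simpa using this

end

/-! ### The region `ℛ₁₂` -/

section

variable {k : ℕ} {α β : Fin k → ℝ}

theorem Curve.sq_eq (S : Curve α β) : S.1.2 ^ 2 = aeval S.1.1 (p0 α β) := sub_eq_zero.1 S.2

/-- Complex conjugation on the curve. -/
def curveConj (S : Curve α β) : Curve α β :=
  ⟨((starRingEnd ℂ) S.1.1, (starRingEnd ℂ) S.1.2), by
    rw [sub_eq_zero, aeval_conj_real, ← Curve.sq_eq S, map_pow]⟩

theorem continuous_curveConj : Continuous (curveConj : Curve α β → Curve α β) := by
  refine Continuous.subtype_mk ?_ _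
  exact (Complex.continuous_conj.comp (continuous_fst.comp continuous_subtype_val)).prodMk
    (Complex.continuous_conj.comp (continuous_snd.comp continuous_subtype_val))

theorem logDer_curveConj (n : ℝ[X]) (S : Curve α β) :
    logDer n (curveConj S).1 = (starRingEnd ℂ) (logDer n S.1) := logDer_conj n S.1.1 S.1.2

variable {κ : ℝ} {n : ℝ[X]} (h : IsHarnackPair (kPrime α β - 1) κ (p0 α β) n (x α β))

theorem real_of_not_offReal {S : Curve α β} (hS : ¬ OffReal (p0 α β) S.1.1) :
    S.1.1.im = 0 ∧ S.1.2.im = 0 := by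
  rw [OffReal] at hS
  push Not at hS
  obtain ⟨hi, hP⟩ := hS
  refine ⟨hi, ?_⟩
  have e : S.1.1 = (S.1.1.re : ℂ) := by apply Complex.ext <;> simp [hi]
  have h2 := Curve.sq_eq S
  rw [e, aeval_ofReal'] at h2
  have hr := congrArg Complex.re h2
  have hm := congrArg Complex.im h2
  simp [sq] at hr hm
  by_contra h0
  have : S.1.2.re = 0 := by
    rcases mul_eq_zero.1 (show S.1.2.re * S.1.2.im = 0 by linarith) with h1 | h1
    · exact h1
    · exact absurd h1 h0
  rw [this] at hr
  have := mul_self_pos.2 h0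
  linarith

theorem curveConj_of_not_offReal {S : Curve α β} (hS : ¬ OffReal (p0 α β) S.1.1) :
    curveConj S = S := by
  obtain ⟨h1, h2⟩ := real_of_not_offReal hS
  apply Subtype.ext
  exact Prod.ext (Complex.conj_eq_iff_im.2 h1) (Complex.conj_eq_iff_im.2 h2)

-- Points that are not `OffReal` are fixed by conjugation, hence have real `logDer`. The sign of Im
-- `logDer` thus splits the complement of the real locus into two parts.
include h in
theorem logDer_im_ne_zero_iff {S : Curve α β} :
    (logDer n S.1).im ≠ 0 ↔ OffReal (p0 α β) S.1.1 := by
  refine ⟨fun hY => ?_, fun hz => h.logDer_im_ne_zero (Curve.sq_eq S) hz⟩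
  by_contra hS
  have := logDer_curveConj n S
  rw [curveConj_of_not_offReal hS] at this
  exact hY (Complex.conj_eq_iff_im.1 this.symm)

theorem exists_nonreal_mem (S : Curve α β) {O : Set (Curve α β)} (hO : O ∈ 𝓝 S) :
    ∃ S' ∈ O, S'.1.1.im ≠ 0 := by
  by_cases hi : S.1.1.im = 0
  swap
  · exact ⟨S, mem_of_mem_nhds hO, hi⟩
  have hpath : ∃ w : ℝ → ℂ, ContinuousAt w 0 ∧ w 0 = S.1.2 ∧
      ∀ᶠ s in 𝓝 (0 : ℝ), w s ^ 2 - aeval (S.1.1 + s * Complex.I) (p0 α β) = 0 := by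
    have ht : Filter.Tendsto (fun s : ℝ => (s : ℂ) * Complex.I) (𝓝 0) (𝓝 0) :=
      Continuous.tendsto' (by fun_prop) _ _ (by simp)
    by_cases hw : S.1.2 = 0
    -- At a branch point any choice of roots along the vertical line is continuous at s = 0, since
    -- |w|² = |p₀| tends to 0; no coherent branch is needed.
    · choose w hw' using fun s : ℝ => IsAlgClosed.exists_pow_nat_eq
        (aeval (S.1.1 + s * Complex.I) (p0 α β)) (n := 2) (by norm_num)
      have h0 : w 0 = 0 := by
        have h1 := hw' 0
        simp only [Complex.ofReal_zero, zero_mul, add_zero] at h1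
        rw [← Curve.sq_eq S, hw] at h1
        simpa using h1
      refine ⟨w, ?_, by rw [h0, hw], Filter.Eventually.of_forall fun s => sub_eq_zero.2 (hw' s)⟩
      rw [ContinuousAt, h0, tendsto_zero_iff_norm_tendsto_zero]
      have hn : ∀ s, ‖w s‖ = Real.sqrt ‖aeval (S.1.1 + s * Complex.I) (p0 α β)‖ := by
        intro s
        rw [← hw' s, norm_pow, Real.sqrt_sq (norm_nonneg _)]
      simp only [hn]
      have hc : Continuous fun s : ℝ => Real.sqrt ‖aeval (S.1.1 + s * Complex.I) (p0 α β)‖ :=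
        (((p0 α β).continuous_aeval).comp
          (by fun_prop : Continuous fun s : ℝ => S.1.1 + s * Complex.I)).norm.sqrt
      refine hc.tendsto' 0 0 ?_
      simp [← Curve.sq_eq S, hw]
    · obtain ⟨g, hg, hg0, hgS⟩ := exists_local_graph (Curve.sq_eq S) hw
      refine ⟨fun s => g (s * Complex.I), ?_, by simp [hg0], ?_⟩
      · refine ContinuousAt.comp (g := g) (f := fun s : ℝ => (s : ℂ) * Complex.I) ?_
          (by fun_prop)
        simpa using hg.continuousAt
      · exact (ht.eventually hgS).mono fun s hs => sub_eq_zero.2 hs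
  obtain ⟨w, hwc, hw0, hw⟩ := hpath
  rw [nhds_subtype_eq_comap, Filter.mem_comap] at hO
  obtain ⟨U, hU, hUO⟩ := hO
  have htend : Filter.Tendsto (fun s : ℝ => (S.1.1 + s * Complex.I, w s)) (𝓝 0) (𝓝 S.1) := by
    rw [show S.1 = (S.1.1, S.1.2) from rfl, ← hw0]
    refine Filter.Tendsto.prodMk_nhds ?_ hwc
    exact Continuous.tendsto' (by fun_prop) _ _ (by simp)
  have hev : ∀ᶠ s : ℝ in 𝓝[≠] (0 : ℝ), (S.1.1 + s * Complex.I, w s) ∈ U ∧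
      w s ^ 2 - aeval (S.1.1 + s * Complex.I) (p0 α β) = 0 ∧ s ≠ 0 := by
    refine ((htend.eventually hU).filter_mono nhdsWithin_le_nhds).and
      ((hw.filter_mono nhdsWithin_le_nhds).and ?_)
    filter_upwards [self_mem_nhdsWithin] with s hs using hs
  obtain ⟨s, h1, h2, h3⟩ := hev.exists
  exact ⟨⟨(S.1.1 + s * Complex.I, w s), h2⟩, hUO h1, by simp [hi, h3]⟩

/-- Large imaginary z escape the compact set together with their conjugates. So each neighbourhood
of ∞ contains a conjugate pair of non-real points. -/
theorem exists_nonreal_near_infty {K : Set (Curve α β)} (hK : IsCompact K) :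
    ∃ S : Curve α β, S.1.1.im ≠ 0 ∧ S ∉ K ∧ curveConj S ∉ K := by
  have hK' : IsCompact ((fun S : Curve α β => ‖S.1.1‖) '' K) :=
    hK.image (continuous_fst.comp continuous_subtype_val).norm
  obtain ⟨M, hM⟩ := hK'.bddAbove
  set s : ℝ := |M| + 1 with hs
  have hs0 : 0 < s := by positivity
  have hMs : M < s := lt_of_le_of_lt (le_abs_self M) (by linarith)
  obtain ⟨w, hw⟩ := IsAlgClosed.exists_pow_nat_eq (aeval (s * Complex.I) (p0 α β)) (n := 2)
    (by norm_num)
  refine ⟨⟨(s * Complex.I, w), sub_eq_zero.2 hw⟩, by simp [hs0.ne'], fun hmem => ?_, fun hmem => ?_⟩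
  · have := hM (Set.mem_image_of_mem _ hmem)
    simp [abs_of_pos hs0] at this
    linarith
  · have := hM (Set.mem_image_of_mem _ hmem)
    simp [curveConj, abs_of_pos hs0] at this
    linarith

-- At poles the formula for `logDer` has an arbitrary value and continuity may fail. The strict
-- inequality forces `OffReal`, hence a nonzero denominator.
include h in
theorem isOpen_logDer_im (ε : ℝ) : IsOpen {S : Curve α β | 0 < ε * (logDer n S.1).im} := by
  rw [isOpen_iff_mem_nhds]
  intro S hS
  have hY : (logDer n S.1).im ≠ 0 := by
    intro h0
    simp [h0] at hS
  have hoff := (logDer_im_ne_zero_iff h).1 hY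
  have hz := (h.offReal_ne hoff).2.1
  have hw := h.offReal_snd_ne (Curve.sq_eq S) hoff
  have hc : ContinuousAt (fun S : Curve α β => ε * (logDer n S.1).im) S := by
    have c1 : Continuous fun S : Curve α β => S.1.1 := continuous_fst.comp continuous_subtype_val
    have c2 : Continuous fun S : Curve α β => S.1.2 := continuous_snd.comp continuous_subtype_val
    have : ContinuousAt (fun S : Curve α β => logDer n S.1) S := by
      refine ContinuousAt.div (c1.mul (n.continuous_aeval.comp c1)).continuousAt
        ((c1.sub continuous_const).mul c2).continuousAt ?_
      exact mul_ne_zero (sub_ne_zero.2 hz) hw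
    exact continuousAt_const.mul (Complex.continuous_im.continuousAt.comp this)
  exact hc.eventually (lt_mem_nhds hS)

/-- The union of the upper half plane of the first sheet and the lower half plane of the second
sheet. -/
def halfSheets (α β : Fin k → ℝ) : Set (Curve α β) :=
  {S | (0 < S.1.1.im ∧ S.1.2 = sqrtP0 α β S.1.1) ∨ (S.1.1.im < 0 ∧ S.1.2 = -sqrtP0 α β S.1.1)}

theorem R12_eq : R12 α β = interior (closure ((↑) '' halfSheets α β)) := by
  rw [R12]
  congr 2
  ext P
  constructor
  · rintro ⟨S, rfl, hS⟩; exact ⟨S, hS, rfl⟩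
  · rintro ⟨S, hS, rfl⟩; exact ⟨S, rfl, hS⟩

-- Over the connected upper half plane Im `logDer` never vanishes on the first sheet, so it keeps
-- one sign ε. Conjugation, followed by the change of sheet, gives the same sign over the lower half
-- plane on the second sheet.
include h in
theorem exists_sign : ∃ ε : ℝ, ε ≠ 0 ∧ ∀ S : Curve α β, S.1.1.im ≠ 0 →
    (S ∈ halfSheets α β ↔ 0 < ε * (logDer n S.1).im) := by
  obtain ⟨hd, hsq, hconj⟩ := sqrtP0_props h.toIsSpectralPoly
  set g := sqrtP0 α β
  have hslit : ∀ z : ℂ, z.im ≠ 0 → z ∈ Complex.slitPlane := fun z hz => Or.inr hz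
  have hne : ∀ z : ℂ, z.im ≠ 0 → (logDer n (z, g z)).im ≠ 0 := fun z hz =>
    h.logDer_im_ne_zero (hsq z (hslit z hz)) (Or.inl hz)
  have hpre : IsPreconnected {z : ℂ | 0 < z.im} := (convex_halfSpace_im_gt 0).isPreconnected
  have hcont : ContinuousOn (fun z => (logDer n (z, g z)).im) {z : ℂ | 0 < z.im} := by
    refine Complex.continuous_im.comp_continuousOn (ContinuousOn.div ?_ ?_ ?_)
    · exact (continuous_id.mul n.continuous_aeval).continuousOn
    · exact (continuous_id.sub continuous_const).continuousOn.mul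
        (hd.continuousOn.mono fun z hz => hslit z (ne_of_gt hz))
    · intro z hz
      refine mul_ne_zero (sub_ne_zero.2 ?_) ?_
      · rintro rfl; simp at hz
      · exact h.offReal_snd_ne (S := (z, g z)) (hsq z (hslit z (ne_of_gt hz)))
          (Or.inl (ne_of_gt hz))
  set ε := (logDer n (Complex.I, g Complex.I)).im
  have hε : ε ≠ 0 := hne _ (by simp)
  have hup : ∀ z : ℂ, 0 < z.im → 0 < ε * (logDer n (z, g z)).im := by
    intro z hz
    by_contra hcon
    have hI : Complex.I ∈ {z : ℂ | 0 < z.im} := by simp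
    have hεε : 0 < ε * ε := mul_self_pos.2 hε
    obtain ⟨u, hu, hu0⟩ := hpre.intermediate_value₂ (f := fun z => ε * (logDer n (z, g z)).im)
      (g := fun _ => (0 : ℝ)) hz hI (continuousOn_const.mul hcont) continuousOn_const
      (not_lt.1 hcon) hεε.le
    exact mul_ne_zero hε (hne u (ne_of_gt hu)) hu0
  have hdown : ∀ z : ℂ, z.im < 0 → 0 < ε * (logDer n (z, -g z)).im := by
    intro z hz
    have h1 := hup ((starRingEnd ℂ) z) (by simpa using hz)
    rw [hconj z (hslit z hz.ne), logDer_conj] at h1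
    rw [logDer_neg]
    simpa using h1
  refine ⟨ε, hε, fun S hS => ⟨?_, fun hpos => ?_⟩⟩
  · rintro (⟨h1, h2⟩ | ⟨h1, h2⟩)
    · rw [show S.1 = (S.1.1, g S.1.1) from Prod.ext rfl h2]; exact hup _ h1
    · rw [show S.1 = (S.1.1, -g S.1.1) from Prod.ext rfl h2]; exact hdown _ h1
  · have h3 : (S.1.2 - g S.1.1) * (S.1.2 + g S.1.1) = 0 := by
      linear_combination Curve.sq_eq S - hsq _ (hslit _ hS)
    rcases lt_or_gt_of_ne hS with hlt | hgt
    · right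
      refine ⟨hlt, ?_⟩
      rcases mul_eq_zero.1 h3 with h4 | h4
      · exfalso
        have h5 := hdown _ hlt
        rw [← sub_eq_zero.1 h4, logDer_neg] at h5
        simp at h5
        linarith
      · linear_combination h4
    · left
      refine ⟨hgt, ?_⟩
      rcases mul_eq_zero.1 h3 with h4 | h4
      · linear_combination h4
      · exfalso
        have h5 := hup _ hgt
        rw [show g S.1.1 = -S.1.2 by linear_combination h4, logDer_neg] at h5
        simp at h5
        linarith

include h in
/-- The region `ℛ₁₂` is one of the two components of the complement of the real locus. -/
theorem exists_R12_eq : ∃ ε : ℝ, ε ≠ 0 ∧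
    R12 α β = (↑) '' {S : Curve α β | 0 < ε * (logDer n S.1).im} := by
  obtain ⟨ε, hε, hsign⟩ := exists_sign h
  refine ⟨ε, hε, ?_⟩
  have hopen := isOpen_logDer_im h ε
  have hopen' := isOpen_logDer_im h (-ε)
  have hoe : Topology.IsOpenEmbedding ((↑) : Curve α β → Surface α β) := OnePoint.isOpenEmbedding_coe
  have hneg : ∀ (S : Curve α β), (S : Surface α β) ∈ closure ((↑) '' halfSheets α β) →
      ¬ 0 < -ε * (logDer n S.1).im := by
    intro S hS hpos
    obtain ⟨_, ⟨S', hS', rfl⟩, ⟨S'', hS'', he⟩⟩ :=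
      mem_closure_iff.1 hS _ (hoe.isOpenMap _ hopen') ⟨S, hpos, rfl⟩
    have := OnePoint.coe_injective he
    subst this
    have hi : S''.1.1.im ≠ 0 := by
      rcases hS'' with h1 | h1
      · exact h1.1.ne'
      · exact h1.1.ne
    have := (hsign _ hi).1 hS''
    have hS' : 0 < -ε * (logDer n S''.1).im := hS'
    linarith
  -- The closure contains no conjugate pair of non-real points. Every neighbourhood of ∞ or of a
  -- conjugation-fixed point contains such a pair, so these points drop out of the interior.
  have hpair : ∀ (S : Curve α β), S.1.1.im ≠ 0 →
      (S : Surface α β) ∈ closure ((↑) '' halfSheets α β) →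
      (curveConj S : Surface α β) ∉ closure ((↑) '' halfSheets α β) := by
    intro S hi hS hS'
    have h1 := hneg _ hS
    have h2 := hneg _ hS'
    rw [logDer_curveConj] at h2
    simp at h2 h1
    have := mul_ne_zero hε ((logDer_im_ne_zero_iff h).2 (Or.inl hi))
    exact this (le_antisymm h2 h1)
  rw [R12_eq]
  apply Set.Subset.antisymm
  · intro P hP
    have hO : IsOpen (interior (closure ((↑) '' halfSheets α β : Set (Surface α β)))) :=
      isOpen_interior
    have hsub : interior (closure ((↑) '' halfSheets α β : Set (Surface α β))) ⊆ _ :=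
      interior_subset
    generalize interior (closure ((↑) '' halfSheets α β : Set (Surface α β))) = O at *
    induction P using OnePoint.rec with
    | infty =>
      exfalso
      obtain ⟨-, hK⟩ := (OnePoint.isOpen_iff_of_mem hP).1 hO
      obtain ⟨S, hi, h1, h2⟩ := exists_nonreal_near_infty hK
      simp only [Set.mem_compl_iff, Set.mem_preimage, not_not] at h1 h2
      exact hpair S hi (hsub h1) (hsub h2)
    | coe S =>
      refine ⟨S, ?_, rfl⟩
      by_contra hcon
      have h1 := hneg S (hsub hP)
      have hcon : ¬ 0 < ε * (logDer n S.1).im := hcon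
      have h0 : (logDer n S.1).im = 0 := by
        have : ε * (logDer n S.1).im = 0 := by linarith
        exact (mul_eq_zero.1 this).resolve_left hε
      have hoff : ¬ OffReal (p0 α β) S.1.1 := fun hoff => (logDer_im_ne_zero_iff h).2 hoff h0
      have hO' : IsOpen ((↑) ⁻¹' O : Set (Curve α β)) := hO.preimage OnePoint.continuous_coe
      have hn1 : ((↑) ⁻¹' O : Set (Curve α β)) ∈ 𝓝 S := hO'.mem_nhds hP
      have hn2 : curveConj ⁻¹' ((↑) ⁻¹' O : Set (Curve α β)) ∈ 𝓝 S := by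
        refine (hO'.preimage continuous_curveConj).mem_nhds ?_
        rw [Set.mem_preimage, curveConj_of_not_offReal hoff]
        exact hP
      obtain ⟨S', ⟨h2, h3⟩, hi⟩ := exists_nonreal_mem S (Filter.inter_mem hn1 hn2)
      exact hpair S' hi (hsub h2) (hsub h3)
  · refine interior_maximal ?_ (hoe.isOpenMap _ hopen)
    rintro _ ⟨S, hS, rfl⟩
    refine mem_closure_iff.2 fun O hO hSO => ?_
    have hO' : IsOpen ((↑) ⁻¹' O : Set (Curve α β)) := hO.preimage OnePoint.continuous_coe
    obtain ⟨S', ⟨h1, h2⟩, hi⟩ := exists_nonreal_mem S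
      (Filter.inter_mem (hO'.mem_nhds hSO) (hopen.mem_nhds hS))
    exact ⟨S', h1, S', (hsign S' hi).2 h2, rfl⟩

-- The loops lie over [0, ∞) and the closed gaps, and these are exactly the real t with p₀(t) ≥ 0.
include h in
theorem mem_realLocus_iff (hk : 0 < kPrime α β) (S : Curve α β) :
    (S : Surface α β) ∈ realLocus α β ↔ ¬ OffReal (p0 α β) S.1.1 := by
  have hmem : (S : Surface α β) ∈ realLocus α β ↔
      ∃ t : ℝ, S.1.1 = t ∧ (0 ≤ t ∨ InGap (kPrime α β - 1) (x α β) t) := by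
    simp only [realLocus, Set.mem_iUnion]
    constructor
    · rintro ⟨l, hl, hS⟩
      have hl := Finset.mem_range.1 hl
      rcases l with _ | l
      · rcases hS with hS | ⟨S', hS', t, ht, e⟩
        · exact absurd hS (OnePoint.coe_ne_infty S)
        · have := OnePoint.coe_injective hS'
          subst this
          exact ⟨t, e, Or.inl ht⟩
      · obtain ⟨S', hS', t, ht, e⟩ := hS
        have := OnePoint.coe_injective hS'
        subst this
        exact ⟨t, e, Or.inr ⟨l, by omega, ht.1, ht.2⟩⟩
    · rintro ⟨t, e, ht | ⟨l, hl, h1, h2⟩⟩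
      · exact ⟨0, Finset.mem_range.2 hk, Or.inr ⟨S, rfl, t, ht, e⟩⟩
      · exact ⟨l + 1, Finset.mem_range.2 (by omega), S, rfl, t, ⟨h1, h2⟩, e⟩
  rw [hmem, OffReal]
  push Not
  constructor
  · rintro ⟨t, e, ht⟩
    rw [e, Complex.ofReal_im, Complex.ofReal_re]
    exact ⟨rfl, h.eval_nonneg_iff.2 ht⟩
  · rintro ⟨hi, hP⟩
    exact ⟨S.1.1.re, Complex.ext rfl (by simpa using hi), h.eval_nonneg_iff.1 hP⟩

end

/-! ### Smooth dependence of the critical point on the parameters -/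

/-- The system `w² = P(z)`, `CritEq`, with complex parameters. -/
noncomputable def critSystem (κ : ℝ) (P n : ℝ[X]) (u : (ℂ × ℂ) × (ℂ × ℂ)) : ℂ × ℂ :=
  (u.2.2 ^ 2 - aeval u.2.1 P,
    κ * ((u.1.2 - 1) * u.2.1 - (u.1.2 + 1)) * u.2.2 - 2 * u.1.1 * u.2.1 * aeval u.2.1 n)

theorem contDiff_critSystem (κ : ℝ) (P n : ℝ[X]) : ContDiff ℂ ∞ (critSystem κ P n) := by
  have h1 : ∀ p : ℝ[X], ContDiff ℂ ∞ fun u : (ℂ × ℂ) × (ℂ × ℂ) => aeval u.2.1 p := fun p =>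
    (p.contDiff_aeval ∞).comp (contDiff_fst.comp contDiff_snd)
  have h2 := h1 P
  have h3 := h1 n
  unfold critSystem
  fun_prop

theorem fderiv_critSystem_apply (κ : ℝ) (P n : ℝ[X]) (u : (ℂ × ℂ) × (ℂ × ℂ)) (a b : ℂ) :
    fderiv ℂ (critSystem κ P n) u (0, (a, b)) =
      (2 * u.2.2 * b - aeval u.2.1 (derivative P) * a,
        κ * ((u.1.2 - 1) * a) * u.2.2 + κ * ((u.1.2 - 1) * u.2.1 - (u.1.2 + 1)) * b -
          2 * u.1.1 * (a * aeval u.2.1 n + u.2.1 * (aeval u.2.1 (derivative n) * a))) := by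
  have hline : HasDerivAt (fun t : ℂ => ((u.1, (u.2.1 + t * a, u.2.2 + t * b)) :
      (ℂ × ℂ) × (ℂ × ℂ))) (0, (a, b)) 0 := by
    refine (hasDerivAt_const _ _).prodMk (HasDerivAt.prodMk ?_ ?_)
    · simpa using ((hasDerivAt_id (0 : ℂ)).mul_const a).const_add u.2.1
    · simpa using ((hasDerivAt_id (0 : ℂ)).mul_const b).const_add u.2.2
  have hF : HasFDerivAt (critSystem κ P n) (fderiv ℂ (critSystem κ P n) u)
      (u.1, (u.2.1 + 0 * a, u.2.2 + 0 * b)) := by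
    simp only [zero_mul, add_zero, Prod.mk.eta]
    exact ((contDiff_critSystem κ P n).differentiable (by simp) u).hasFDerivAt
  have h1 := hF.comp_hasDerivAt (0 : ℂ) hline
  refine h1.unique ?_
  have hz : HasDerivAt (fun t : ℂ => u.2.1 + t * a) a 0 := by
    simpa using ((hasDerivAt_id (0 : ℂ)).mul_const a).const_add u.2.1
  have hw : HasDerivAt (fun t : ℂ => u.2.2 + t * b) b 0 := by
    simpa using ((hasDerivAt_id (0 : ℂ)).mul_const b).const_add u.2.2
  have hpol : ∀ p : ℝ[X], HasDerivAt (fun t : ℂ => aeval (u.2.1 + t * a) p)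
      (aeval u.2.1 (derivative p) * a) 0 := by
    intro p
    have := (p.hasDerivAt_aeval (u.2.1 + 0 * a)).comp (0 : ℂ) hz
    simp only [zero_mul, add_zero] at this
    exact this
  refine HasDerivAt.prodMk ?_ ?_
  · refine ((hw.pow 2).sub (hpol P)).congr_deriv ?_
    simp
  · refine (((((hz.const_mul (u.1.2 - 1)).sub_const (u.1.2 + 1)).const_mul (κ : ℂ)).mul hw).sub
      ((hz.const_mul (2 * u.1.1)).mul (hpol n))).congr_deriv ?_
    simp
    ring

theorem critSystem_isInvertible {κ : ℝ} {P n : ℝ[X]} {u : (ℂ × ℂ) × (ℂ × ℂ)} (hw : u.2.2 ≠ 0)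
    (hJ : aeval u.2.1 (derivative P) * (κ * ((u.1.2 - 1) * u.2.1 - (u.1.2 + 1))) +
      2 * u.2.2 * (κ * (u.1.2 - 1) * u.2.2 - 2 * u.1.1 * (aeval u.2.1 n +
        u.2.1 * aeval u.2.1 (derivative n))) ≠ 0) :
    (fderiv ℂ (critSystem κ P n) u ∘L .inr ℂ (ℂ × ℂ) (ℂ × ℂ)).IsInvertible := by
  set A := fderiv ℂ (critSystem κ P n) u ∘L .inr ℂ (ℂ × ℂ) (ℂ × ℂ) with hA
  have hinj : Function.Injective (A : (ℂ × ℂ) →ₗ[ℂ] (ℂ × ℂ)) := by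
    refine (injective_iff_map_eq_zero _).2 ?_
    rintro ⟨a, b⟩ hab
    have hab' : fderiv ℂ (critSystem κ P n) u (0, (a, b)) = 0 := hab
    rw [fderiv_critSystem_apply] at hab'
    have e1 := congrArg Prod.fst hab'
    have e2 := congrArg Prod.snd hab'
    simp only [Prod.fst_zero, Prod.snd_zero] at e1 e2
    have ha : a = 0 := by
      -- Eliminating b from the two linear equations leaves the Jacobian times a; then b = 0 follows
      -- from w ≠ 0.
      apply (mul_eq_zero.1 (show _ * a = 0 from ?_)).resolve_left hJ
      linear_combination 2 * u.2.2 * e2 - κ * ((u.1.2 - 1) * u.2.1 - (u.1.2 + 1)) * e1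
    subst ha
    have hb : b = 0 := by simpa [hw] using e1
    subst hb
    rfl
  refine ⟨(LinearEquiv.ofInjectiveEndo _ hinj).toContinuousLinearEquiv, ?_⟩
  ext <;> rfl

namespace IsHarnackPair

variable {m : ℕ} {κ : ℝ} {P n : ℝ[X]} {x : ℕ → ℝ} (h : IsHarnackPair m κ P n x)
include h

theorem exists_smooth_solution {S : ℂ × ℂ} (hS : S.2 ^ 2 = aeval S.1 P) (hz : OffReal P S.1)
    {v : ℝ × ℝ} (hv : CritEq κ n v S) :
    ∃ ψ : ℝ × ℝ → ℂ × ℂ, ContDiffAt ℝ ∞ ψ v ∧ ψ v = S ∧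
      ∀ᶠ v' in 𝓝 v, (ψ v').2 ^ 2 = aeval (ψ v').1 P ∧ CritEq κ n v' (ψ v') := by
  -- The parameters are complexified so that the implicit function theorem applies over ℂ; the
  -- solution is then restricted to real parameters.
  set ι : ℝ × ℝ → ℂ × ℂ := fun v => ((v.1 : ℂ), (v.2 : ℂ)) with hι
  have hιs : ContDiff ℝ ∞ ι :=
    (Complex.ofRealCLM.contDiff.comp contDiff_fst).prodMk
      (Complex.ofRealCLM.contDiff.comp contDiff_snd)
  set u : (ℂ × ℂ) × (ℂ × ℂ) := (ι v, S)
  have cdf : ContDiffAt ℂ ∞ (critSystem κ P n) u := (contDiff_critSystem κ P n).contDiffAt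
  have pn : (∞ : WithTop ℕ∞) ≠ 0 := by simp
  have if₂ := critSystem_isInvertible (κ := κ) (P := P) (n := n) (u := u)
    (h.offReal_snd_ne hS hz) (h.jacobian_ne_zero hS hz hv)
  have h0 : critSystem κ P n u = 0 := by
    refine Prod.ext ?_ ?_
    · exact sub_eq_zero.2 hS
    · exact sub_eq_zero.2 hv
  refine ⟨fun v' => cdf.implicitFunction pn if₂ (ι v'), ?_,
    cdf.implicitFunction_apply_self pn if₂, ?_⟩
  · exact ((cdf.contDiffAt_implicitFunction pn if₂).restrict_scalars ℝ).comp v hιs.contDiffAt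
  · have ht : Filter.Tendsto ι (𝓝 v) (𝓝 u.1) := hιs.continuous.continuousAt
    refine (ht.eventually (cdf.eventually_apply_implicitFunction pn if₂)).mono fun v' hv' => ?_
    rw [h0] at hv'
    exact ⟨sub_eq_zero.1 (congrArg Prod.fst hv'), sub_eq_zero.1 (congrArg Prod.snd hv')⟩

end IsHarnackPair

/-- The points of `ℂ²` at which `critParam` is smooth. -/
def regularSet (n : ℝ[X]) : Set (ℂ × ℂ) :=
  {S | S.1 - 1 ≠ 0 ∧ S.2 ≠ 0} ∩ {S | (logDer n S).im ≠ 0}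

theorem contDiffOn_logDer (n : ℝ[X]) :
    ContDiffOn ℝ ∞ (logDer n) {S | S.1 - 1 ≠ 0 ∧ S.2 ≠ 0} := by
  refine ContDiffOn.restrict_scalars (𝕜' := ℂ) ℝ (ContDiffOn.div ?_ ?_ ?_)
  · exact (contDiff_fst.mul ((n.contDiff_aeval ∞).comp contDiff_fst)).contDiffOn
  · exact ((contDiff_fst.sub contDiff_const).mul contDiff_snd).contDiffOn
  · rintro S ⟨h1, h2⟩
    exact mul_ne_zero h1 h2

theorem isOpen_regularSet (n : ℝ[X]) : IsOpen (regularSet n) := by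
  have h1 : IsOpen {S : ℂ × ℂ | S.1 - 1 ≠ 0 ∧ S.2 ≠ 0} :=
    (isOpen_ne_fun (by fun_prop) (by fun_prop)).inter (isOpen_ne_fun (by fun_prop) (by fun_prop))
  have h2 : ContinuousOn (fun S => (logDer n S).im) {S : ℂ × ℂ | S.1 - 1 ≠ 0 ∧ S.2 ≠ 0} :=
    Complex.continuous_im.comp_continuousOn (contDiffOn_logDer n).continuousOn
  exact h2.isOpen_inter_preimage h1 isOpen_ne

theorem contDiffOn_critParam (κ : ℝ) (n : ℝ[X]) :
    ContDiffOn ℝ ∞ (critParam κ n) (regularSet n) := by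
  have hY := (contDiffOn_logDer n).mono (Set.inter_subset_left : regularSet n ⊆ _)
  have hy : ContDiffOn ℝ ∞ (fun S : ℂ × ℂ => (S.1 + 1) / (S.1 - 1)) (regularSet n) := by
    refine ContDiffOn.restrict_scalars (𝕜' := ℂ) ℝ (ContDiffOn.div ?_ ?_ fun S hS => hS.1.1)
    · exact (contDiff_fst.add contDiff_const).contDiffOn
    · exact (contDiff_fst.sub contDiff_const).contDiffOn
  have hYi : ContDiffOn ℝ ∞ (fun S => (logDer n S).im) (regularSet n) :=
    Complex.imCLM.contDiff.comp_contDiffOn hY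
  have hYr : ContDiffOn ℝ ∞ (fun S => (logDer n S).re) (regularSet n) :=
    Complex.reCLM.contDiff.comp_contDiffOn hY
  have hyi : ContDiffOn ℝ ∞ (fun S : ℂ × ℂ => ((S.1 + 1) / (S.1 - 1)).im) (regularSet n) :=
    Complex.imCLM.contDiff.comp_contDiffOn hy
  have hyr : ContDiffOn ℝ ∞ (fun S : ℂ × ℂ => ((S.1 + 1) / (S.1 - 1)).re) (regularSet n) :=
    Complex.reCLM.contDiff.comp_contDiffOn hy
  refine ContDiffOn.prodMk ?_ ?_
  · exact (contDiffOn_const.mul hyi).div (contDiffOn_const.mul hYi)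
      fun S hS => mul_ne_zero two_ne_zero hS.2
  · exact hyr.sub ((hyi.div hYi fun S hS => hS.2).mul hYr)

theorem CritEq.conj {κ : ℝ} {n : ℝ[X]} {v : ℝ × ℝ} {z w : ℂ} (hv : CritEq κ n v (z, w)) :
    CritEq κ n v ((starRingEnd ℂ) z, (starRingEnd ℂ) w) := by
  have := congrArg (starRingEnd ℂ) hv
  simp [← aeval_conj_real, map_ofNat] at this
  exact this

/-! ### The main theorem -/

section

variable {k : ℕ} (hk : 0 < k) (α β : Fin k → ℝ) (hα : ∀ m, 0 < α m) (hβ : ∀ m, 0 < β m)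
  (hαβ : ∏ m, α m = ∏ m, β m)
include hk hα hβ hαβ

/-- The critical points in `ℛ₁₂` are described by the map `critParam` on one half of the curve. -/
theorem exists_half_curve : ∃ (n : ℝ[X]) (H : Set (Curve α β)),
    IsHarnackPair (kPrime α β - 1) k (p0 α β) n (x α β) ∧ IsOpen H ∧
    R12 α β = (↑) '' H ∧ (∀ S ∈ H, OffReal (p0 α β) S.1.1) ∧
    (∀ S ∈ H, ∀ S' ∈ H, 0 < (logDer n S.1).im * (logDer n S'.1).im) ∧
    (∀ S ∈ H, ∀ v, IsCriticalPoint α β v (S : Surface α β) ↔ CritEq k n v S.1) ∧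
    (∀ v, v ∈ roughRegion α β ↔ ∃ S ∈ H, CritEq k n v S.1) := by
  obtain ⟨n, hn, h⟩ := exists_isHarnackPair hk α β hα hβ hαβ
  obtain ⟨ε, hε, hR⟩ := exists_R12_eq h
  have hk' : 0 < kPrime α β := by
    have := (natDegree_p0 hk α β hα hβ).2.1
    unfold kPrime
    omega
  have hcrit : ∀ S : Curve α β, OffReal (p0 α β) S.1.1 → ∀ v,
      IsCriticalPoint α β v (S : Surface α β) ↔ CritEq k n v S.1 := fun S hS v =>
    isCriticalPoint_iff hk α β hα hβ hn (h.offReal_ne hS).1 (h.offReal_ne hS).2.1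
      (h.offReal_snd_ne (Curve.sq_eq S) hS) v
  have hoff : ∀ S : Curve α β, 0 < ε * (logDer n S.1).im → OffReal (p0 α β) S.1.1 :=
    fun S hS => (logDer_im_ne_zero_iff h).1 fun h0 => by simp [h0] at hS
  refine ⟨n, {S | 0 < ε * (logDer n S.1).im}, h, isOpen_logDer_im h ε, hR, hoff, ?_,
    fun S hS => hcrit S (hoff S hS), fun v => ⟨?_, ?_⟩⟩
  · intro S hS S' hS'
    have h1 : 0 < (ε * (logDer n S.1).im) * (ε * (logDer n S'.1).im) := mul_pos hS hS'
    have h2 : 0 < ε ^ 2 := by positivity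
    refine pos_of_mul_pos_right (a := ε ^ 2) ?_ h2.le
    linarith
  · rintro ⟨-, P, hP, hcr⟩
    obtain ⟨S, rfl, -⟩ := id hcr
    have hS : OffReal (p0 α β) S.1.1 := by
      rw [mem_realLocus_iff h hk'] at hP
      exact not_not.1 hP
    have hv := (hcrit S hS v).1 hcr
    have hY := mul_ne_zero hε ((logDer_im_ne_zero_iff h).2 hS)
    -- The equation has real parameters, so the conjugate of a critical point is also critical, and
    -- exactly one of the two lies in the chosen half.
    rcases lt_or_gt_of_ne hY with hlt | hgt
    · refine ⟨curveConj S, ?_, CritEq.conj hv⟩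
      change 0 < ε * (logDer n (curveConj S).1).im
      rw [logDer_curveConj, Complex.conj_im]
      linarith
    · exact ⟨S, hgt, hv⟩
  · rintro ⟨S, hS, hv⟩
    have hSo := hoff S hS
    refine ⟨h.critEq_mem (Curve.sq_eq S) hSo hv, (S : Surface α β), ?_, (hcrit S hSo v).2 hv⟩
    rw [mem_realLocus_iff h hk']
    exact not_not.2 hSo

end

end Aztec

theorem mainTheorem8 (k : ℕ) (hk : 0 < k) (α β : Fin k → ℝ)
    (hα : ∀ m, 0 < α m) (hβ : ∀ m, 0 < β m) (hαβ : ∏ m, α m = ∏ m, β m) :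
    (∀ v ∈ Aztec.roughRegion α β,
      ∃! P : Aztec.Surface α β, P ∈ Aztec.R12 α β ∧ Aztec.IsCriticalPoint α β v P) ∧
    ∃ L : ℝ × ℝ → Aztec.Surface α β,
      (∀ v ∈ Aztec.roughRegion α β,
        L v ∈ Aztec.R12 α β ∧ Aztec.IsCriticalPoint α β v (L v)) ∧
      Aztec.IsDiffeomorphism α β L (Aztec.roughRegion α β) (Aztec.R12 α β) := by
  obtain ⟨n, H, h, hopen, hR, hoff, hsign, hcrit, hrough⟩ :=
    Aztec.exists_half_curve hk α β hα hβ hαβ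
  have huniq : ∀ S ∈ H, ∀ S' ∈ H, ∀ v, Aztec.CritEq k n v S.1 → Aztec.CritEq k n v S'.1 →
      S = S' := fun S hS S' hS' v hv hv' => Subtype.ext <|
    h.critEq_unique (Aztec.Curve.sq_eq S) (hoff S hS) (Aztec.Curve.sq_eq S') (hoff S' hS') hv hv'
      (hsign S hS S' hS')
  have hreg : ∀ S ∈ H, S.1 ∈ Aztec.regularSet n := fun S hS =>
    ⟨⟨sub_ne_zero.2 (h.offReal_ne (hoff S hS)).2.1,
      h.offReal_snd_ne (Aztec.Curve.sq_eq S) (hoff S hS)⟩,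
      h.logDer_im_ne_zero (Aztec.Curve.sq_eq S) (hoff S hS)⟩
  have hparam : ∀ S ∈ H, ∀ v, Aztec.CritEq k n v S.1 ↔ v = Aztec.critParam k n S.1 :=
    fun S hS v => Aztec.critEq_iff h.kappa_pos.ne' (sub_ne_zero.1 (hreg S hS).1.1)
      (hreg S hS).1.2 (hreg S hS).2 v
  have hch : ∀ v, ∃ S : Aztec.Surface α β, v ∈ Aztec.roughRegion α β →
      ∃ T ∈ H, S = ↑T ∧ Aztec.CritEq k n v T.1 := by
    intro v
    by_cases hv : v ∈ Aztec.roughRegion α β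
    · obtain ⟨S, hS, hc⟩ := (hrough v).1 hv
      exact ⟨S, fun _ => ⟨S, hS, rfl, hc⟩⟩
    -- Outside the rough region the value of L is irrelevant.
    · exact ⟨OnePoint.infty, fun hv' => absurd hv' hv⟩
  choose L hL using hch
  have hLH : ∀ v ∈ Aztec.roughRegion α β, ∀ T ∈ H, Aztec.CritEq k n v T.1 → L v = ↑T := by
    intro v hv T hT hc
    obtain ⟨S, hS, e, hc'⟩ := hL v hv
    rw [e, huniq S hS T hT v hc' hc]
  -- the local smooth solution stays in the half curve
  have hloc : ∀ v ∈ Aztec.roughRegion α β, ∃ ψ : ℝ × ℝ → ℂ × ℂ, ContDiffAt ℝ ∞ ψ v ∧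
      ∀ᶠ v' in 𝓝 v, v' ∈ Aztec.roughRegion α β ∧ Aztec.affineCoord α β (L v') = ψ v' := by
    intro v hv
    obtain ⟨S, hS, -, hc⟩ := hL v hv
    obtain ⟨ψ, hψ, hψS, hev⟩ := h.exists_smooth_solution (Aztec.Curve.sq_eq S) (hoff S hS) hc
    obtain ⟨U, hU, hUH⟩ := isOpen_induced_iff.1 hopen
    have hSU : S.1 ∈ U := by
      have : S ∈ Subtype.val ⁻¹' U := by rw [hUH]; exact hS
      exact this
    have hnear : ∀ᶠ v' in 𝓝 v, ψ v' ∈ U :=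
      hψ.continuousAt.eventually (by rw [hψS]; exact hU.mem_nhds hSU)
    refine ⟨ψ, hψ, ?_⟩
    filter_upwards [hev, hnear] with v' ⟨h1, h2⟩ h3
    set T : Aztec.Curve α β := ⟨ψ v', sub_eq_zero.2 h1⟩
    have hT : T ∈ H := by rw [← hUH]; exact h3
    have hv' : v' ∈ Aztec.roughRegion α β := (hrough v').2 ⟨T, hT, h2⟩
    refine ⟨hv', ?_⟩
    rw [hLH v' hv' T hT h2]
    rfl
  have hLmem : ∀ v ∈ Aztec.roughRegion α β,
      L v ∈ Aztec.R12 α β ∧ Aztec.IsCriticalPoint α β v (L v) := by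
    intro v hv
    obtain ⟨S, hS, e, hc⟩ := hL v hv
    rw [e, hR]
    exact ⟨⟨S, hS, rfl⟩, (hcrit S hS v).2 hc⟩
  refine ⟨fun v hv => ⟨L v, hLmem v hv, ?_⟩, L, hLmem, ?_, ?_, ?_, ⟨?_, ?_, ?_⟩, ?_, ?_⟩
  · rintro P ⟨hP, hcP⟩
    rw [hR] at hP
    obtain ⟨T, hT, rfl⟩ := hP
    exact (hLH v hv T hT ((hcrit T hT v).1 hcP)).symm
  · rw [isOpen_iff_mem_nhds]
    intro v hv
    obtain ⟨ψ, -, hev⟩ := hloc v hv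
    exact hev.mono fun v' hv' => hv'.1
  · exact isOpen_interior
  · rw [hR]
    rintro ⟨S, -, e⟩
    exact OnePoint.coe_ne_infty S e
  · exact fun v hv => (hLmem v hv).1
  · intro v hv v' hv' e
    obtain ⟨S, hS, e1, hc⟩ := hL v hv
    obtain ⟨S', hS', e2, hc'⟩ := hL v' hv'
    have : S = S' := OnePoint.coe_injective (by rw [← e1, ← e2, e])
    subst this
    rw [(hparam S hS v).1 hc, (hparam S hS v').1 hc']
  · intro P hP
    rw [hR] at hP
    obtain ⟨T, hT, rfl⟩ := hP
    have hc := (hparam T hT _).2 rfl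
    have hv := (hrough _).2 ⟨T, hT, hc⟩
    exact ⟨_, hv, hLH _ hv T hT hc⟩
  · intro v hv
    obtain ⟨ψ, hψ, hev⟩ := hloc v hv
    exact (hψ.congr_of_eventuallyEq (hev.mono fun v' hv' => hv'.2)).contDiffWithinAt
  · intro P hP
    rw [hR] at hP
    obtain ⟨T, hT, rfl⟩ := hP
    -- The formula for (χ, η) makes sense on an open subset of ℂ², not only on the curve, so one
    -- neighbourhood and one smooth extension of the inverse serve all points.
    refine ⟨Aztec.regularSet n, Aztec.isOpen_regularSet n, hreg T hT, Aztec.critParam k n,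
      Aztec.contDiffOn_critParam k n, fun v hv _ => ?_⟩
    obtain ⟨S, hS, e, hc⟩ := hL v hv
    rw [e]
    exact ((hparam S hS v).1 hc).symm
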